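/- Let $f:\mathbb Z^d\to[0,\infty)$ have finite support and $\sum_z f(z)=1$, put $p_{\max}=\inf_{z:\,f(z)>0}1/f(z)$, and let $p\in[0,p_{\max}]$. In oriented percolation on $\mathbb N\times\mathbb Z^d$ each edge $((n,x),(n+1,y))$, $n\ge 0$, $x,y\in\mathbb Z^d$, is open with probability $p\,f(y-x)$, independently of the others; the law is denoted $\mathbb P_p$. Let $\mathcal P$ be the event that there is an infinite open oriented path starting at the origin, and let $Z_N$ be the number of open oriented paths of length $N$ starting at the origin. Let $\textsc{f}(p)\in[-\infty,\infty)$ be the $\mathbb P_p(\cdot\mid\mathcal P)$-almost sure (constant) value of $\limsup_{N\to\infty}\frac1N\log Z_N$ if $\mathbb P_p(\mathcal P)>0$, and $\textsc{f}(p)=-\infty$ otherwise. The second threshold of $f$ is $$p_c^{(2)}=\inf\{p\in(0,p_{\max}]\;:\;\textsc{f}(p)=\log p\},$$ with $p_c^{(2)}=p_{\max}$ if this set is empty. Write $f^{*n}$ for the $n$-fold discrete convolution of $f$ with itself. Theorem 1. (i) For the nearest-neighbour model $f(z)=\frac1{2d}\mathbf 1_{\{|z_1|+\dots+|z_d|=1\}}$,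 the second threshold $p_c^{(2)}(d)$ satisfies, as $d\to\infty$, $$p_c^{(2)}(d)\;\ge\;1+\frac{\log 2}{2d^2}+o(d^{-2}).$$ (ii) Let $d\ge3$ and let $F:\mathbb R^d\to[0,\infty)$ be continuous with compact support, invariant under each reflection $(x_1,\dots,x_i,\dots,x_d)\mapsto(x_1,\dots,-x_i,\dots,x_d)$, with $\int F(x)\,dx=1$. For the generalized spread-out model $f_L(x)=F(x/L)/\sum_{y\in\mathbb Z^d}F(y/L)$, $L\in\mathbb N$, the series $\sum_{k\ge2}f_L^{*2k}(0)$ converges for all large $L$, and the second threshold $p_c^{(2)}(d,L)$ satisfies, as $L\to\infty$ (with $d$ and $F$ fixed), $$p_c^{(2)}(d,L)\;\ge\;1+\log 2\sum_{k=2}^\infty f_L^{*2k}(0)+O(L^{-3d/2}).$$ -/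

import Mathlib

open MeasureTheory ProbabilityTheory Filter Asymptotics

/-- The sites of the transversal lattice `ℤ^d`. -/
abbrev Site (d : ℕ) : Type := Fin d → ℤ

/-- The oriented edges `((n, x), (n + 1, y))` of `ℕ × ℤ^d`, encoded as triples `(n, x, y)`. -/
abbrev OEdge (d : ℕ) : Type := ℕ × Site d × Site d

/-- A percolation environment: the value at an edge is `true` if the edge is open. -/
abbrev Env (d : ℕ) : Type := OEdge d → Bool

/-- The law of the environment with kernel `f` and parameter `p`: the edges are independent,
and the edge `((n, x), (n + 1, y))` is open with probability `p * f (y - x)`.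
(The projection onto `[0, 1]` has no effect for `0 ≤ p ≤ pMax f`.) -/
noncomputable def percLaw {d : ℕ} (f : Site d → ℝ) (p : ℝ) : Measure (Env d) :=
  Measure.infinitePi fun e : OEdge d =>
    bernoulliMeasure true false
      (Set.projIcc (0 : ℝ) 1 zero_le_one (p * f (e.2.2 - e.2.1)))

/-- `pMax f` is the infimum of `1 / f z` over the sites with `f z > 0`
(where `f z = 0`, the quotient `1 / f z` is understood as `+∞`). -/
noncomputable def pMax {d : ℕ} (f : Site d → ℝ) : ℝ :=
  sInf ((fun z => 1 / f z) '' {z | 0 < f z})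

/-- The event that there is an infinite open path from the origin. -/
def percEvent (d : ℕ) : Set (Env d) :=
  {X | ∃ S : ℕ → Site d, S 0 = 0 ∧ ∀ n, X (n, S n, S (n + 1)) = true}

/-- The open oriented paths of length `N` from the origin. -/
def openPaths {d : ℕ} (X : Env d) (N : ℕ) : Set (Fin (N + 1) → Site d) :=
  {S | S 0 = 0 ∧ ∀ i : Fin N, X ((i : ℕ), S i.castSucc, S i.succ) = true}

/-- `Z_N`, the number of open oriented paths of length `N` from the origin. -/
noncomputable def numPaths {d : ℕ} (X : Env d) (N : ℕ) : ENNReal :=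
  ((openPaths X N).encard : ENNReal)

/-- The upper growth rate `limsup (1 / N) log Z_N`, with `log 0 = -∞`. -/
noncomputable def upperRate {d : ℕ} (X : Env d) : EReal :=
  limsup (fun N : ℕ => ENNReal.log (numPaths X N) / (N : EReal)) atTop

open Classical in
/-- The almost sure value of the upper growth rate given percolation from the origin, and `-∞`
if percolation has probability `0`. The essential supremum extracts that value, see
`growthRate_eq`. -/
noncomputable def growthRate {d : ℕ} (f : Site d → ℝ) (p : ℝ) : EReal :=
  if percLaw f p (percEvent d) = 0 then ⊥
  else essSup upperRate (cond (percLaw f p) (percEvent d))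

theorem growthRate_eq {d : ℕ} (f : Site d → ℝ) (p : ℝ) (a : EReal)
    (h : percLaw f p (percEvent d) ≠ 0)
    (ha : ∀ᵐ X ∂(cond (percLaw f p) (percEvent d)), upperRate X = a) :
    growthRate f p = a := by
  have : IsProbabilityMeasure (percLaw f p) := by unfold percLaw; infer_instance
  have := cond_isProbabilityMeasure h
  rw [growthRate, if_neg h, essSup_congr_ae (g := fun _ => a) ha,
    essSup_const' a]

open Classical in
/-- The second threshold: the infimum of the `p ∈ (0, pMax f]` with `growthRate f p = log p`,
and `pMax f` if there is no such `p`. -/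
noncomputable def secondThreshold {d : ℕ} (f : Site d → ℝ) : ℝ :=
  if {p : ℝ | p ∈ Set.Ioc 0 (pMax f) ∧ growthRate f p = (Real.log p : EReal)}.Nonempty then
    sInf {p : ℝ | p ∈ Set.Ioc 0 (pMax f) ∧ growthRate f p = (Real.log p : EReal)}
  else pMax f

/-- The nearest-neighbour kernel on `ℤ^d`. -/
noncomputable def nearestNeighbor (d : ℕ) : Site d → ℝ :=
  fun z => if ∑ i, |z i| = 1 then 1 / (2 * (d : ℝ)) else 0

/-- The generalized spread-out kernel with profile `F` and range `L`. -/
noncomputable def spreadOut {d : ℕ} (F : (Fin d → ℝ) → ℝ) (L : ℕ) : Site d → ℝ :=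
  fun x => F (fun i => (x i : ℝ) / (L : ℝ)) / ∑' y : Site d, F (fun i => (y i : ℝ) / (L : ℝ))

/-- The `n`-th discrete convolution power of `f`; the `0`-th power is the unit mass at `0`. -/
noncomputable def convPow {d : ℕ} (f : Site d → ℝ) : ℕ → Site d → ℝ
  | 0 => fun x => if x = 0 then 1 else 0
  | n + 1 => fun x => ∑' y : Site d, convPow f n y * f (x - y)

/-! The mean number of open paths of length `N` is `p ^ N`, so the point is that for `p` slightly
above `1` the typical growth rate stays strictly below `log p`. This is shown with fractional
moments. For `0 < θ ≤ 1` the sum over endpoints of `E[count ^ θ]` is submultiplicative in the length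
(`fracMoment_add_le`), so a single block length `M` at which it is smaller than `p ^ (θ M)` already
gives the strict inequality (`growthRate_lt_of_fracMoment_lt`).

Take `θ = 1 - ε`. Expanding one factor `count` over paths turns the fractional moment into a sum
over paths `s` of `E[1_{s open} count ^ (-ε)]`. An open path along which `N` open detours run in
disjoint time intervals forces `count ≥ 2 ^ N`, hence `count ^ (-ε) ≤ 1 - ε N log 2 + O(ε ^ 2)`. The
expected number of detours of length `k` per unit time, given that `s` is open and averaged over
`s`, is `p ^ k * firstMeet f k`. So the block condition amounts to `log p < log 2 * ∑ p ^ k *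
firstMeet f k`, up to errors (`growthRate_lt_of_detours`).

Detours may overlap. Only good detours are therefore counted: those for which no open ear, a path
joining two points of the path or the detour through other edges, is present. Good detours are
automatically disjoint in time (`IsGood.le_of_lt`, `IsGood.unique`), so they multiply the count
(`two_pow_card_le_count`). A union bound over ears shows that few detours are lost
(`percLaw_le_isGood`).

Finally `firstMeet f k` equals `f^{*2k}(0)` up to a quadratic error (`le_firstMeet`). For the
nearest-neighbour kernel the detours of length `2`, counted by hand, suffice. For the spread-out
kernel all lengths up to `L ^ d` are used, together with the uniform bound `f^{*k} ≤ C L^{-d}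
k^{-3/2}`. That bound comes from writing `f` as a mixture of a cube law and a remainder
(`convPow_le_of_cube`): each power of the cube law inherits the flatness of the binomial
distribution. -/

/-! ### Walks, their edges and open edge sets. -/

/-- The position after `j` steps of the walk started at `0` with steps `t`. -/
def pos {d k : ℕ} (t : Fin k → Site d) (j : ℕ) : Site d :=
  ∑ i : Fin k, if (i : ℕ) < j then t i else 0

lemma pos_zero {d k : ℕ} (t : Fin k → Site d) : pos t 0 = 0 := by simp [pos]

lemma pos_succ {d k : ℕ} (t : Fin k → Site d) (i : Fin k) :
    pos t (i + 1) = pos t i + t i := by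
  unfold pos
  rw [← Finset.add_sum_erase _ _ (Finset.mem_univ i),
    ← Finset.add_sum_erase (a := i) _ (fun j : Fin k => if (j : ℕ) < (i : ℕ) then t j else 0)
      (Finset.mem_univ i)]
  simp only [lt_add_iff_pos_right, zero_lt_one, if_true, lt_irrefl, if_false, zero_add]
  rw [add_comm]
  congr 1
  refine Finset.sum_congr rfl fun j hj => ?_
  have : (j : ℕ) ≠ i := fun h => (Finset.ne_of_mem_erase hj) (Fin.ext h)
  have h2 : ((j : ℕ) < i + 1) ↔ ((j : ℕ) < i) := by omega
  simp [h2]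

lemma pos_neg {d k : ℕ} (t : Fin k → Site d) (j : ℕ) : pos (-t) j = - pos t j := by
  simp [pos, ← Finset.sum_neg_distrib, apply_ite]

lemma pos_increments {d : ℕ} (η : ℕ → Site d) (a k j : ℕ) (hj : j ≤ k) :
    pos (fun i : Fin k => η (a + i + 1) - η (a + i)) j = η (a + j) - η a := by
  induction j with
  | zero => simp [pos_zero]
  | succ j ih =>
    have := pos_succ (fun i : Fin k => η (a + i + 1) - η (a + i)) ⟨j, hj⟩
    simp only at this
    rw [this, ih (by omega), ← add_assoc]
    abel

lemma pos_append_left {d a b : ℕ} (r : Fin a → Site d) (u : Fin b → Site d) {j : ℕ}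
    (hj : j ≤ a) : pos (Fin.append r u) j = pos r j := by
  simp only [pos, Fin.sum_univ_add, Fin.append_left, Fin.append_right, Fin.val_castAdd,
    Fin.val_natAdd]
  rw [Finset.sum_eq_zero (s := (Finset.univ : Finset (Fin b))), add_zero]
  intro i _
  rw [if_neg (by omega)]

lemma pos_append_right {d a b : ℕ} (r : Fin a → Site d) (u : Fin b → Site d) (j : ℕ) :
    pos (Fin.append r u) (a + j) = pos r a + pos u j := by
  simp only [pos, Fin.sum_univ_add, Fin.append_left, Fin.append_right, Fin.val_castAdd,
    Fin.val_natAdd]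
  congr 1
  · refine Finset.sum_congr rfl fun i _ => ?_
    rw [if_pos (by omega), if_pos i.2]
  · refine Finset.sum_congr rfl fun i _ => ?_
    simp

lemma pos_injective {d k : ℕ} {s t : Fin k → Site d} (h : ∀ j ≤ k, pos s j = pos t j) :
    s = t := by
  funext i
  have h1 := pos_succ s i
  have h2 := pos_succ t i
  rw [h _ i.2, h _ i.2.le, h2] at h1
  exact (add_left_cancel h1).symm

/-- The edges of the path started at `(n, x)` with steps `t`. -/
def stepEdge {d k : ℕ} (n : ℕ) (x : Site d) (t : Fin k → Site d) (i : Fin k) : OEdge d :=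
  (n + i, x + pos t i, x + pos t (i + 1))

lemma stepEdge_injective {d k : ℕ} (n : ℕ) (x : Site d) (t : Fin k → Site d) :
    Function.Injective (stepEdge n x t) := by
  intro i j h
  have := congrArg Prod.fst h
  simp only [stepEdge] at this
  exact Fin.ext (by omega)

/-- The set of edges of the path started at `(n, x)` with steps `t`. -/
def stepEdges {d k : ℕ} (n : ℕ) (x : Site d) (t : Fin k → Site d) : Finset (OEdge d) :=
  Finset.univ.image (stepEdge n x t)

lemma mem_stepEdges {d k : ℕ} {n : ℕ} {x : Site d} {t : Fin k → Site d} {e : OEdge d} :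
    e ∈ stepEdges n x t ↔ ∃ i, stepEdge n x t i = e := by
  simp [stepEdges]

/-- All the edges of `E` are open. -/
def AllOpen {d : ℕ} (X : Env d) (E : Finset (OEdge d)) : Prop := ∀ e ∈ E, X e = true

lemma allOpen_stepEdges {d k : ℕ} {X : Env d} {n : ℕ} {x : Site d} {t : Fin k → Site d} :
    AllOpen X (stepEdges n x t) ↔ ∀ i, X (stepEdge n x t i) = true := by
  simp [AllOpen, stepEdges]

lemma allOpen_union {d : ℕ} {X : Env d} {E E' : Finset (OEdge d)} :
    AllOpen X (E ∪ E') ↔ AllOpen X E ∧ AllOpen X E' := by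
  simp only [AllOpen, Finset.mem_union]
  exact ⟨fun h => ⟨fun e he => h e (Or.inl he), fun e he => h e (Or.inr he)⟩,
    fun h e he => he.elim (h.1 e) (h.2 e)⟩

lemma allOpen_stepEdges_append {d a b : ℕ} {X : Env d} {n : ℕ} {x : Site d}
    {r : Fin a → Site d} {u : Fin b → Site d} :
    AllOpen X (stepEdges n x (Fin.append r u)) ↔
      AllOpen X (stepEdges n x r) ∧ AllOpen X (stepEdges (n + a) (x + pos r a) u) := by
  have h1 : ∀ i : Fin a, stepEdge n x (Fin.append r u) (Fin.castAdd b i) = stepEdge n x r i := by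
    intro i
    simp only [stepEdge, Fin.val_castAdd]
    rw [pos_append_left _ _ i.2.le, pos_append_left _ _ i.2]
  have h2 : ∀ i : Fin b, stepEdge n x (Fin.append r u) (Fin.natAdd a i) =
      stepEdge (n + a) (x + pos r a) u i := by
    intro i
    simp only [stepEdge, Fin.val_natAdd]
    rw [pos_append_right, add_assoc a, pos_append_right]
    simp only [add_assoc]
  simp only [allOpen_stepEdges]
  constructor
  · intro h
    exact ⟨fun i => h1 i ▸ h _, fun i => h2 i ▸ h _⟩
  · rintro ⟨ha, hb⟩ i
    induction i using Fin.addCases with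
    | left i => rw [h1]; exact ha i
    | right i => rw [h2]; exact hb i

lemma measurableSet_allOpen {d : ℕ} (E : Finset (OEdge d)) :
    MeasurableSet {X : Env d | AllOpen X E} := by
  have : {X : Env d | AllOpen X E} = ⋂ e ∈ E, {X : Env d | X e = true} := by
    ext X; simp [AllOpen]
  rw [this]
  exact Finset.measurableSet_biInter _ fun e _ =>
    measurableSet_eq_fun (measurable_pi_apply e) measurable_const

instance {d : ℕ} (f : Site d → ℝ) (p : ℝ) : IsProbabilityMeasure (percLaw f p) := by
  unfold percLaw; infer_instance

/-! ### Probabilities of open edge sets. -/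

/-- `f` is a probability kernel and `p > 0` is such that all the `p * f z` are probabilities. -/
structure Admissible {d : ℕ} (f : Site d → ℝ) (p : ℝ) : Prop where
  nonneg : ∀ z, 0 ≤ f z
  mass : ∑' z, ENNReal.ofReal (f z) = 1
  pos : 0 < p
  le_one : ∀ z, p * f z ≤ 1

/-- The weight of a step sequence. -/
noncomputable def wt {d k : ℕ} (f : Site d → ℝ) (t : Fin k → Site d) : ENNReal :=
  ∏ i, ENNReal.ofReal (f (t i))

lemma percLaw_edge {d : ℕ} {f : Site d → ℝ} {p : ℝ} (h : Admissible f p) (z : Site d) :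
    bernoulliMeasure true false (Set.projIcc (0 : ℝ) 1 zero_le_one (p * f z)) {true} =
      ENNReal.ofReal (p * f z) := by
  rw [bernoulliMeasure_apply_of_mem_of_notMem _ (measurableSet_singleton _) (Set.mem_singleton _)
    (by simp)]
  have : Set.projIcc (0 : ℝ) 1 zero_le_one (p * f z) =
    ⟨p * f z, mul_nonneg h.pos.le (h.nonneg z), h.le_one z⟩ := Set.projIcc_of_mem _ _
  rw [this, ENNReal.ofReal, ENNReal.coe_inj]
  exact NNReal.eq (Real.coe_toNNReal _ (mul_nonneg h.pos.le (h.nonneg z))).symm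

lemma percLaw_allOpen {d : ℕ} {f : Site d → ℝ} {p : ℝ} (h : Admissible f p)
    (E : Finset (OEdge d)) :
    percLaw f p {X | AllOpen X E} = ∏ e ∈ E, ENNReal.ofReal (p * f (e.2.2 - e.2.1)) := by
  have : {X : Env d | AllOpen X E} = Set.pi (E : Set (OEdge d)) (fun _ => {true}) := by
    ext X; simp [AllOpen, Set.mem_pi]
  rw [this, percLaw, Measure.infinitePi_pi]
  · exact Finset.prod_congr rfl fun e _ => percLaw_edge h _
  · intro i _; exact measurableSet_singleton _

lemma prod_stepEdges {d k : ℕ} {f : Site d → ℝ} {p : ℝ} (h : Admissible f p) (n : ℕ)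
    (x : Site d) (t : Fin k → Site d) :
    ∏ e ∈ stepEdges n x t, ENNReal.ofReal (p * f (e.2.2 - e.2.1)) =
      ENNReal.ofReal p ^ k * wt f t := by
  rw [stepEdges, Finset.prod_image (fun i _ j _ hij => stepEdge_injective n x t hij)]
  have : ∀ i : Fin k, ENNReal.ofReal
      (p * f ((stepEdge n x t i).2.2 - (stepEdge n x t i).2.1)) =
      ENNReal.ofReal p * ENNReal.ofReal (f (t i)) := by
    intro i
    simp only [stepEdge]
    rw [pos_succ, ENNReal.ofReal_mul h.pos.le]
    congr 3
    abel
  simp only [this, Finset.prod_mul_distrib, Finset.prod_const, Finset.card_univ,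
    Fintype.card_fin, wt]

lemma percLaw_stepEdges {d k : ℕ} {f : Site d → ℝ} {p : ℝ} (h : Admissible f p) (n : ℕ)
    (x : Site d) (t : Fin k → Site d) :
    percLaw f p {X | AllOpen X (stepEdges n x t)} = ENNReal.ofReal p ^ k * wt f t := by
  rw [percLaw_allOpen h, prod_stepEdges h]

lemma percLaw_union {d : ℕ} {f : Site d → ℝ} {p : ℝ} (h : Admissible f p)
    {E E' : Finset (OEdge d)} (hd : Disjoint E E') :
    percLaw f p {X | AllOpen X (E ∪ E')} =
      percLaw f p {X | AllOpen X E} * percLaw f p {X | AllOpen X E'} := by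
  simp only [percLaw_allOpen h, Finset.prod_union hd]

/-! ### Sums over step sequences -/

lemma tsum_append {α : Type*} (a b : ℕ) (φ : (Fin (a + b) → α) → ENNReal) :
    ∑' t, φ t = ∑' (r : Fin a → α) (u : Fin b → α), φ (Fin.append r u) := by
  rw [← ENNReal.tsum_prod, ← (Fin.appendEquiv a b).tsum_eq]
  rfl

lemma tsum_prod_eq_pow {α : Type*} (k : ℕ) (w : α → ENNReal) :
    ∑' t : Fin k → α, ∏ i, w (t i) = (∑' z, w z) ^ k := by
  induction k with
  | zero => simp [tsum_fintype]
  | succ k ih =>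
    rw [← (Fin.consEquiv (fun _ : Fin (k + 1) => α)).tsum_eq, ENNReal.tsum_prod']
    simp only [Fin.consEquiv, Equiv.coe_fn_mk, Fin.prod_univ_succ, Fin.cons_zero, Fin.cons_succ,
      ENNReal.tsum_mul_left, ih, ENNReal.tsum_mul_right]
    rw [pow_succ']

lemma tsum_prod_eq_one {α ι : Type*} [Fintype ι] {w : α → ENNReal} (hw : ∑' z, w z = 1) :
    ∑' t : ι → α, ∏ i, w (t i) = 1 := by
  rw [← ((Fintype.equivFin ι).symm.arrowCongr (Equiv.refl α)).tsum_eq]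
  have := tsum_prod_eq_pow (Fintype.card ι) w
  rw [hw, one_pow] at this
  rw [← this]
  refine tsum_congr fun t => ?_
  exact Fintype.prod_equiv (Fintype.equivFin ι) _ _ fun i => rfl

/-- The weights of the coordinates outside the range of `e` sum to one and drop out. In
`tsum_detour`, `e` selects the time window of a path along which a detour runs. -/
lemma tsum_marginal {α ι κ : Type*} [Fintype ι] [Fintype κ] {w : α → ENNReal}
    (hw : ∑' z, w z = 1) (e : κ → ι) (he : Function.Injective e) (φ : (κ → α) → ENNReal) :
    ∑' s : ι → α, (∏ i, w (s i)) * φ (s ∘ e) = ∑' r : κ → α, (∏ i, w (r i)) * φ r := by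
  classical
  rw [← (Equiv.piEquivPiSubtypeProd (fun i => i ∈ Set.range e) (fun _ => α)).symm.tsum_eq,
    ENNReal.tsum_prod', ← ((Equiv.ofInjective e he).arrowCongr (Equiv.refl α)).tsum_eq]
  refine tsum_congr fun r => ?_
  have h1 : ∀ v : {i // i ∉ Set.range e} → α,
      ((Equiv.piEquivPiSubtypeProd (fun i => i ∈ Set.range e) (fun _ => α)).symm
        ((Equiv.ofInjective e he).arrowCongr (Equiv.refl α) r, v)) ∘ e = r := by
    intro v
    funext k
    simp [Equiv.piEquivPiSubtypeProd, Equiv.arrowCongr]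
  have h2 : ∀ v : {i // i ∉ Set.range e} → α,
      ∏ i, w ((Equiv.piEquivPiSubtypeProd (fun i => i ∈ Set.range e) (fun _ => α)).symm
        ((Equiv.ofInjective e he).arrowCongr (Equiv.refl α) r, v) i) =
      (∏ i, w (r i)) * ∏ i, w (v i) := by
    intro v
    rw [← Fintype.prod_subtype_mul_prod_subtype (fun i => i ∈ Set.range e) (fun i =>
      w ((Equiv.piEquivPiSubtypeProd (fun i => i ∈ Set.range e) (fun _ => α)).symm
        ((Equiv.ofInjective e he).arrowCongr (Equiv.refl α) r, v) i))]
    congr 1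
    · refine Finset.prod_bij' (fun i _ => (Equiv.ofInjective e he).symm i)
        (fun k _ => Equiv.ofInjective e he k) (by simp) (by simp) (by simp) (by simp) fun i _ => ?_
      have := i.2
      simp only [Set.mem_range] at this
      simp [Equiv.piEquivPiSubtypeProd, Equiv.arrowCongr, this]
    · refine Finset.prod_congr rfl fun i _ => ?_
      have := i.2
      simp only [Set.mem_range] at this
      simp [Equiv.piEquivPiSubtypeProd, this]
  simp only [h1, h2, ENNReal.tsum_mul_right, ENNReal.tsum_mul_left]
  rw [tsum_prod_eq_one hw, mul_one]

/-! ### Numbers of open paths between two points. -/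

open Classical in
/-- The number of open paths from `(n, x)` to `(n + k, y)`. -/
noncomputable def count {d : ℕ} (X : Env d) (n : ℕ) (x : Site d) (k : ℕ) (y : Site d) : ENNReal :=
  ∑' t : Fin k → Site d, if x + pos t k = y ∧ AllOpen X (stepEdges n x t) then 1 else 0

lemma count_add {d : ℕ} (X : Env d) (n : ℕ) (x : Site d) (a b : ℕ) (y : Site d) :
    count X n x (a + b) y = ∑' z, count X n x a z * count X (n + a) z b y := by
  classical
  unfold count
  rw [tsum_append]
  simp only [← ENNReal.tsum_mul_right]
  symm
  rw [ENNReal.tsum_comm]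
  refine tsum_congr fun r => ?_
  rw [tsum_eq_single (x + pos r a)]
  · rw [← ENNReal.tsum_mul_left]
    refine tsum_congr fun u => ?_
    simp only [allOpen_stepEdges_append, pos_append_right, ← add_assoc]
    by_cases h1 : AllOpen X (stepEdges n x r) <;> simp [h1]
  · intro z hz
    rw [if_neg (fun h => hz h.1.symm), zero_mul]

lemma count_mul_le {d : ℕ} (X : Env d) (n : ℕ) (x : Site d) (a b : ℕ) (y z : Site d) :
    count X n x a z * count X (n + a) z b y ≤ count X n x (a + b) y := by
  rw [count_add]
  exact ENNReal.le_tsum z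

/-- A gap between `0` and `1` gives `count ^ θ ≤ count` for `0 < θ ≤ 1`, and lets `count ^ (1 - ε)`
be split into `count * count ^ (-ε)` when the count is nonzero and finite. -/
lemma count_eq_zero_or_one_le {d : ℕ} (X : Env d) (n : ℕ) (x : Site d) (k : ℕ) (y : Site d) :
    count X n x k y = 0 ∨ 1 ≤ count X n x k y := by
  classical
  by_cases h : ∃ t : Fin k → Site d, x + pos t k = y ∧ AllOpen X (stepEdges n x t)
  · obtain ⟨t, ht⟩ := h
    right
    refine le_trans ?_ (ENNReal.le_tsum t)
    rw [if_pos ht]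
  · left
    refine ENNReal.tsum_eq_zero.2 fun t => ?_
    rw [if_neg fun ht => h ⟨t, ht⟩]

/-- The environment seen from `(n, x)`. -/
def shiftEnv {d : ℕ} (n : ℕ) (x : Site d) (X : Env d) : Env d :=
  fun e => X (n + e.1, x + e.2.1, x + e.2.2)

lemma count_shift {d : ℕ} (X : Env d) (n : ℕ) (x : Site d) (k : ℕ) (y : Site d) :
    count X n x k y = count (shiftEnv n x X) 0 0 k (y - x) := by
  unfold count
  refine tsum_congr fun t => ?_
  have h1 : x + pos t k = y ↔ 0 + pos t k = y - x := by
    rw [zero_add, eq_sub_iff_add_eq, add_comm]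
  have h2 : AllOpen X (stepEdges n x t) ↔ AllOpen (shiftEnv n x X) (stepEdges 0 0 t) := by
    simp [allOpen_stepEdges, shiftEnv, stepEdge]
  by_cases h : AllOpen X (stepEdges n x t)
  · by_cases h' : x + pos t k = y
    · rw [if_pos ⟨h', h⟩, if_pos ⟨h1.1 h', h2.1 h⟩]
    · rw [if_neg fun c => h' c.1, if_neg fun c => h' (h1.2 c.1)]
  · rw [if_neg fun c => h c.2, if_neg fun c => h (h2.2 c.2)]

/-- The marginals depend only on the increment of an edge, and the shift of edges is injective. It
is not surjective for `n > 0`, so the map forgets the early edges. -/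
lemma percLaw_map_shiftEnv {d : ℕ} (f : Site d → ℝ) (p : ℝ) (n : ℕ) (x : Site d) :
    (percLaw f p).map (shiftEnv n x) = percLaw f p := by
  have hinj : Function.Injective
      (fun e : OEdge d => ((n + e.1, x + e.2.1, x + e.2.2) : OEdge d)) := by
    rintro ⟨a, b, c⟩ ⟨a', b', c'⟩ h
    simpa using h
  have := Measure.map_infinitePi_infinitePi_of_inj (P := fun e : OEdge d =>
    bernoulliMeasure true false
      (Set.projIcc (0 : ℝ) 1 zero_le_one (p * f (e.2.2 - e.2.1)))) hinj
  simp only [add_sub_add_left_eq_sub] at this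
  exact this

lemma measurable_shiftEnv {d : ℕ} (n : ℕ) (x : Site d) :
    Measurable (shiftEnv n x : Env d → Env d) :=
  measurable_pi_lambda _ fun _ => measurable_pi_apply _

/-- The σ-algebra is left free so that independence can be applied with the σ-algebras of the edges
before and after a given time. -/
lemma measurable_count {d : ℕ} {m : MeasurableSpace (Env d)} (n : ℕ) (x : Site d) (k : ℕ)
    (y : Site d) (h : ∀ e : OEdge d, n ≤ e.1 → e.1 < n + k → Measurable[m] fun X : Env d => X e) :
    Measurable[m] fun X : Env d => count X n x k y := by
  classical
  unfold count
  refine Measurable.tsum fun t => ?_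
  by_cases hx : x + pos t k = y
  · simp only [hx, true_and, allOpen_stepEdges]
    refine Measurable.ite ?_ measurable_const measurable_const
    have : {X : Env d | ∀ i, X (stepEdge n x t i) = true} =
        ⋂ i, (fun X : Env d => X (stepEdge n x t i)) ⁻¹' {true} := by
      ext X; simp
    rw [this]
    refine MeasurableSet.iInter fun i => ?_
    refine h (stepEdge n x t i) ?_ ?_ (measurableSet_singleton _)
    · simp [stepEdge]
    · simp [stepEdge]
  · simp only [hx, false_and, if_false]
    exact measurable_const

lemma measurable_count' {d : ℕ} (n : ℕ) (x : Site d) (k : ℕ) (y : Site d) :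
    Measurable fun X : Env d => count X n x k y :=
  measurable_count n x k y fun e _ _ => measurable_pi_apply e

/-- The two factors depend on edges before and from time `n` on, hence are independent; the second
is then shifted to the origin. -/
lemma lintegral_count_mul {d : ℕ} (f : Site d → ℝ) (p : ℝ) (θ : ℝ) (n k : ℕ) (x y : Site d) :
    ∫⁻ X, count X 0 0 n x ^ θ * count X n x k y ^ θ ∂(percLaw f p) =
      (∫⁻ X, count X 0 0 n x ^ θ ∂(percLaw f p)) *
        ∫⁻ X, count X 0 0 k (y - x) ^ θ ∂(percLaw f p) := by
  have hind : iIndepFun (fun (e : OEdge d) (X : Env d) => X e) (percLaw f p) :=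
    iIndepFun_infinitePi (X := fun _ b => b) (fun _ => measurable_id)
  have hle : ∀ e : OEdge d, MeasurableSpace.comap (fun X : Env d => X e) inferInstance ≤
      (inferInstance : MeasurableSpace (Env d)) := fun e => (measurable_pi_apply e).comap_le
  have hdisj : Disjoint {e : OEdge d | e.1 < n} {e : OEdge d | n ≤ e.1} := by
    rw [Set.disjoint_left]
    intro e h1 h2
    simp only [Set.mem_ofPred_eq] at h1 h2
    omega
  have hI := indep_iSup_of_disjoint hle hind hdisj
  rw [lintegral_mul_eq_lintegral_mul_lintegral_of_independent_measurableSpace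
    (iSup₂_le fun e _ => hle e) (iSup₂_le fun e _ => hle e) hI]
  · congr 1
    have hmap := lintegral_map (μ := percLaw f p)
      ((measurable_count' 0 0 k (y - x)).pow_const θ) (measurable_shiftEnv n x)
    rw [percLaw_map_shiftEnv f p n x] at hmap
    rw [hmap]
    exact lintegral_congr fun X => by rw [← count_shift]
  · refine Measurable.pow_const (measurable_count 0 0 n x fun e _ he => ?_) _
    rw [measurable_iff_comap_le]
    exact le_iSup₂_of_le e (by simpa using he) le_rfl
  · refine Measurable.pow_const (measurable_count n x k y fun e he _ => ?_) _
    rw [measurable_iff_comap_le]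
    exact le_iSup₂_of_le e he le_rfl

/-! ### Fractional moments control the growth rate. -/

lemma ENNReal.tsum_rpow_le {ι : Type*} (a : ι → ENNReal) {θ : ℝ} (h0 : 0 < θ) (h1 : θ ≤ 1) :
    (∑' i, a i) ^ θ ≤ ∑' i, a i ^ θ := by
  classical
  have hfin : ∀ s : Finset ι, (∑ i ∈ s, a i) ^ θ ≤ ∑ i ∈ s, a i ^ θ := by
    intro s
    induction s using Finset.induction_on with
    | empty => simp [h0]
    | insert i s hi ih =>
      rw [Finset.sum_insert hi, Finset.sum_insert hi]
      exact (ENNReal.rpow_add_le_add_rpow _ _ h0.le h1).trans (by gcongr)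
  rw [← ENNReal.le_rpow_inv_iff h0, ENNReal.tsum_eq_iSup_sum]
  refine iSup_le fun s => ?_
  rw [ENNReal.le_rpow_inv_iff h0]
  exact (hfin s).trans (ENNReal.sum_le_tsum s)

/-- The fractional moment of the point-to-point numbers of open paths of length `N`. -/
noncomputable def fracMoment {d : ℕ} (f : Site d → ℝ) (p θ : ℝ) (N : ℕ) : ENNReal :=
  ∑' y, ∫⁻ X, count X 0 0 N y ^ θ ∂(percLaw f p)

/-- Paths are cut at time `N`, the power `θ ≤ 1` is moved inside the sum over the intermediate site
by subadditivity, and independence factorizes each term. -/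
lemma fracMoment_add_le {d : ℕ} (f : Site d → ℝ) (p : ℝ) {θ : ℝ} (h0 : 0 < θ) (h1 : θ ≤ 1)
    (N M : ℕ) : fracMoment f p θ (N + M) ≤ fracMoment f p θ N * fracMoment f p θ M := by
  have key : ∀ y, ∫⁻ X, count X 0 0 (N + M) y ^ θ ∂(percLaw f p) ≤
      ∑' z, (∫⁻ X, count X 0 0 N z ^ θ ∂(percLaw f p)) *
        ∫⁻ X, count X 0 0 M (y - z) ^ θ ∂(percLaw f p) := by
    intro y
    calc ∫⁻ X, count X 0 0 (N + M) y ^ θ ∂(percLaw f p)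
        ≤ ∫⁻ X, ∑' z, count X 0 0 N z ^ θ * count X N z M y ^ θ ∂(percLaw f p) := by
          refine lintegral_mono fun X => ?_
          simp only
          rw [count_add, zero_add]
          refine (ENNReal.tsum_rpow_le _ h0 h1).trans_eq (tsum_congr fun z => ?_)
          exact ENNReal.mul_rpow_of_nonneg _ _ h0.le
      _ = _ := by
          rw [lintegral_tsum]
          · exact tsum_congr fun z => lintegral_count_mul f p θ N M z y
          · intro z
            exact (((measurable_count' _ _ _ _).pow_const _).mul
              ((measurable_count' _ _ _ _).pow_const _)).aemeasurable
  calc fracMoment f p θ (N + M)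
      ≤ ∑' y, ∑' z, (∫⁻ X, count X 0 0 N z ^ θ ∂(percLaw f p)) *
        ∫⁻ X, count X 0 0 M (y - z) ^ θ ∂(percLaw f p) := ENNReal.tsum_le_tsum key
    _ = ∑' z, (∫⁻ X, count X 0 0 N z ^ θ ∂(percLaw f p)) * fracMoment f p θ M := by
        rw [ENNReal.tsum_comm]
        refine tsum_congr fun z => ?_
        rw [ENNReal.tsum_mul_left]
        congr 1
        exact (Equiv.subRight z).tsum_eq
          (fun y => ∫⁻ X, count X 0 0 M y ^ θ ∂(percLaw f p))
    _ = _ := by rw [ENNReal.tsum_mul_right]; rfl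

lemma lintegral_ite_allOpen {d : ℕ} (f : Site d → ℝ) (p : ℝ) (P : Prop) [Decidable P]
    (E : Finset (OEdge d)) [∀ X : Env d, Decidable (P ∧ AllOpen X E)] :
    ∫⁻ X, (if P ∧ AllOpen X E then (1 : ENNReal) else 0) ∂(percLaw f p) =
      if P then percLaw f p {X | AllOpen X E} else 0 := by
  by_cases hP : P
  · simp only [hP, true_and, if_true]
    rw [← lintegral_indicator_one (measurableSet_allOpen E)]
    refine lintegral_congr fun X => ?_
    by_cases h : AllOpen X E <;> simp [h, hP]
  · simp [hP]

lemma tsum_lintegral_count {d : ℕ} {f : Site d → ℝ} {p : ℝ} (h : Admissible f p) (N : ℕ) :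
    ∑' y, ∫⁻ X, count X 0 0 N y ∂(percLaw f p) = ENNReal.ofReal p ^ N := by
  classical
  have : ∀ y, ∫⁻ X, count X 0 0 N y ∂(percLaw f p) = ∑' t : Fin N → Site d,
      if 0 + pos t N = y then ENNReal.ofReal p ^ N * wt f t else 0 := by
    intro y
    unfold count
    rw [lintegral_tsum]
    · refine tsum_congr fun t => ?_
      rw [lintegral_ite_allOpen]
      simp only [percLaw_stepEdges h]
    · intro t
      refine Measurable.aemeasurable (Measurable.ite ?_ measurable_const measurable_const)
      exact (MeasurableSet.const _).inter (measurableSet_allOpen _)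
  simp only [this]
  rw [ENNReal.tsum_comm]
  have h2 : ∀ t : Fin N → Site d, (∑' y, if 0 + pos t N = y then ENNReal.ofReal p ^ N * wt f t
      else 0) = ENNReal.ofReal p ^ N * wt f t := fun t => tsum_ite_eq' _ _
  rw [tsum_congr h2]
  have h3 : ∑' t : Fin N → Site d, wt f t = 1 := tsum_prod_eq_one h.mass
  rw [ENNReal.tsum_mul_left, h3, mul_one]

lemma fracMoment_ne_top {d : ℕ} {f : Site d → ℝ} {p θ : ℝ} (h : Admissible f p) (h0 : 0 < θ)
    (h1 : θ ≤ 1) (N : ℕ) : fracMoment f p θ N ≠ ⊤ := by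
  refine ne_top_of_le_ne_top (ENNReal.pow_ne_top (ENNReal.ofReal_ne_top (r := p)) (n := N)) ?_
  rw [← tsum_lintegral_count h N]
  refine ENNReal.tsum_le_tsum fun y => lintegral_mono fun X => ?_
  rcases count_eq_zero_or_one_le X 0 0 N y with hz | hz
  · simp [hz, h0]
  · calc count X 0 0 N y ^ θ ≤ count X 0 0 N y ^ (1 : ℝ) := ENNReal.rpow_le_rpow_of_exponent_le hz h1
      _ = _ := ENNReal.rpow_one _

lemma numPaths_le {d : ℕ} (X : Env d) (N : ℕ) : numPaths X N ≤ ∑' y, count X 0 0 N y := by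
  classical
  have h1 : ∑' y, count X 0 0 N y = ∑' t : Fin N → Site d,
      if AllOpen X (stepEdges 0 0 t) then (1 : ENNReal) else 0 := by
    unfold count
    rw [ENNReal.tsum_comm]
    refine tsum_congr fun t => ?_
    by_cases h : AllOpen X (stepEdges 0 0 t)
    · simp only [h, and_true, if_true]
      exact tsum_ite_eq' _ _
    · simp [h]
  rw [h1, numPaths, ← ENNReal.tsum_set_one]
  -- The value `0` beyond time `N` is never read by `inc`.
  let ext : (Fin (N + 1) → Site d) → ℕ → Site d := fun S j => if hj : j < N + 1 then S ⟨j, hj⟩ else 0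
  let inc : openPaths X N → Fin N → Site d := fun S i => ext S.1 (0 + i + 1) - ext S.1 (0 + i)
  have hpos : ∀ (S : openPaths X N) (j : ℕ) (hj : j < N + 1), pos (inc S) j = S.1 ⟨j, hj⟩ := by
    intro S j hj
    have := pos_increments (ext S.1) 0 N j (by omega)
    simp only [inc]
    rw [this]
    have h0 : S.1 0 = 0 := S.2.1
    simp [ext, Nat.lt_succ_iff.1 hj, h0]
  have hinj : Function.Injective inc := by
    intro S S' hSS
    apply Subtype.ext
    funext i
    have h1 := hpos S i.1 i.2
    have h2 := hpos S' i.1 i.2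
    rw [hSS, h2] at h1
    exact h1.symm
  refine le_trans (le_of_eq (tsum_congr fun S => ?_))
    (ENNReal.tsum_comp_le_tsum_of_injective hinj _)
  rw [if_pos]
  rw [allOpen_stepEdges]
  intro i
  have := S.2.2 i
  simp only [stepEdge, zero_add]
  rw [hpos S i.1 (by omega), hpos S (i.1 + 1) (by omega)]
  exact this

/-- A partial sum `S` satisfies `S ≤ (first M terms) + κ * S`; since `S` is finite, this can be
solved for `S` with a bound uniform in the number of terms. -/
lemma ENNReal.tsum_ne_top_of_contract {a : ℕ → ENNReal} {M : ℕ} {κ : ENNReal}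
    (ha : ∀ n, a n ≠ ⊤) (hκ : κ < 1) (h : ∀ n, a (n + M) ≤ κ * a n) : ∑' n, a n ≠ ⊤ := by
  have hfin : ∀ n, ∑ i ∈ Finset.range n, a i ≠ ⊤ := fun n =>
    ENNReal.sum_ne_top.2 fun i _ => ha i
  have hb : ∀ n, ∑ i ∈ Finset.range n, a i ≤ (∑ i ∈ Finset.range M, a i) / (1 - κ) := by
    intro n
    rw [ENNReal.le_div_iff_mul_le (Or.inl (tsub_pos_of_lt hκ).ne') (Or.inl (by simp)),
      ENNReal.mul_sub (fun _ _ => hfin n), mul_one, tsub_le_iff_right]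
    calc ∑ i ∈ Finset.range n, a i ≤ ∑ i ∈ Finset.range (M + n), a i :=
          Finset.sum_le_sum_of_subset (Finset.range_mono (by omega))
      _ = ∑ i ∈ Finset.range M, a i + ∑ i ∈ Finset.range n, a (M + i) := Finset.sum_range_add _ _ _
      _ ≤ _ := by
        rw [Finset.sum_mul]
        gcongr with i _
        rw [add_comm, mul_comm]; exact h i
  refine ne_top_of_le_ne_top ?_ (ENNReal.tsum_le_of_sum_range_le hb)
  exact ENNReal.div_ne_top (hfin M) (tsub_pos_of_lt hκ).ne'

/-- With `c = r ^ (-θ)` submultiplicativity makes the moments weighted by `c ^ N` summable. Hence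
the weighted sums of `count ^ θ` tend to `0` almost surely, and `Z_N ≤ r ^ N` eventually. -/
lemma ae_upperRate_le {d : ℕ} {f : Site d → ℝ} {p θ : ℝ} (h : Admissible f p) (h0 : 0 < θ)
    (h1 : θ ≤ 1) {M : ℕ} (r : NNReal) (hr : 0 < r)
    (hlt : fracMoment f p θ M < (r : ENNReal) ^ (θ * M)) :
    ∀ᵐ X ∂(percLaw f p), upperRate X ≤ (Real.log r : EReal) := by
  have hr0 : (r : ENNReal) ≠ 0 := by simpa using hr.ne'
  have hrt : (r : ENNReal) ≠ ⊤ := ENNReal.coe_ne_top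
  set c : ENNReal := (r : ENNReal) ^ (-θ) with hc
  have hct : c ≠ ⊤ := ENNReal.rpow_ne_top_of_ne_zero hr0 hrt
  have hc0 : c ≠ 0 := by simp [hc, hr0, hrt]
  have hcM : c ^ M = (r : ENNReal) ^ (-(θ * M)) := by
    rw [hc, ← ENNReal.rpow_natCast, ← ENNReal.rpow_mul]; ring_nf
  have hκ : fracMoment f p θ M * c ^ M < 1 := by
    have h2 : (r : ENNReal) ^ (θ * M) * c ^ M = 1 := by
      rw [hcM, ← ENNReal.rpow_add _ _ hr0 hrt]; simp
    rw [← h2]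
    exact ENNReal.mul_lt_mul_left (pow_ne_zero _ hc0) (ENNReal.pow_ne_top hct) hlt
  have hsum : ∑' N, fracMoment f p θ N * c ^ N ≠ ⊤ := by
    refine ENNReal.tsum_ne_top_of_contract
      (fun N => ENNReal.mul_ne_top (fracMoment_ne_top h h0 h1 N) (ENNReal.pow_ne_top hct)) hκ
      (M := M) fun N => ?_
    calc fracMoment f p θ (N + M) * c ^ (N + M)
        ≤ (fracMoment f p θ N * fracMoment f p θ M) * c ^ (N + M) := by
          gcongr; exact fracMoment_add_le f p h0 h1 N M
      _ = _ := by rw [pow_add]; ring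
  have hmeas : ∀ N, Measurable fun X : Env d => (∑' y, count X 0 0 N y ^ θ) * c ^ N := fun N =>
    (Measurable.tsum fun y => (measurable_count' _ _ _ _).pow_const _).mul_const _
  have hint : ∫⁻ X, ∑' N, (∑' y, count X 0 0 N y ^ θ) * c ^ N ∂(percLaw f p) ≠ ⊤ := by
    rw [lintegral_tsum fun N => (hmeas N).aemeasurable]
    convert hsum using 3 with N
    rw [lintegral_mul_const _
      (Measurable.tsum fun y => (measurable_count' _ _ _ _).pow_const _),
      lintegral_tsum fun y => ((measurable_count' _ _ _ _).pow_const _).aemeasurable]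
    rfl
  filter_upwards [ae_lt_top (Measurable.tsum hmeas) hint] with X hX
  have htend := ENNReal.tendsto_atTop_zero_of_tsum_ne_top hX.ne
  have hev : ∀ᶠ N : ℕ in atTop, (∑' y, count X 0 0 N y ^ θ) * c ^ N < 1 :=
    htend.eventually_lt_const zero_lt_one
  refine limsup_le_of_le (by isBoundedDefault) ?_
  filter_upwards [hev, eventually_gt_atTop 0] with N hN hNpos
  have hle : numPaths X N ^ θ ≤ ((r : ENNReal) ^ N) ^ θ := by
    have h3 : ((r : ENNReal) ^ N) ^ θ * c ^ N = 1 := by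
      rw [hc, ← ENNReal.rpow_natCast, ← ENNReal.rpow_natCast, ← ENNReal.rpow_mul,
        ← ENNReal.rpow_mul, ← ENNReal.rpow_add _ _ hr0 hrt]
      ring_nf
      simp
    have h4 : numPaths X N ^ θ * c ^ N ≤ ((r : ENNReal) ^ N) ^ θ * c ^ N := by
      rw [h3]
      refine le_trans ?_ hN.le
      gcongr
      exact (ENNReal.rpow_le_rpow (numPaths_le X N) h0.le).trans (ENNReal.tsum_rpow_le _ h0 h1)
    exact (ENNReal.mul_le_mul_iff_left (pow_ne_zero _ hc0) (ENNReal.pow_ne_top hct)).1 h4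
  have hle2 : numPaths X N ≤ (r : ENNReal) ^ N := (ENNReal.rpow_le_rpow_iff h0).1 hle
  rw [EReal.div_le_iff_le_mul (by exact_mod_cast hNpos) (EReal.natCast_ne_top N)]
  calc ENNReal.log (numPaths X N) ≤ ENNReal.log ((r : ENNReal) ^ N) :=
        ENNReal.log_monotone hle2
    _ = _ := by
      rw [ENNReal.log_pow, ← ENNReal.ofReal_coe_nnreal, ENNReal.log_ofReal_of_pos (by exact_mod_cast hr)]

/-- The strict inequality leaves room for a rate `r < p`. The almost sure bound survives
conditioning because the conditional law is absolutely continuous. -/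
theorem growthRate_lt_of_fracMoment_lt {d : ℕ} {f : Site d → ℝ} {p θ : ℝ} (h : Admissible f p)
    (h0 : 0 < θ) (h1 : θ ≤ 1) {M : ℕ} (hM : 0 < M)
    (hlt : fracMoment f p θ M < ENNReal.ofReal p ^ (θ * M)) :
    growthRate f p < (Real.log p : EReal) := by
  have hz : 0 < θ * M := by positivity
  have hlt2 : fracMoment f p θ M ^ (θ * M)⁻¹ < ENNReal.ofReal p :=
    (ENNReal.rpow_inv_lt_iff hz).2 hlt
  obtain ⟨r, hr1, hr2⟩ := ENNReal.lt_iff_exists_nnreal_btwn.1 hlt2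
  have hr : 0 < r := by
    have := lt_of_le_of_lt zero_le hr1
    exact_mod_cast this
  have hrp : (r : ℝ) < p := by
    have := (ENNReal.toReal_lt_toReal ENNReal.coe_ne_top ENNReal.ofReal_ne_top).2 hr2
    rwa [ENNReal.coe_toReal, ENNReal.toReal_ofReal h.pos.le] at this
  have hlog : (Real.log r : EReal) < (Real.log p : EReal) := by
    exact_mod_cast Real.log_lt_log (by exact_mod_cast hr) hrp
  have hae := ae_upperRate_le h h0 h1 r hr ((ENNReal.rpow_inv_lt_iff hz).1 hr1)
  unfold growthRate
  split_ifs with hP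
  · exact EReal.bot_lt_coe _
  · exact (essSup_le_of_ae_le _ (cond_absolutelyContinuous.ae_le hae)).trans_lt hlog

/-! ### Good detours of an open path double the number of paths. -/

/-- The steps of the path `η` between the times `a` and `a + k`. -/
def increments {d : ℕ} (η : ℕ → Site d) (a k : ℕ) : Fin k → Site d :=
  fun i => η (a + i + 1) - η (a + i)

lemma stepEdge_increments {d : ℕ} (η : ℕ → Site d) (a k : ℕ) (i : Fin k) :
    stepEdge a (η a) (increments η a k) i = (a + i, η (a + i), η (a + i + 1)) := by
  unfold stepEdge increments
  rw [pos_increments η a k i i.2.le, pos_increments η a k (i + 1) i.2]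
  simp [add_assoc]

lemma add_pos_increments {d : ℕ} (η : ℕ → Site d) (a k j : ℕ) (hj : j ≤ k) :
    η a + pos (increments η a k) j = η (a + j) := by
  unfold increments
  rw [pos_increments η a k j hj]; abel

lemma allOpen_increments {d : ℕ} {X : Env d} {η : ℕ → Site d} {a k : ℕ}
    (h : ∀ j, a ≤ j → j < a + k → X (j, η j, η (j + 1)) = true) :
    AllOpen X (stepEdges a (η a) (increments η a k)) := by
  rw [allOpen_stepEdges]
  intro i
  rw [stepEdge_increments]
  exact h (a + i) (by omega) (by omega)

lemma one_le_count_of_path {d : ℕ} {X : Env d} {η : ℕ → Site d} {a k : ℕ}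
    (h : ∀ j, a ≤ j → j < a + k → X (j, η j, η (j + 1)) = true) :
    1 ≤ count X a (η a) k (η (a + k)) := by
  classical
  refine le_trans ?_ (ENNReal.le_tsum (increments η a k))
  rw [if_pos ⟨add_pos_increments η a k k le_rfl, allOpen_increments h⟩]

lemma two_le_count_of_paths {d : ℕ} {X : Env d} {η η' : ℕ → Site d} {a k j : ℕ} (hj : j ≤ k)
    (h : ∀ j, a ≤ j → j < a + k → X (j, η j, η (j + 1)) = true)
    (h' : ∀ j, a ≤ j → j < a + k → X (j, η' j, η' (j + 1)) = true)
    (h0 : η a = η' a) (h1 : η (a + k) = η' (a + k)) (hne : η (a + j) ≠ η' (a + j)) :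
    2 ≤ count X a (η a) k (η (a + k)) := by
  classical
  have hne' : increments η a k ≠ increments η' a k := by
    intro heq
    apply hne
    rw [← add_pos_increments η a k j hj, ← add_pos_increments η' a k j hj, h0, heq]
  refine le_trans ?_ (ENNReal.sum_le_tsum {increments η a k, increments η' a k})
  rw [Finset.sum_pair hne', if_pos ⟨add_pos_increments η a k k le_rfl, allOpen_increments h⟩,
    if_pos, one_add_one_eq_two]
  refine ⟨?_, ?_⟩
  · rw [h0, add_pos_increments η' a k k le_rfl, h1]
  · rw [h0]; exact allOpen_increments h'

/-- The step sequence `t` started at time `n` on the path `s` leaves `s` and returns to `s` for the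
first time at time `n + k`. -/
structure IsDetour {d M : ℕ} (s : Fin M → Site d) (n k : ℕ) (t : Fin k → Site d) : Prop where
  two_le : 2 ≤ k
  le : n + k ≤ M
  end_eq : pos s n + pos t k = pos s (n + k)
  avoid : ∀ j, 0 < j → j < k → pos s n + pos t j ≠ pos s (n + j)

/-- The position at time `j` of the detour `t` started at time `n` on `s`. -/
def detourPos {d M : ℕ} (s : Fin M → Site d) (n : ℕ) {k : ℕ} (t : Fin k → Site d) (j : ℕ) :
    Site d :=
  pos s n + pos t (j - n)

/-- The edges of the path `s` and of the detour `t`. -/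
def detourEdges {d M : ℕ} (s : Fin M → Site d) (n : ℕ) {k : ℕ} (t : Fin k → Site d) :
    Finset (OEdge d) :=
  stepEdges 0 0 s ∪ stepEdges n (pos s n) t

/-- The path started at `(a, x)` with steps `u` connects two points of `s` or `t` without using
edges of `s` or `t`. -/
structure IsEar {d M : ℕ} (s : Fin M → Site d) (n : ℕ) {k : ℕ} (t : Fin k → Site d) (a : ℕ)
    (x : Site d) {l : ℕ} (u : Fin l → Site d) : Prop where
  start : x = pos s a ∨ x = detourPos s n t a
  finish : x + pos u l = pos s (a + l) ∨ x + pos u l = detourPos s n t (a + l)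
  disjoint : Disjoint (detourEdges s n t) (stepEdges a x u)

/-- The detour `t` is open, has length at most `K` and no open ears of length at most `K`. -/
structure IsGood {d M : ℕ} (X : Env d) (K : ℕ) (s : Fin M → Site d) (n k : ℕ)
    (t : Fin k → Site d) : Prop where
  isDetour : IsDetour s n k t
  le : k ≤ K
  isOpen : AllOpen X (stepEdges n (pos s n) t)
  no_ear : ∀ a ∈ Finset.Ico n (n + k), ∀ l ∈ Finset.Icc 1 K, ∀ (x : Site d) (u : Fin l → Site d),
    IsEar s n t a x u → ¬ AllOpen X (stepEdges a x u)

lemma mem_detourEdges {d M : ℕ} {s : Fin M → Site d} {n k : ℕ} {t : Fin k → Site d} {j : ℕ}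
    {x y : Site d} (h : (j, x, y) ∈ detourEdges s n t) :
    (x = pos s j ∧ y = pos s (j + 1)) ∨
      (n ≤ j ∧ j < n + k ∧ x = detourPos s n t j ∧ y = detourPos s n t (j + 1)) := by
  simp only [detourEdges, Finset.mem_union, mem_stepEdges, stepEdge, Prod.mk.injEq, zero_add] at h
  rcases h with ⟨i, rfl, rfl, rfl⟩ | ⟨i, rfl, rfl, rfl⟩
  · exact Or.inl ⟨rfl, rfl⟩
  · right
    refine ⟨by omega, by omega, ?_, ?_⟩
    · simp [detourPos]
    · simp [detourPos, add_assoc]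

lemma isOpen_detourPos {d M : ℕ} {X : Env d} {s : Fin M → Site d} {n k : ℕ} {t : Fin k → Site d}
    (h : AllOpen X (stepEdges n (pos s n) t)) (j : ℕ) (h1 : n ≤ j) (h2 : j < n + k) :
    X (j, detourPos s n t j, detourPos s n t (j + 1)) = true := by
  rw [allOpen_stepEdges] at h
  have := h ⟨j - n, by omega⟩
  simp only [stepEdge] at this
  unfold detourPos
  rw [show j + 1 - n = j - n + 1 by omega]
  rwa [show n + (j - n) = j by omega] at this

lemma isOpen_spine {d M : ℕ} {X : Env d} {s : Fin M → Site d} (h : AllOpen X (stepEdges 0 0 s))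
    (j : ℕ) (h2 : j < M) : X (j, pos s j, pos s (j + 1)) = true := by
  rw [allOpen_stepEdges] at h
  simpa [stepEdge] using h ⟨j, h2⟩

lemma IsDetour.detourPos_ne {d M : ℕ} {s : Fin M → Site d} {n k : ℕ} {t : Fin k → Site d}
    (h : IsDetour s n k t) {j : ℕ} (h1 : n < j) (h2 : j < n + k) :
    detourPos s n t j ≠ pos s j := by
  have := h.avoid (j - n) (by omega) (by omega)
  rwa [show n + (j - n) = j by omega] at this

lemma IsDetour.detourPos_end {d M : ℕ} {s : Fin M → Site d} {n k : ℕ} {t : Fin k → Site d}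
    (h : IsDetour s n k t) : detourPos s n t (n + k) = pos s (n + k) := by
  unfold detourPos
  rw [Nat.add_sub_cancel_left]; exact h.end_eq

lemma detourPos_self {d M : ℕ} (s : Fin M → Site d) (n : ℕ) {k : ℕ} (t : Fin k → Site d) :
    detourPos s n t n = pos s n := by
  simp [detourPos, pos_zero]

/-- A good detour admits no open path between points of `s` or `t` avoiding their edges. -/
lemma IsGood.no_path {d M K : ℕ} {X : Env d} {s : Fin M → Site d} {n k : ℕ} {t : Fin k → Site d}
    (h : IsGood X K s n k t) {η : ℕ → Site d} {a b : ℕ} (hab : a < b) (hK : b ≤ a + K)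
    (ha1 : n ≤ a) (ha2 : a < n + k) (ha : η a = pos s a ∨ η a = detourPos s n t a)
    (hb : η b = pos s b ∨ η b = detourPos s n t b)
    (ho : ∀ j, a ≤ j → j < b → X (j, η j, η (j + 1)) = true)
    (hE : ∀ j, a ≤ j → j < b → (j, η j, η (j + 1)) ∉ detourEdges s n t) : False := by
  obtain ⟨l, rfl⟩ := Nat.exists_eq_add_of_lt hab
  refine h.no_ear a (by simp; omega) (l + 1) (by simp; omega) (η a) (increments η a (l + 1))
    ⟨ha, ?_, ?_⟩ (allOpen_increments ho)
  · rw [add_pos_increments η a (l + 1) (l + 1) le_rfl]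
    exact hb
  · rw [Finset.disjoint_right]
    intro e he
    obtain ⟨i, rfl⟩ := mem_stepEdges.1 he
    rw [stepEdge_increments]
    exact hE (a + i) (by omega) (by omega)

/-- A good detour is not left by an open detour. -/
lemma IsGood.not_leave {d M K : ℕ} {X : Env d} {s : Fin M → Site d} {n k : ℕ} {t : Fin k → Site d}
    (h : IsGood X K s n k t) {n' k' : ℕ} {t' : Fin k' → Site d} (h' : IsDetour s n' k' t')
    (hk' : k' ≤ K) (ho : AllOpen X (stepEdges n' (pos s n') t')) {a : ℕ}
    (ha1 : n ≤ a) (ha2 : a < n + k) (ha1' : n' ≤ a) (ha2' : a < n' + k')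
    (ha : detourPos s n' t' a = pos s a ∨ detourPos s n' t' a = detourPos s n t a)
    (hE : (a, detourPos s n' t' a, detourPos s n' t' (a + 1)) ∉ detourEdges s n t) : False := by
  classical
  -- The segment of `t'` from time `a` to its first later visit to `s` or `t` is an open ear. It
  -- exists, and has length at most `k' ≤ K`, because `t'` ends on `s`.
  have hex : ∃ b, a < b ∧ (detourPos s n' t' b = pos s b ∨
      detourPos s n' t' b = detourPos s n t b) := ⟨n' + k', ha2', Or.inl h'.detourPos_end⟩
  obtain ⟨hb1, hb2⟩ := Nat.find_spec hex
  have hb3 : Nat.find hex ≤ n' + k' := Nat.find_min' hex ⟨ha2', Or.inl h'.detourPos_end⟩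
  have hmin : ∀ j, a < j → j < Nat.find hex → ¬ (detourPos s n' t' j = pos s j ∨
      detourPos s n' t' j = detourPos s n t j) := fun j hj1 hj2 hj3 =>
    Nat.find_min hex hj2 ⟨hj1, hj3⟩
  refine h.no_path (η := detourPos s n' t') hb1 (by omega) ha1 ha2 ha hb2
    (fun j hj1 hj2 => isOpen_detourPos ho j (by omega) (by omega)) fun j hj1 hj2 => ?_
  rcases hj1.eq_or_lt with rfl | hj1
  · exact hE
  · intro hmem
    apply hmin j hj1 hj2
    rcases mem_detourEdges hmem with h1 | h1
    · exact Or.inl h1.1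
    · exact Or.inr h1.2.2.1

/-- A detour starting on `s` strictly inside the time interval of `t` would leave both `s` and `t`
with its first edge, since `t` is off `s` there, and so would contain an ear of `t`. -/
lemma IsGood.le_of_lt {d M K : ℕ} {X : Env d} {s : Fin M → Site d} {n k : ℕ} {t : Fin k → Site d}
    (h : IsGood X K s n k t) {n' k' : ℕ} {t' : Fin k' → Site d} (h' : IsGood X K s n' k' t')
    (hn : n < n') : n + k ≤ n' := by
  by_contra! hlt
  have h2 := h'.isDetour.two_le
  refine h.not_leave h'.isDetour h'.le h'.isOpen (a := n') hn.le hlt le_rfl (by omega)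
    (Or.inl (detourPos_self _ _ _)) fun hmem => ?_
  rcases mem_detourEdges hmem with h1 | h1
  · exact h'.isDetour.detourPos_ne (by omega) (by omega) h1.2
  · rw [detourPos_self] at h1
    exact h.isDetour.detourPos_ne hn hlt h1.2.2.1.symm

/-- At the first time the two detours separate, the second one leaves `s` and `t` and must come
back, which creates an ear. If they never separate, the shorter one ends on `s` while the longer one
still avoids `s`. -/
lemma IsGood.unique {d M K : ℕ} {X : Env d} {s : Fin M → Site d} {n k : ℕ} {t : Fin k → Site d}
    (h : IsGood X K s n k t) {k' : ℕ} {t' : Fin k' → Site d} (h' : IsGood X K s n k' t') :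
    (⟨k, t⟩ : Σ k, Fin k → Site d) = ⟨k', t'⟩ := by
  classical
  have hk := h.isDetour.two_le
  have hk' := h'.isDetour.two_le
  by_contra hne
  have hex : ∃ j, j ≤ k ∧ j ≤ k' ∧ pos t' j ≠ pos t j := by
    by_contra! hall
    rcases lt_trichotomy k k' with hlt | heq | hlt
    · have h1 := hall k le_rfl hlt.le
      have h2 := h.isDetour.end_eq
      rw [← h1] at h2
      exact h'.isDetour.avoid k (by omega) hlt h2
    · subst heq
      exact hne (by rw [pos_injective fun j hj => hall j hj hj])
    · have h1 := hall k' hlt.le le_rfl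
      have h2 := h'.isDetour.end_eq
      rw [h1] at h2
      exact h.isDetour.avoid k' (by omega) hlt h2
  obtain ⟨hj1, hj2, hj3⟩ := Nat.find_spec hex
  obtain ⟨i, hi⟩ : ∃ i, Nat.find hex = i + 1 := by
    refine Nat.exists_eq_succ_of_ne_zero fun h0 => ?_
    rw [h0] at hj3
    simp [pos_zero] at hj3
  have hi' : pos t' i = pos t i := by
    by_contra hc
    exact Nat.find_min hex (m := i) (by omega) ⟨by omega, by omega, hc⟩
  rw [hi] at hj1 hj2 hj3
  refine h.not_leave h'.isDetour h'.le h'.isOpen (a := n + i) (by omega) (by omega) (by omega)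
    (by omega) (Or.inr ?_) fun hmem => ?_
  · simp [detourPos, hi']
  · rcases mem_detourEdges hmem with h1 | h1
    · rcases Nat.lt_or_ge (i + 1) k' with hik | hik
      · exact h'.isDetour.detourPos_ne (by omega) (by omega) h1.2
      · exact h'.isDetour.detourPos_ne (by omega) (by omega) h1.1
    · have h2 := h1.2.2.2
      simp only [detourPos, add_right_inj, add_assoc, Nat.add_sub_cancel_left] at h2
      exact hj3 h2

/-- Every family of good detours doubles the number of open paths at each of its elements. -/
lemma two_pow_card_le_count {d M K : ℕ} {X : Env d} {s : Fin M → Site d}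
    (hs : AllOpen X (stepEdges 0 0 s)) (κ : ℕ → ℕ) (τ : ∀ n, Fin (κ n) → Site d) (I : Finset ℕ)
    (hI : ∀ n ∈ I, IsGood X K s n (κ n) (τ n)) (m : ℕ) (hm : m ≤ M)
    (hIm : ∀ n ∈ I, n + κ n ≤ m) : 2 ^ I.card ≤ count X 0 0 m (pos s m) := by
  classical
  -- The detour with the latest start is split off. All others end before it begins, so the count
  -- factorizes at its two endpoints.
  induction I using Finset.induction_on_max generalizing m with
  | empty =>
    have := one_le_count_of_path (X := X) (η := pos s) (a := 0) (k := m)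
      fun j _ hj => isOpen_spine hs j (by omega)
    simpa [pos_zero] using this
  | insert n I hmax ih =>
    have hn := hI n (Finset.mem_insert_self _ _)
    have hnm := hIm n (Finset.mem_insert_self _ _)
    have hk := hn.isDetour.two_le
    have h1 : 2 ^ I.card ≤ count X 0 0 n (pos s n) :=
      ih (fun j hj => hI j (Finset.mem_insert_of_mem hj)) n (by omega)
        fun j hj => (hI j (Finset.mem_insert_of_mem hj)).le_of_lt hn (hmax j hj)
    have h2 : 2 ≤ count X n (pos s n) (κ n) (pos s (n + κ n)) := by
      refine two_le_count_of_paths (η := pos s) (η' := detourPos s n (τ n)) (j := 1) (by omega)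
        (fun j _ hj => isOpen_spine hs j (by omega))
        (fun j hj1 hj2 => isOpen_detourPos hn.isOpen j hj1 hj2) (detourPos_self _ _ _).symm
        hn.isDetour.detourPos_end.symm
        (hn.isDetour.detourPos_ne (by omega) (by omega)).symm
    obtain ⟨r, rfl⟩ := Nat.exists_eq_add_of_le hnm
    have h3 : 1 ≤ count X (n + κ n) (pos s (n + κ n)) r (pos s (n + κ n + r)) :=
      one_le_count_of_path (η := pos s) fun j _ hj => isOpen_spine hs j (by omega)
    have hnI : n ∉ I := fun hc => (hmax n hc).false
    rw [Finset.card_insert_of_notMem hnI, pow_succ]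
    calc 2 ^ I.card * 2 ≤ count X 0 0 n (pos s n) * count X n (pos s n) (κ n) (pos s (n + κ n)) := by
          gcongr
      _ ≤ count X 0 0 (n + κ n) (pos s (n + κ n)) := by
          have := count_mul_le X 0 0 n (κ n) (pos s (n + κ n)) (pos s n)
          rwa [zero_add] at this
      _ ≤ count X 0 0 (n + κ n) (pos s (n + κ n)) *
          count X (n + κ n) (pos s (n + κ n)) r (pos s (n + κ n + r)) :=
          le_mul_of_one_le_right' h3
      _ ≤ _ := by
          have := count_mul_le X 0 0 (n + κ n) r (pos s (n + κ n + r)) (pos s (n + κ n))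
          rwa [zero_add] at this

lemma measurableSet_isGood {d M : ℕ} (K : ℕ) (s : Fin M → Site d) (n k : ℕ)
    (t : Fin k → Site d) : MeasurableSet {X : Env d | IsGood X K s n k t} := by
  have : {X : Env d | IsGood X K s n k t} = {X | IsDetour s n k t} ∩ {X | k ≤ K} ∩
      {X | AllOpen X (stepEdges n (pos s n) t)} ∩
      ⋂ a ∈ Finset.Ico n (n + k), ⋂ l ∈ Finset.Icc 1 K, ⋂ (x : Site d), ⋂ (u : Fin l → Site d),
        {X | IsEar s n t a x u → ¬ AllOpen X (stepEdges a x u)} := by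
    ext X
    simp only [Set.mem_inter_iff, Set.mem_ofPred_eq, Set.mem_iInter]
    exact ⟨fun h => ⟨⟨⟨h.1, h.2⟩, h.3⟩, h.4⟩, fun h => ⟨h.1.1.1, h.1.1.2, h.1.2, h.2⟩⟩
  rw [this]
  refine (((MeasurableSet.const _).inter (MeasurableSet.const _)).inter
    (measurableSet_allOpen _)).inter ?_
  refine Finset.measurableSet_biInter _ fun a _ => Finset.measurableSet_biInter _ fun l _ =>
    MeasurableSet.iInter fun x => MeasurableSet.iInter fun u => ?_
  by_cases h : IsEar s n t a x u
  · simp only [h, true_imp_iff]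
    exact (measurableSet_allOpen _).compl
  · simp [h]

/-! ### The expected number of good detours. -/

open Classical in
/-- The law of the position of the walk after `l` steps. -/
noncomputable def stepLaw {d : ℕ} (f : Site d → ℝ) (l : ℕ) (z : Site d) : ENNReal :=
  ∑' u : Fin l → Site d, if pos u l = z then wt f u else 0

open Classical in
/-- The probability that two independent walks meet for the first time after `k` steps. -/
noncomputable def firstMeet {d : ℕ} (f : Site d → ℝ) (k : ℕ) : ENNReal :=
  ∑' (r : Fin k → Site d) (t : Fin k → Site d),
    if pos r k = pos t k ∧ ∀ j, 0 < j → j < k → pos r j ≠ pos t j then wt f r * wt f t else 0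

/-- Since `k ≥ 2`, every edge of the detour has an endpoint at an interior time, where the detour is
off `s`. -/
lemma disjoint_stepEdges_detour {d M : ℕ} {s : Fin M → Site d} {n k : ℕ} {t : Fin k → Site d}
    (h : IsDetour s n k t) : Disjoint (stepEdges 0 0 s) (stepEdges n (pos s n) t) := by
  rw [Finset.disjoint_left]
  intro e h1 h2
  obtain ⟨i, hi⟩ := mem_stepEdges.1 h1
  obtain ⟨j, rfl⟩ := mem_stepEdges.1 h2
  simp only [stepEdge, Prod.mk.injEq, zero_add] at hi
  obtain ⟨hi1, hi2, hi3⟩ := hi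
  have := h.two_le
  rcases Nat.eq_zero_or_pos (j : ℕ) with h0 | h0
  · refine h.avoid (j + 1) (by omega) (by omega) ?_
    rw [← hi3, hi1]; rfl
  · refine h.avoid j h0 j.2 ?_
    rw [← hi2, hi1]

lemma percLaw_detourEdges {d M : ℕ} {f : Site d → ℝ} {p : ℝ} (hf : Admissible f p)
    {s : Fin M → Site d} {n k : ℕ} {t : Fin k → Site d} (h : IsDetour s n k t) :
    percLaw f p {X | AllOpen X (detourEdges s n t)} =
      ENNReal.ofReal p ^ (M + k) * (wt f s * wt f t) := by
  rw [detourEdges, percLaw_union hf (disjoint_stepEdges_detour h), percLaw_stepEdges hf,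
    percLaw_stepEdges hf, pow_add]
  ring

open Classical in
lemma tsum_ite_add_pos_eq {d : ℕ} (f : Site d → ℝ) (l : ℕ) (x y : Site d) :
    ∑' u : Fin l → Site d, (if x + pos u l = y then wt f u else 0) = stepLaw f l (y - x) := by
  unfold stepLaw
  refine tsum_congr fun u => ?_
  have : x + pos u l = y ↔ pos u l = y - x := by rw [eq_sub_iff_add_eq, add_comm]
  simp only [this]

/-- An ear has edges disjoint from those of `s` and `t`, hence is independent of them. The factor
`2` counts its possible endpoints, on `s` or on `t`. -/
lemma percLaw_ear_le {d M : ℕ} {f : Site d → ℝ} {p : ℝ} (hf : Admissible f p)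
    {s : Fin M → Site d} {n k : ℕ} {t : Fin k → Site d} (a l : ℕ) (x : Site d) {b : ENNReal}
    (hb : ∀ z, stepLaw f l z ≤ b) :
    percLaw f p (⋃ u : Fin l → Site d, {X | IsEar s n t a x u ∧
      AllOpen X (detourEdges s n t ∪ stepEdges a x u)}) ≤
      percLaw f p {X | AllOpen X (detourEdges s n t)} * (2 * (ENNReal.ofReal p ^ l * b)) := by
  classical
  set P := percLaw f p {X | AllOpen X (detourEdges s n t)} with hP
  have hu : ∀ u : Fin l → Site d, percLaw f p {X | IsEar s n t a x u ∧
      AllOpen X (detourEdges s n t ∪ stepEdges a x u)} ≤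
      P * (ENNReal.ofReal p ^ l * ((if x + pos u l = pos s (a + l) then wt f u else 0) +
        (if x + pos u l = detourPos s n t (a + l) then wt f u else 0))) := by
    intro u
    by_cases h : IsEar s n t a x u
    · simp only [h, true_and]
      rw [percLaw_union hf h.disjoint, percLaw_stepEdges hf]
      gcongr
      rcases h.finish with h1 | h1
      · rw [if_pos h1]; exact le_self_add
      · rw [if_pos h1]; exact le_add_self
    · simp [h]
  refine (measure_iUnion_le _).trans ((ENNReal.tsum_le_tsum hu).trans ?_)
  rw [ENNReal.tsum_mul_left, ENNReal.tsum_mul_left, ENNReal.tsum_add, tsum_ite_add_pos_eq,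
    tsum_ite_add_pos_eq]
  calc P * (ENNReal.ofReal p ^ l * (stepLaw f l (pos s (a + l) - x) +
        stepLaw f l (detourPos s n t (a + l) - x)))
      ≤ P * (ENNReal.ofReal p ^ l * (b + b)) := by gcongr <;> exact hb _
    _ = _ := by ring

/-- If the detour is open but not good, some ear is open. The union bound has `k` starting times,
two starting points and two endpoints, which gives `4 * k`. The inequality is additive to avoid
truncated subtraction. -/
lemma percLaw_le_isGood {d M K : ℕ} {f : Site d → ℝ} {p : ℝ} (hf : Admissible f p)
    {s : Fin M → Site d} {n k : ℕ} {t : Fin k → Site d} (h : IsDetour s n k t) (hk : k ≤ K)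
    {b : ℕ → ENNReal} (hb : ∀ l ∈ Finset.Icc 1 K, ∀ z, stepLaw f l z ≤ b l) :
    percLaw f p {X | AllOpen X (detourEdges s n t)} ≤
      percLaw f p {X | AllOpen X (stepEdges 0 0 s) ∧ IsGood X K s n k t} +
      percLaw f p {X | AllOpen X (detourEdges s n t)} *
        (4 * k * ∑ l ∈ Finset.Icc 1 K, ENNReal.ofReal p ^ l * b l) := by
  classical
  have hsub : {X | AllOpen X (detourEdges s n t)} ⊆
      {X : Env d | AllOpen X (stepEdges 0 0 s) ∧ IsGood X K s n k t} ∪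
      ⋃ a ∈ Finset.Ico n (n + k), ⋃ l ∈ Finset.Icc 1 K,
        ⋃ x ∈ ({pos s a, detourPos s n t a} : Finset (Site d)),
        ⋃ u : Fin l → Site d, {X | IsEar s n t a x u ∧
          AllOpen X (detourEdges s n t ∪ stepEdges a x u)} := by
    intro X hX
    simp only [Set.mem_ofPred_eq] at hX
    obtain ⟨h1, h2⟩ := allOpen_union.1 hX
    by_cases hg : IsGood X K s n k t
    · exact Or.inl ⟨h1, hg⟩
    · right
      by_contra hc
      refine hg ⟨h, hk, h2, fun a ha l hl x u hear ho => hc ?_⟩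
      simp only [Set.mem_iUnion]
      exact ⟨a, ha, l, hl, x, by simpa using hear.start, u, hear, allOpen_union.2 ⟨hX, ho⟩⟩
  refine (measure_mono hsub).trans ((measure_union_le _ _).trans ?_)
  gcongr
  set P := percLaw f p {X | AllOpen X (detourEdges s n t)}
  calc _ ≤ ∑ a ∈ Finset.Ico n (n + k), ∑ l ∈ Finset.Icc 1 K,
        ∑ x ∈ ({pos s a, detourPos s n t a} : Finset (Site d)),
          P * (2 * (ENNReal.ofReal p ^ l * b l)) := by
        refine (measure_biUnion_finset_le _ _).trans (Finset.sum_le_sum fun a _ => ?_)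
        refine (measure_biUnion_finset_le _ _).trans (Finset.sum_le_sum fun l hl => ?_)
        refine (measure_biUnion_finset_le _ _).trans (Finset.sum_le_sum fun x _ => ?_)
        exact percLaw_ear_le hf a l x (hb l hl)
    _ ≤ ∑ a ∈ Finset.Ico n (n + k), ∑ l ∈ Finset.Icc 1 K,
          2 * (P * (2 * (ENNReal.ofReal p ^ l * b l))) := by
        gcongr with a _ l _
        rw [Finset.sum_const, nsmul_eq_mul]
        gcongr
        exact_mod_cast Finset.card_le_two
    _ = _ := by
        rw [Finset.sum_const, Nat.card_Ico, nsmul_eq_mul, Nat.add_sub_cancel_left,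
          Finset.mul_sum, Finset.mul_sum, Finset.mul_sum]
        refine Finset.sum_congr rfl fun l _ => ?_
        ring

open Classical in
/-- The number of good detours of the path `s`. -/
noncomputable def numGood {d M : ℕ} (X : Env d) (K : ℕ) (s : Fin M → Site d) : ENNReal :=
  ∑ n ∈ Finset.range M, ∑ k ∈ Finset.Icc 2 K, ∑' t : Fin k → Site d,
    if IsGood X K s n k t then 1 else 0

/-- At most one good detour starts at each time, so `numGood` is bounded by the number of starting
times, and these detours double the count independently. -/
lemma exists_numGood_le {d M : ℕ} (X : Env d) (K : ℕ) (s : Fin M → Site d)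
    (hs : AllOpen X (stepEdges 0 0 s)) :
    ∃ N : ℕ, N ≤ M ∧ numGood X K s ≤ N ∧ 2 ^ N ≤ count X 0 0 M (pos s M) := by
  classical
  set I := (Finset.range M).filter fun n => ∃ σ : Σ k, Fin k → Site d, IsGood X K s n σ.1 σ.2
    with hI
  refine ⟨I.card, (Finset.card_filter_le _ _).trans (by simp), ?_, ?_⟩
  · rw [hI, Finset.card_filter, Nat.cast_sum]
    unfold numGood
    refine Finset.sum_le_sum fun n _ => ?_
    have h1 : ∑ k ∈ Finset.Icc 2 K, ∑' t : Fin k → Site d,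
        (if IsGood X K s n k t then (1 : ENNReal) else 0) ≤
        ∑' σ : Σ k, Fin k → Site d, if IsGood X K s n σ.1 σ.2 then 1 else 0 := by
      rw [ENNReal.tsum_sigma']
      exact ENNReal.sum_le_tsum _
    refine h1.trans ?_
    by_cases h : ∃ σ : Σ k, Fin k → Site d, IsGood X K s n σ.1 σ.2
    · rw [if_pos h]
      obtain ⟨σ, hσ⟩ := h
      rw [tsum_eq_single σ]
      · rw [if_pos hσ]; simp
      · intro σ' hne
        rw [if_neg]
        exact fun hσ' => hne (hσ'.unique hσ)
    · rw [if_neg h]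
      push Not at h
      simp [h]
  · have hex : ∀ n, ∃ σ : Σ k, Fin k → Site d, n ∈ I → IsGood X K s n σ.1 σ.2 := by
      intro n
      by_cases hn : n ∈ I
      · obtain ⟨σ, hσ⟩ := (Finset.mem_filter.1 hn).2
        exact ⟨σ, fun _ => hσ⟩
      · exact ⟨⟨0, Fin.elim0⟩, fun h => absurd h hn⟩
    choose σ hσ using hex
    exact two_pow_card_le_count hs (fun n => (σ n).1) (fun n => (σ n).2) I hσ M le_rfl
      fun n hn => (hσ n hn).isDetour.le

lemma pos_comp_natAdd {d M n k : ℕ} (s : Fin M → Site d) (h : n + k ≤ M) (j : ℕ) (hj : j ≤ k) :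
    pos s n + pos (fun i : Fin k => s ⟨n + i, by omega⟩) j = pos s (n + j) := by
  have : (fun i : Fin k => s ⟨n + i, by omega⟩) = increments (pos s) n k := by
    funext i
    have := pos_succ s ⟨n + i, by omega⟩
    simp only at this
    rw [increments, this]; abel
  rw [this]
  exact add_pos_increments (pos s) n k j hj

open Classical in
-- Being a detour depends only on the steps of `s` in the window `[n, n + k)`. The other steps
-- integrate out, leaving two independent walks that meet for the first time at time `k`.
lemma tsum_detour {d M n k : ℕ} {f : Site d → ℝ} {p : ℝ} (hf : Admissible f p) (hk : 2 ≤ k)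
    (h : n + k ≤ M) :
    ∑' (s : Fin M → Site d) (t : Fin k → Site d),
      (if IsDetour s n k t then wt f s * wt f t else 0) = firstMeet f k := by
  have key : ∀ (s : Fin M → Site d) (t : Fin k → Site d), IsDetour s n k t ↔
      (pos (fun i : Fin k => s ⟨n + i, by omega⟩) k = pos t k ∧ ∀ j, 0 < j → j < k →
        pos (fun i : Fin k => s ⟨n + i, by omega⟩) j ≠ pos t j) := by
    intro s t
    constructor
    · intro hd
      refine ⟨?_, fun j h1 h2 heq => hd.avoid j h1 h2 ?_⟩
      · have := hd.end_eq
        rw [← pos_comp_natAdd s h k le_rfl] at this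
        exact (add_left_cancel this).symm
      · rw [← pos_comp_natAdd s h j h2.le, heq]
    · rintro ⟨h1, h2⟩
      refine ⟨hk, h, ?_, fun j h3 h4 heq => h2 j h3 h4 ?_⟩
      · rw [← pos_comp_natAdd s h k le_rfl, h1]
      · rw [← pos_comp_natAdd s h j h4.le] at heq
        exact (add_left_cancel heq).symm
  have he : Function.Injective (fun i : Fin k => (⟨n + i, by omega⟩ : Fin M)) := by
    intro i j hij
    simp only [Fin.mk.injEq] at hij
    exact Fin.ext (by omega)
  have := tsum_marginal (w := fun z => ENNReal.ofReal (f z)) hf.mass _ he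
    (fun r : Fin k → Site d => ∑' t : Fin k → Site d, if pos r k = pos t k ∧
      ∀ j, 0 < j → j < k → pos r j ≠ pos t j then wt f t else 0)
  unfold firstMeet
  simp only [← ENNReal.tsum_mul_left, mul_ite, mul_zero] at this
  refine Eq.trans ?_ this
  refine tsum_congr fun s => tsum_congr fun t => ?_
  by_cases hd : IsDetour s n k t
  · rw [if_pos hd]
    exact (if_pos ((key s t).1 hd)).symm
  · rw [if_neg hd]
    exact (if_neg fun hc => hd ((key s t).2 hc)).symm

open Classical in
/-- The expected number of pairs of an open path of length `M` and one of its good detours. -/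
noncomputable def expGood {d : ℕ} (f : Site d → ℝ) (p : ℝ) (K M : ℕ) : ENNReal :=
  ∑' s : Fin M → Site d, ∫⁻ X, (if AllOpen X (stepEdges 0 0 s) then numGood X K s else 0)
    ∂(percLaw f p)

lemma measurable_numGood {d M : ℕ} (K : ℕ) (s : Fin M → Site d) :
    Measurable fun X : Env d => numGood X K s := by
  classical
  unfold numGood
  refine Finset.measurable_sum _ fun n _ => Finset.measurable_sum _ fun k _ =>
    Measurable.tsum fun t => ?_
  exact Measurable.ite (measurableSet_isGood K s n k t) measurable_const measurable_const

lemma expGood_eq {d : ℕ} (f : Site d → ℝ) (p : ℝ) (K M : ℕ) :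
    expGood f p K M = ∑ n ∈ Finset.range M, ∑ k ∈ Finset.Icc 2 K, ∑' (s : Fin M → Site d)
      (t : Fin k → Site d),
      percLaw f p {X | AllOpen X (stepEdges 0 0 s) ∧ IsGood X K s n k t} := by
  classical
  have h1 : ∀ s : Fin M → Site d,
      ∫⁻ X, (if AllOpen X (stepEdges 0 0 s) then numGood X K s else 0) ∂(percLaw f p) =
      ∑ n ∈ Finset.range M, ∑ k ∈ Finset.Icc 2 K, ∑' (t : Fin k → Site d),
      percLaw f p {X | AllOpen X (stepEdges 0 0 s) ∧ IsGood X K s n k t} := by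
    intro s
    have hm : ∀ (n k : ℕ) (t : Fin k → Site d), MeasurableSet
        {X : Env d | AllOpen X (stepEdges 0 0 s) ∧ IsGood X K s n k t} := fun n k t =>
      (measurableSet_allOpen _).inter (measurableSet_isGood K s n k t)
    have hm' : ∀ (n k : ℕ) (t : Fin k → Site d), Measurable fun X : Env d =>
        if AllOpen X (stepEdges 0 0 s) ∧ IsGood X K s n k t then (1 : ENNReal) else 0 :=
      fun n k t => Measurable.ite (hm n k t) measurable_const measurable_const
    have h2 : ∀ X : Env d, (if AllOpen X (stepEdges 0 0 s) then numGood X K s else 0) =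
        ∑ n ∈ Finset.range M, ∑ k ∈ Finset.Icc 2 K, ∑' (t : Fin k → Site d),
          if AllOpen X (stepEdges 0 0 s) ∧ IsGood X K s n k t then (1 : ENNReal) else 0 := by
      intro X
      unfold numGood
      by_cases h : AllOpen X (stepEdges 0 0 s) <;> simp [h]
    simp only [h2]
    rw [lintegral_finsetSum _ fun n _ => Finset.measurable_sum _ fun k _ =>
      Measurable.tsum fun t => hm' n k t]
    refine Finset.sum_congr rfl fun n _ => ?_
    rw [lintegral_finsetSum _ fun k _ => Measurable.tsum fun t => hm' n k t]
    refine Finset.sum_congr rfl fun k _ => ?_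
    rw [lintegral_tsum fun t => (hm' n k t).aemeasurable]
    refine tsum_congr fun t => ?_
    rw [← lintegral_indicator_one (hm n k t)]
    refine lintegral_congr fun X => ?_
    by_cases h : AllOpen X (stepEdges 0 0 s) ∧ IsGood X K s n k t <;> simp [Set.indicator, h]
  unfold expGood
  simp only [h1]
  rw [Summable.tsum_finsetSum fun _ _ => ENNReal.summable]
  refine Finset.sum_congr rfl fun n _ => ?_
  rw [Summable.tsum_finsetSum fun _ _ => ENNReal.summable]

lemma sum_firstMeet_le_expGood {d : ℕ} {f : Site d → ℝ} {p : ℝ} (hf : Admissible f p) (K M : ℕ)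
    {b : ℕ → ENNReal} (hb : ∀ l ∈ Finset.Icc 1 K, ∀ z, stepLaw f l z ≤ b l) :
    ∑ n ∈ Finset.range M, ∑ k ∈ Finset.Icc 2 K,
      (if n + k ≤ M then ENNReal.ofReal p ^ (M + k) * firstMeet f k else 0) ≤
    expGood f p K M + ∑ n ∈ Finset.range M, ∑ k ∈ Finset.Icc 2 K,
      (if n + k ≤ M then ENNReal.ofReal p ^ (M + k) * firstMeet f k else 0) *
        (4 * k * ∑ l ∈ Finset.Icc 1 K, ENNReal.ofReal p ^ l * b l) := by
  classical
  rw [expGood_eq, ← Finset.sum_add_distrib]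
  refine Finset.sum_le_sum fun n _ => ?_
  rw [← Finset.sum_add_distrib]
  refine Finset.sum_le_sum fun k hk => ?_
  rw [Finset.mem_Icc] at hk
  by_cases hnk : n + k ≤ M
  swap
  · simp [hnk]
  simp only [hnk, if_true]
  rw [← tsum_detour hf hk.1 hnk]
  set c := 4 * (k : ENNReal) * ∑ l ∈ Finset.Icc 1 K, ENNReal.ofReal p ^ l * b l
  simp only [← ENNReal.tsum_mul_left, ← ENNReal.tsum_mul_right, ← ENNReal.tsum_add]
  refine ENNReal.tsum_le_tsum fun s => ENNReal.tsum_le_tsum fun t => ?_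
  by_cases h : IsDetour s n k t
  · simp only [h, if_true]
    rw [← percLaw_detourEdges hf h]
    exact percLaw_le_isGood hf h hk.2 hb
  · simp [h]

/-! ### From good detours to a strict gap in the growth rate. -/

/-- This follows from `exp x ≥ 1 + x` and `(1 + x) * (1 - x + x ^ 2) = 1 + x ^ 3 ≥ 1`. -/
lemma Real.exp_neg_le_quadratic {x : ℝ} (hx : 0 ≤ x) : Real.exp (-x) ≤ 1 - x + x ^ 2 := by
  rw [Real.exp_neg, inv_le_comm₀ (Real.exp_pos x) (by nlinarith [sq_nonneg (x - 1)])]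
  refine le_trans ?_ (Real.add_one_le_exp x)
  rw [inv_le_iff_one_le_mul₀ (by nlinarith [sq_nonneg (x - 1)])]
  nlinarith [pow_nonneg hx 3]

/-- First-order expansion of `2 ^ (-ε N)` in `ε`: the linear gain is moved to the left, and the
quadratic error is bounded using `log 2 ≤ 1` and `N ≤ M`. -/
lemma two_pow_rpow_neg_add_le {ε : ℝ} (hε : 0 < ε) {N M : ℕ} (hN : N ≤ M) {c D : ENNReal}
    (hc : 2 ^ N ≤ c) (hD : D ≤ N) :
    c ^ (-ε) + ENNReal.ofReal (ε * Real.log 2) * D ≤ ENNReal.ofReal (1 + ε ^ 2 * M ^ 2) := by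
  have hlog0 : 0 ≤ Real.log 2 := Real.log_nonneg (by norm_num)
  have hlog1 : Real.log 2 ≤ 1 := by linarith [Real.log_two_lt_d9]
  have h1 : c ^ (-ε) ≤ ENNReal.ofReal (Real.exp (-(ε * Real.log 2 * N))) := by
    have h2 : ((2 : ENNReal) ^ N) ^ (-ε) = ENNReal.ofReal (Real.exp (-(ε * Real.log 2 * N))) := by
      rw [show (2 : ENNReal) = ENNReal.ofReal 2 by simp, ← ENNReal.ofReal_pow (by norm_num),
        ENNReal.ofReal_rpow_of_pos (by positivity), Real.rpow_def_of_pos (by positivity),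
        Real.log_pow]
      ring_nf
    rw [← h2, ENNReal.rpow_neg, ENNReal.rpow_neg]
    exact ENNReal.inv_le_inv.2 (ENNReal.rpow_le_rpow hc hε.le)
  calc c ^ (-ε) + ENNReal.ofReal (ε * Real.log 2) * D
      ≤ ENNReal.ofReal (Real.exp (-(ε * Real.log 2 * N))) +
        ENNReal.ofReal (ε * Real.log 2) * ENNReal.ofReal N := by
        rw [ENNReal.ofReal_natCast]
        gcongr
    _ = ENNReal.ofReal (Real.exp (-(ε * Real.log 2 * N)) + ε * Real.log 2 * N) := by
        rw [← ENNReal.ofReal_mul (by positivity), ← ENNReal.ofReal_add (Real.exp_pos _).le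
          (by positivity)]
    _ ≤ _ := by
        apply ENNReal.ofReal_le_ofReal
        have h3 := Real.exp_neg_le_quadratic (x := ε * Real.log 2 * N) (by positivity)
        have h4 : ε * Real.log 2 * N ≤ ε * M := by
          have : (N : ℝ) ≤ M := by exact_mod_cast hN
          calc ε * Real.log 2 * N ≤ ε * 1 * M := by gcongr
            _ = _ := by ring
        have h5 : (ε * Real.log 2 * N) ^ 2 ≤ (ε * M) ^ 2 := by gcongr
        nlinarith

open Classical in
-- Size biasing: where the count is nonzero and finite, `count ^ (1 - ε) = count * count ^ (-ε)`,
-- and the first factor is expanded as a sum over open paths.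
lemma fracMoment_le_tsum {d : ℕ} {f : Site d → ℝ} {p ε : ℝ} (hf : Admissible f p) (hε : ε < 1)
    (M : ℕ) : fracMoment f p (1 - ε) M ≤ ∑' s : Fin M → Site d,
      ∫⁻ X, (if AllOpen X (stepEdges 0 0 s) then count X 0 0 M (pos s M) ^ (-ε) else 0)
        ∂(percLaw f p) := by
  have hfin : ∀ y, ∀ᵐ X ∂(percLaw f p), count X 0 0 M y < ⊤ := by
    intro y
    refine ae_lt_top (measurable_count' _ _ _ _) ?_
    refine ne_top_of_le_ne_top (ENNReal.pow_ne_top (ENNReal.ofReal_ne_top (r := p)) (n := M)) ?_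
    rw [← tsum_lintegral_count hf M]
    exact ENNReal.le_tsum (f := fun y => ∫⁻ X, count X 0 0 M y ∂(percLaw f p)) y
  have hmeas : ∀ (s : Fin M → Site d) (y : Site d), Measurable fun X : Env d =>
      (if 0 + pos s M = y ∧ AllOpen X (stepEdges 0 0 s) then count X 0 0 M y ^ (-ε) else 0) :=
    fun s y => Measurable.ite ((MeasurableSet.const _).inter (measurableSet_allOpen _))
      ((measurable_count' _ _ _ _).pow_const _) measurable_const
  have hy : ∀ y, ∫⁻ X, count X 0 0 M y ^ (1 - ε) ∂(percLaw f p) ≤ ∑' s : Fin M → Site d,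
      ∫⁻ X, (if 0 + pos s M = y ∧ AllOpen X (stepEdges 0 0 s) then
        count X 0 0 M y ^ (-ε) else 0) ∂(percLaw f p) := by
    intro y
    rw [← lintegral_tsum fun s => (hmeas s y).aemeasurable]
    refine lintegral_mono_ae ?_
    filter_upwards [hfin y] with X hX
    rcases count_eq_zero_or_one_le X 0 0 M y with h0 | h1
    · rw [h0, ENNReal.zero_rpow_of_pos (by linarith)]; exact zero_le
    · refine le_of_eq ?_
      rw [sub_eq_add_neg, ENNReal.rpow_add _ _ (by positivity) hX.ne, ENNReal.rpow_one]
      nth_rewrite 1 [count]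
      rw [← ENNReal.tsum_mul_right]
      refine tsum_congr fun s => ?_
      rw [ite_mul, one_mul, zero_mul]
  refine (ENNReal.tsum_le_tsum hy).trans_eq ?_
  rw [ENNReal.tsum_comm]
  refine tsum_congr fun s => ?_
  rw [tsum_eq_single (0 + pos s M)]
  · simp
  · intro y hne
    simp [Ne.symm (by simpa using hne)]

lemma fracMoment_add_expGood_le {d : ℕ} {f : Site d → ℝ} {p ε : ℝ} (hf : Admissible f p)
    (h0 : 0 < ε) (h1 : ε < 1) (K M : ℕ) :
    fracMoment f p (1 - ε) M + ENNReal.ofReal (ε * Real.log 2) * expGood f p K M ≤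
      ENNReal.ofReal (p ^ M * (1 + ε ^ 2 * M ^ 2)) := by
  classical
  calc fracMoment f p (1 - ε) M + ENNReal.ofReal (ε * Real.log 2) * expGood f p K M
      ≤ ∑' s : Fin M → Site d, (∫⁻ X, (if AllOpen X (stepEdges 0 0 s) then
          count X 0 0 M (pos s M) ^ (-ε) else 0) ∂(percLaw f p) +
          ENNReal.ofReal (ε * Real.log 2) * ∫⁻ X, (if AllOpen X (stepEdges 0 0 s) then
          numGood X K s else 0) ∂(percLaw f p)) := by
        rw [ENNReal.tsum_add, ENNReal.tsum_mul_left]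
        gcongr
        · exact fracMoment_le_tsum hf h1 M
        · rfl
    _ ≤ ∑' s : Fin M → Site d, ENNReal.ofReal (1 + ε ^ 2 * M ^ 2) *
          percLaw f p {X | AllOpen X (stepEdges 0 0 s)} := by
        refine ENNReal.tsum_le_tsum fun s => ?_
        have hm : Measurable fun X : Env d => if AllOpen X (stepEdges 0 0 s) then
            numGood X K s else 0 :=
          Measurable.ite (measurableSet_allOpen _) (measurable_numGood K s) measurable_const
        rw [← lintegral_const_mul _ hm, ← lintegral_add_right _ (hm.const_mul _),
          ← lintegral_indicator_const (measurableSet_allOpen _)]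
        refine lintegral_mono fun X => ?_
        by_cases h : AllOpen X (stepEdges 0 0 s)
        · obtain ⟨N, hN1, hN2, hN3⟩ := exists_numGood_le X K s h
          simp only [h, if_true, Set.indicator, Set.mem_ofPred_eq]
          exact two_pow_rpow_neg_add_le h0 hN1 hN3 hN2
        · simp [h]
    _ = _ := by
        have h3 : ∑' t : Fin M → Site d, wt f t = 1 := tsum_prod_eq_one hf.mass
        simp only [percLaw_stepEdges hf]
        rw [ENNReal.tsum_mul_left, ENNReal.tsum_mul_left, h3, mul_one, mul_comm,
          ENNReal.ofReal_mul (pow_nonneg hf.pos.le _), ENNReal.ofReal_pow hf.pos.le]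

lemma firstMeet_le_one {d : ℕ} {f : Site d → ℝ} (hm : ∑' z, ENNReal.ofReal (f z) = 1) (k : ℕ) :
    firstMeet f k ≤ 1 := by
  classical
  have h3 : ∑' t : Fin k → Site d, wt f t = 1 := tsum_prod_eq_one hm
  calc firstMeet f k ≤ ∑' (r : Fin k → Site d) (t : Fin k → Site d), wt f r * wt f t := by
        refine ENNReal.tsum_le_tsum fun r => ENNReal.tsum_le_tsum fun t => ?_
        split_ifs
        · exact le_rfl
        · exact zero_le
    _ = 1 := by
        simp only [ENNReal.tsum_mul_left, h3, mul_one]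

/-- At most `K` starting times near the end of the block are lost. The absolute value is needed
because `a` may be negative. -/
lemma sum_ite_add_le_ge (K M k : ℕ) (hk : k ≤ K) (a : ℝ) :
    M * a - K * |a| ≤ ∑ n ∈ Finset.range M, if n + k ≤ M then a else 0 := by
  rw [← Finset.sum_filter, Finset.sum_const, nsmul_eq_mul]
  have h1 : ((Finset.range M).filter fun n => n + k ≤ M).card ≤ M :=
    (Finset.card_filter_le _ _).trans (by simp)
  have h2 : M ≤ ((Finset.range M).filter fun n => n + k ≤ M).card + K := by
    have : Finset.range (M - k) ⊆ (Finset.range M).filter fun n => n + k ≤ M := by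
      intro n hn
      simp only [Finset.mem_range, Finset.mem_filter] at hn ⊢
      omega
    have := Finset.card_le_card this
    rw [Finset.card_range] at this
    omega
  set c := ((Finset.range M).filter fun n => n + k ≤ M).card
  have h1' : (c : ℝ) ≤ M := by exact_mod_cast h1
  have h2' : (M : ℝ) ≤ c + K := by exact_mod_cast h2
  have h3 : ((M : ℝ) - c) * a ≤ (M - c) * |a| :=
    mul_le_mul_of_nonneg_left (le_abs_self a) (by linarith)
  have h4 : ((M : ℝ) - c) * |a| ≤ K * |a| := mul_le_mul_of_nonneg_right (by linarith) (abs_nonneg a)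
  linarith

/-- If the rate of the good detours exceeds `log p / log 2`, the number of open paths grows
strictly slower than its mean. -/
theorem growthRate_lt_of_detours {d : ℕ} {f : Site d → ℝ} {p : ℝ} (hf : Admissible f p) (K : ℕ)
    {b : ℕ → ℝ} (hb0 : ∀ l, 0 ≤ b l)
    (hb : ∀ l ∈ Finset.Icc 1 K, ∀ z, stepLaw f l z ≤ ENNReal.ofReal (b l))
    (hlog : Real.log p < Real.log 2 * ∑ k ∈ Finset.Icc 2 K, p ^ k * (firstMeet f k).toReal *
      (1 - 4 * k * ∑ l ∈ Finset.Icc 1 K, p ^ l * b l)) :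
    growthRate f p < (Real.log p : EReal) := by
  have hp := hf.pos
  have hlog2 : 0 < Real.log 2 := Real.log_pos (by norm_num)
  set B := ∑ l ∈ Finset.Icc 1 K, p ^ l * b l with hB
  have hB0 : 0 ≤ B := Finset.sum_nonneg fun l _ => mul_nonneg (pow_nonneg hp.le _) (hb0 l)
  set g : ℕ → ℝ := fun k => (firstMeet f k).toReal with hg
  have hg0 : ∀ k, 0 ≤ g k := fun k => ENNReal.toReal_nonneg
  have hgE : ∀ k, firstMeet f k = ENNReal.ofReal (g k) := fun k =>
    (ENNReal.ofReal_toReal (ne_top_of_le_ne_top ENNReal.one_ne_top (firstMeet_le_one hf.mass k))).symm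
  set a : ℕ → ℝ := fun k => p ^ k * g k * (1 - 4 * k * B) with ha
  -- The boundary loss does not depend on `M`, whereas the gap in `hlog` is multiplied by `M`.
  obtain ⟨M, hM0, hM⟩ : ∃ M : ℕ, 0 < M ∧ M * Real.log p < Real.log 2 *
      ∑ n ∈ Finset.range M, ∑ k ∈ Finset.Icc 2 K, (if n + k ≤ M then a k else 0) := by
    have hδ : 0 < Real.log 2 * ∑ k ∈ Finset.Icc 2 K, a k - Real.log p := sub_pos.2 hlog
    obtain ⟨M, hM⟩ := exists_nat_gt
      (Real.log 2 * (K * ∑ k ∈ Finset.Icc 2 K, |a k|) /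
        (Real.log 2 * ∑ k ∈ Finset.Icc 2 K, a k - Real.log p))
    have hM0 : (0 : ℝ) < M := lt_of_le_of_lt (div_nonneg (mul_nonneg hlog2.le
      (mul_nonneg (Nat.cast_nonneg _) (Finset.sum_nonneg fun _ _ => abs_nonneg _))) hδ.le) hM
    refine ⟨M, by exact_mod_cast hM0, ?_⟩
    rw [div_lt_iff₀ hδ] at hM
    have h1 : M * ∑ k ∈ Finset.Icc 2 K, a k - K * ∑ k ∈ Finset.Icc 2 K, |a k| ≤
        ∑ n ∈ Finset.range M, ∑ k ∈ Finset.Icc 2 K, (if n + k ≤ M then a k else 0) := by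
      rw [Finset.sum_comm, Finset.mul_sum, Finset.mul_sum, ← Finset.sum_sub_distrib]
      exact Finset.sum_le_sum fun k hk => sum_ite_add_le_ge K M k (Finset.mem_Icc.1 hk).2 _
    nlinarith
  set V := ∑ n ∈ Finset.range M, ∑ k ∈ Finset.Icc 2 K, (if n + k ≤ M then a k else 0) with hV
  have hMr : (0 : ℝ) < M := by exact_mod_cast hM0
  set δ := Real.log 2 * V - M * Real.log p with hδ
  have hδ0 : 0 < δ := sub_pos.2 hM
  -- With this choice the quadratic error `ε ^ 2 * M ^ 2` is smaller than the linear gain `ε * δ`.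
  obtain ⟨ε, hε0, hε1, hε2⟩ : ∃ ε : ℝ, 0 < ε ∧ ε < 1 ∧ ε * M ^ 2 < δ := by
    refine ⟨min (1 / 2) (δ / (2 * M ^ 2)), by positivity, ?_, ?_⟩
    · exact (min_le_left _ _).trans_lt (by norm_num)
    · calc min (1 / 2) (δ / (2 * M ^ 2)) * (M : ℝ) ^ 2 ≤ δ / (2 * M ^ 2) * (M : ℝ) ^ 2 := by
            gcongr; exact min_le_right _ _
        _ = δ / 2 := by field_simp
        _ < δ := by linarith
  set x := ∑ n ∈ Finset.range M, ∑ k ∈ Finset.Icc 2 K,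
      (if n + k ≤ M then p ^ (M + k) * g k else 0) with hx
  set y := ∑ n ∈ Finset.range M, ∑ k ∈ Finset.Icc 2 K,
      (if n + k ≤ M then p ^ (M + k) * g k else 0) * (4 * k * B) with hy
  have hterm : ∀ n k : ℕ, 0 ≤ (if n + k ≤ M then p ^ (M + k) * g k else 0) := by
    intro n k
    split_ifs
    · exact mul_nonneg (pow_nonneg hp.le _) (hg0 k)
    · exact le_rfl
  have hy0 : 0 ≤ y := Finset.sum_nonneg fun n _ => Finset.sum_nonneg fun k _ =>
    mul_nonneg (hterm n k) (by positivity)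
  have hxy : x - y = p ^ M * V := by
    rw [hx, hy, hV, ← Finset.sum_sub_distrib, Finset.mul_sum]
    refine Finset.sum_congr rfl fun n _ => ?_
    rw [← Finset.sum_sub_distrib, Finset.mul_sum]
    refine Finset.sum_congr rfl fun k _ => ?_
    split_ifs
    · rw [ha]; ring
    · simp
  have hBE : ∑ l ∈ Finset.Icc 1 K, ENNReal.ofReal p ^ l * ENNReal.ofReal (b l) =
      ENNReal.ofReal B := by
    rw [hB, ENNReal.ofReal_sum_of_nonneg fun l _ => mul_nonneg (pow_nonneg hp.le _) (hb0 l)]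
    refine Finset.sum_congr rfl fun l _ => ?_
    rw [ENNReal.ofReal_mul (pow_nonneg hp.le _), ENNReal.ofReal_pow hp.le]
  have htermE : ∀ n k : ℕ, (if n + k ≤ M then ENNReal.ofReal p ^ (M + k) * firstMeet f k else 0) =
      ENNReal.ofReal (if n + k ≤ M then p ^ (M + k) * g k else 0) := by
    intro n k
    split_ifs
    · rw [hgE, ENNReal.ofReal_mul (pow_nonneg hp.le _), ENNReal.ofReal_pow hp.le]
    · simp
  have hE : ENNReal.ofReal x ≤ expGood f p K M + ENNReal.ofReal y := by
    have := sum_firstMeet_le_expGood hf K M hb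
    rw [hBE] at this
    simp only [htermE] at this
    convert this using 1
    · rw [hx, ENNReal.ofReal_sum_of_nonneg fun n _ => Finset.sum_nonneg fun k _ => hterm n k]
      refine Finset.sum_congr rfl fun n _ => ?_
      rw [ENNReal.ofReal_sum_of_nonneg fun k _ => hterm n k]
    · congr 1
      rw [hy, ENNReal.ofReal_sum_of_nonneg fun n _ => Finset.sum_nonneg fun k _ =>
        mul_nonneg (hterm n k) (by positivity)]
      refine Finset.sum_congr rfl fun n _ => ?_
      rw [ENNReal.ofReal_sum_of_nonneg fun k _ => mul_nonneg (hterm n k) (by positivity)]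
      refine Finset.sum_congr rfl fun k _ => ?_
      rw [ENNReal.ofReal_mul (hterm n k), ENNReal.ofReal_mul (by positivity),
        ENNReal.ofReal_mul (by norm_num), ENNReal.ofReal_natCast]
      simp
  have hE2 : ENNReal.ofReal (p ^ M * V) ≤ expGood f p K M := by
    rw [← hxy, ENNReal.ofReal_sub _ hy0]
    exact tsub_le_iff_right.2 hE
  refine growthRate_lt_of_fracMoment_lt hf (θ := 1 - ε) (by linarith) (by linarith) hM0 ?_
  by_contra! hcon
  have hfm := fracMoment_add_expGood_le hf hε0 hε1 K M
  have hle : ENNReal.ofReal (p ^ ((1 - ε) * M) + ε * Real.log 2 * (p ^ M * V)) ≤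
      ENNReal.ofReal (p ^ M * (1 + ε ^ 2 * M ^ 2)) := by
    refine ENNReal.ofReal_add_le.trans (le_trans ?_ hfm)
    rw [← ENNReal.ofReal_rpow_of_pos hp, ENNReal.ofReal_mul (by positivity)]
    gcongr
  rw [ENNReal.ofReal_le_ofReal_iff (by positivity)] at hle
  -- The lower bound `exp y ≥ 1 + y` at `y = -ε M log p` makes the contradiction linear in `ε`.
  have hQ : p ^ M * (1 - ε * M * Real.log p) ≤ p ^ ((1 - ε) * M) := by
    rw [show (1 - ε) * (M : ℝ) = M + -(ε * M) by ring, Real.rpow_add hp, Real.rpow_natCast]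
    gcongr
    rw [Real.rpow_def_of_pos hp]
    have := Real.add_one_le_exp (Real.log p * -(ε * M))
    linarith
  have hpM : 0 < p ^ M := pow_pos hp M
  have h6 : p ^ M * (1 - ε * M * Real.log p + ε * Real.log 2 * V) ≤ p ^ M * (1 + ε ^ 2 * M ^ 2) := by
    nlinarith
  have h7 := le_of_mul_le_mul_left h6 hpM
  have h8 : ε * δ ≤ ε * (ε * M ^ 2) := by rw [hδ]; nlinarith
  exact absurd (le_of_mul_le_mul_left h8 hε0) (not_le.2 hε2)

/-! ### First meetings of two walks and convolution powers. -/

/-- A symmetric probability kernel. -/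
structure IsSymmKernel {d : ℕ} (f : Site d → ℝ) : Prop where
  nonneg : ∀ z, 0 ≤ f z
  mass : ∑' z, ENNReal.ofReal (f z) = 1
  symm : ∀ z, f (-z) = f z

lemma IsSymmKernel.summable {d : ℕ} {f : Site d → ℝ} (h : IsSymmKernel f) : Summable f := by
  have := ENNReal.summable_toReal (f := fun z => ENNReal.ofReal (f z)) (by rw [h.mass]; simp)
  simpa [ENNReal.toReal_ofReal (h.nonneg _)] using this

lemma IsSymmKernel.tsum_eq_one {d : ℕ} {f : Site d → ℝ} (h : IsSymmKernel f) : ∑' z, f z = 1 := by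
  have := ENNReal.ofReal_tsum_of_nonneg h.nonneg h.summable
  rw [h.mass] at this
  rwa [ENNReal.ofReal_eq_one] at this

lemma tsum_wt {d : ℕ} {f : Site d → ℝ} (hm : ∑' z, ENNReal.ofReal (f z) = 1) (k : ℕ) :
    ∑' t : Fin k → Site d, wt f t = 1 := tsum_prod_eq_one hm

lemma wt_append {d a b : ℕ} (f : Site d → ℝ) (r : Fin a → Site d) (u : Fin b → Site d) :
    wt f (Fin.append r u) = wt f r * wt f u := by
  simp [wt, Fin.prod_univ_add]

lemma tsum_stepLaw_mul {d : ℕ} (f : Site d → ℝ) (k : ℕ) (φ : Site d → ENNReal) :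
    ∑' z, stepLaw f k z * φ z = ∑' r : Fin k → Site d, wt f r * φ (pos r k) := by
  classical
  unfold stepLaw
  simp only [← ENNReal.tsum_mul_right]
  rw [ENNReal.tsum_comm]
  refine tsum_congr fun r => ?_
  rw [tsum_eq_single (pos r k)]
  · simp
  · intro z hz
    rw [if_neg hz.symm, zero_mul]

lemma stepLaw_add {d : ℕ} (f : Site d → ℝ) (a b : ℕ) (z : Site d) :
    stepLaw f (a + b) z = ∑' y, stepLaw f a y * stepLaw f b (z - y) := by
  classical
  rw [tsum_stepLaw_mul]
  conv_lhs => unfold stepLaw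
  rw [tsum_append]
  refine tsum_congr fun r => ?_
  rw [← tsum_ite_add_pos_eq, ← ENNReal.tsum_mul_left]
  refine tsum_congr fun u => ?_
  rw [pos_append_right, wt_append]
  simp

lemma stepLaw_one {d : ℕ} (f : Site d → ℝ) (z : Site d) :
    stepLaw f 1 z = ENNReal.ofReal (f z) := by
  classical
  unfold stepLaw
  rw [← (Equiv.funUnique (Fin 1) (Site d)).symm.tsum_eq, tsum_eq_single z]
  · simp [pos, wt]
  · intro y hy
    rw [if_neg]
    simpa [pos] using hy

lemma stepLaw_zero {d : ℕ} (f : Site d → ℝ) (z : Site d) :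
    stepLaw f 0 z = if z = 0 then 1 else 0 := by
  classical
  unfold stepLaw
  rw [tsum_fintype]
  simp [pos, wt, eq_comm]

lemma stepLaw_le_one {d : ℕ} {f : Site d → ℝ} (hm : ∑' z, ENNReal.ofReal (f z) = 1) (l : ℕ)
    (z : Site d) : stepLaw f l z ≤ 1 := by
  classical
  rw [← tsum_wt hm l]
  refine ENNReal.tsum_le_tsum fun u => ?_
  split_ifs
  · exact le_rfl
  · exact zero_le

lemma stepLaw_neg {d : ℕ} {f : Site d → ℝ} (hf : IsSymmKernel f) (l : ℕ) (z : Site d) :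
    stepLaw f l (-z) = stepLaw f l z := by
  classical
  unfold stepLaw
  rw [← (Equiv.neg (Fin l → Site d)).tsum_eq]
  refine tsum_congr fun u => ?_
  have : wt f (-u) = wt f u := by simp [wt, hf.symm]
  simp only [Equiv.neg_apply, pos_neg, neg_inj, this]

lemma convPow_nonneg {d : ℕ} {f : Site d → ℝ} (hf : ∀ z, 0 ≤ f z) (n : ℕ) (z : Site d) :
    0 ≤ convPow f n z := by
  induction n generalizing z with
  | zero => simp only [convPow]; split_ifs <;> norm_num
  | succ n ih => exact tsum_nonneg fun y => mul_nonneg (ih y) (hf _)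

lemma stepLaw_eq_convPow {d : ℕ} {f : Site d → ℝ} (hf : IsSymmKernel f) (n : ℕ) (z : Site d) :
    stepLaw f n z = ENNReal.ofReal (convPow f n z) := by
  induction n generalizing z with
  | zero => rw [stepLaw_zero]; simp only [convPow]; split_ifs <;> simp
  | succ n ih =>
    have hle : ∀ y, convPow f n y ≤ 1 := by
      intro y
      have := stepLaw_le_one hf.mass n y
      rwa [ih, ENNReal.ofReal_le_one] at this
    have hs : Summable fun y => convPow f n y * f (z - y) := by
      refine Summable.of_nonneg_of_le (fun y => mul_nonneg (convPow_nonneg hf.nonneg n y)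
        (hf.nonneg _)) (fun y => mul_le_of_le_one_left (hf.nonneg _) (hle y)) ?_
      exact (Equiv.subLeft z).summable_iff.2 hf.summable
    rw [stepLaw_add, convPow, ENNReal.ofReal_tsum_of_nonneg (fun y => mul_nonneg
      (convPow_nonneg hf.nonneg n y) (hf.nonneg _)) hs]
    refine tsum_congr fun y => ?_
    rw [ih, stepLaw_one, ENNReal.ofReal_mul (convPow_nonneg hf.nonneg n y)]

open Classical in
/-- The probability that two independent walks are at the same site after `k` steps. -/
noncomputable def meet {d : ℕ} (f : Site d → ℝ) (k : ℕ) : ENNReal :=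
  ∑' (r : Fin k → Site d) (t : Fin k → Site d),
    if pos r k = pos t k then wt f r * wt f t else 0

/-- By symmetry the second walk can be reversed and appended to the first, giving a walk of length
`2 * k` that returns to the origin. -/
lemma meet_eq_stepLaw {d : ℕ} {f : Site d → ℝ} (hf : IsSymmKernel f) (k : ℕ) :
    meet f k = stepLaw f (2 * k) 0 := by
  classical
  rw [two_mul, stepLaw_add, tsum_stepLaw_mul]
  unfold meet
  refine tsum_congr fun r => ?_
  rw [zero_sub, stepLaw_neg hf]
  unfold stepLaw
  rw [← ENNReal.tsum_mul_left]
  refine tsum_congr fun t => ?_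
  simp only [mul_ite, mul_zero, eq_comm]

/-- A meeting at time `k` is either the first one or is preceded by one at some `j`. Both walks are
cut at `j`, and the two meetings are independent. -/
lemma meet_le {d : ℕ} (f : Site d → ℝ) (k : ℕ) :
    meet f k ≤ firstMeet f k + ∑ j ∈ Finset.Ioo 0 k, meet f j * meet f (k - j) := by
  classical
  have h1 : meet f k ≤ ∑' (r : Fin k → Site d) (t : Fin k → Site d),
      ((if pos r k = pos t k ∧ ∀ j, 0 < j → j < k → pos r j ≠ pos t j then wt f r * wt f t else 0) +
      ∑ j ∈ Finset.Ioo 0 k, if pos r j = pos t j ∧ pos r k = pos t k then wt f r * wt f t else 0) := by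
    refine ENNReal.tsum_le_tsum fun r => ENNReal.tsum_le_tsum fun t => ?_
    by_cases h : pos r k = pos t k
    · rw [if_pos h]
      by_cases h' : ∀ j, 0 < j → j < k → pos r j ≠ pos t j
      · rw [if_pos ⟨h, h'⟩]
        exact le_self_add
      · push Not at h'
        obtain ⟨j, hj1, hj2, hj3⟩ := h'
        refine le_trans ?_ le_add_self
        refine le_trans ?_ (Finset.single_le_sum (f := fun j => if pos r j = pos t j ∧
          pos r k = pos t k then wt f r * wt f t else 0) (fun _ _ => zero_le)
          (Finset.mem_Ioo.2 ⟨hj1, hj2⟩))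
        rw [if_pos ⟨hj3, h⟩]
    · rw [if_neg h]; exact zero_le
  refine h1.trans ?_
  simp only [ENNReal.tsum_add]
  rw [show (∑' (r : Fin k → Site d) (t : Fin k → Site d), if pos r k = pos t k ∧
    ∀ j, 0 < j → j < k → pos r j ≠ pos t j then wt f r * wt f t else 0) = firstMeet f k from rfl]
  gcongr
  have h2 : ∀ r : Fin k → Site d, (∑' t : Fin k → Site d, ∑ j ∈ Finset.Ioo 0 k,
      if pos r j = pos t j ∧ pos r k = pos t k then wt f r * wt f t else 0) =
      ∑ j ∈ Finset.Ioo 0 k, ∑' t : Fin k → Site d,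
      if pos r j = pos t j ∧ pos r k = pos t k then wt f r * wt f t else 0 := fun r =>
    Summable.tsum_finsetSum fun _ _ => ENNReal.summable
  simp only [h2]
  rw [Summable.tsum_finsetSum fun _ _ => ENNReal.summable]
  refine Finset.sum_le_sum fun j hj => ?_
  rw [Finset.mem_Ioo] at hj
  obtain ⟨i, rfl⟩ := Nat.exists_eq_add_of_lt hj.2
  rw [show j + i + 1 - j = i + 1 by omega, add_assoc]
  generalize i + 1 = m
  refine le_of_eq ?_
  rw [tsum_append]
  simp only [tsum_append j m]
  unfold meet
  simp only [← ENNReal.tsum_mul_right]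
  refine tsum_congr fun r => ?_
  rw [ENNReal.tsum_comm]
  refine tsum_congr fun t => ?_
  rw [← ENNReal.tsum_mul_left]
  refine tsum_congr fun r' => ?_
  rw [← ENNReal.tsum_mul_left]
  refine tsum_congr fun t' => ?_
  rw [pos_append_left _ _ le_rfl, pos_append_left _ _ le_rfl, pos_append_right, pos_append_right,
    wt_append, wt_append]
  by_cases h : pos r j = pos t j
  · by_cases h' : pos r' m = pos t' m
    · simp only [h, h', and_self, if_true]; ring
    · simp [h, h']
  · simp [h]

lemma le_firstMeet {d : ℕ} {f : Site d → ℝ} (hf : IsSymmKernel f) (k : ℕ) :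
    convPow f (2 * k) 0 - ∑ j ∈ Finset.Ioo 0 k, convPow f (2 * j) 0 * convPow f (2 * (k - j)) 0 ≤
      (firstMeet f k).toReal := by
  have hne : firstMeet f k ≠ ⊤ :=
    ne_top_of_le_ne_top ENNReal.one_ne_top (firstMeet_le_one hf.mass k)
  have h := meet_le f k
  simp only [meet_eq_stepLaw hf, stepLaw_eq_convPow hf,
    ← ENNReal.ofReal_mul (convPow_nonneg hf.nonneg _ _)] at h
  have hs : 0 ≤ ∑ j ∈ Finset.Ioo 0 k, convPow f (2 * j) 0 * convPow f (2 * (k - j)) 0 :=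
    Finset.sum_nonneg fun j _ => mul_nonneg (convPow_nonneg hf.nonneg _ _)
      (convPow_nonneg hf.nonneg _ _)
  rw [← ENNReal.ofReal_sum_of_nonneg fun j _ => mul_nonneg (convPow_nonneg hf.nonneg _ _)
      (convPow_nonneg hf.nonneg _ _), ← ENNReal.ofReal_toReal hne,
    ← ENNReal.ofReal_add ENNReal.toReal_nonneg hs,
    ENNReal.ofReal_le_ofReal_iff (add_nonneg ENNReal.toReal_nonneg hs)] at h
  linarith

lemma firstMeet_le {d : ℕ} {f : Site d → ℝ} (hf : IsSymmKernel f) (k : ℕ) :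
    (firstMeet f k).toReal ≤ convPow f (2 * k) 0 := by
  classical
  refine ENNReal.toReal_le_of_le_ofReal (convPow_nonneg hf.nonneg _ _) ?_
  rw [← stepLaw_eq_convPow hf, ← meet_eq_stepLaw hf]
  refine ENNReal.tsum_le_tsum fun r => ENNReal.tsum_le_tsum fun t => ?_
  by_cases h : pos r k = pos t k
  · rw [if_pos h]
    split_ifs
    · exact le_rfl
    · exact zero_le
  · rw [if_neg h, if_neg fun hc => h hc.1]

/-! ### From the growth rate to the second threshold. -/

lemma admissible_of_mem {d : ℕ} {f : Site d → ℝ} (hf : IsSymmKernel f) {p : ℝ}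
    (hp : p ∈ Set.Ioc 0 (pMax f)) : Admissible f p := by
  refine ⟨hf.nonneg, hf.mass, hp.1, fun z => ?_⟩
  rcases (hf.nonneg z).eq_or_lt with h | h
  · rw [← h, mul_zero]; exact zero_le_one
  · have h1 : pMax f ≤ 1 / f z := by
      refine csInf_le ⟨0, ?_⟩ ⟨z, h, rfl⟩
      rintro _ ⟨y, hy, rfl⟩
      exact div_nonneg zero_le_one (hf.nonneg y)
    exact (le_div_iff₀ h).1 (hp.2.trans h1)

/-- The second threshold is at least `x` if for all `p ∈ [1, x)` there are enough good detours. -/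
theorem le_secondThreshold {d : ℕ} {f : Site d → ℝ} (hf : IsSymmKernel f) {x : ℝ}
    (hx : x ≤ pMax f) (K : ℕ) {b : ℕ → ℝ} (hb0 : ∀ l, 0 ≤ b l)
    (hb : ∀ l ∈ Finset.Icc 1 K, ∀ z, convPow f l z ≤ b l)
    (hlog : ∀ p, 1 ≤ p → p < x →
      Real.log p < Real.log 2 * ∑ k ∈ Finset.Icc 2 K, p ^ k * (firstMeet f k).toReal *
      (1 - 4 * k * ∑ l ∈ Finset.Icc 1 K, p ^ l * b l)) :
    x ≤ secondThreshold f := by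
  unfold secondThreshold
  split_ifs with h
  · refine le_csInf h fun p hp => ?_
    by_contra! hpx
    have hadm := admissible_of_mem hf hp.1
    refine absurd hp.2 (ne_of_lt ?_)
    rcases lt_or_ge p 1 with h1 | h1
    -- For `p < 1` no detours are needed: with `K = 1` the sum over `k` is empty and `log p < 0`.
    · refine growthRate_lt_of_detours hadm 1 (b := fun _ => 1) (fun _ => zero_le_one)
        (fun l _ z => by simpa using stepLaw_le_one hf.mass l z) ?_
      simpa using Real.log_neg hadm.pos h1
    · refine growthRate_lt_of_detours hadm K hb0 (fun l hl z => ?_) (hlog p h1 hpx)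
      rw [stepLaw_eq_convPow hf]
      exact ENNReal.ofReal_le_ofReal (hb l hl z)
  · exact hx

/-- Averaging over the first `n` steps, the last step alone spreads the mass by the bound `c`. -/
lemma convPow_succ_le {d : ℕ} {f : Site d → ℝ} (hf : IsSymmKernel f) {c : ℝ} (hc0 : 0 ≤ c)
    (hc : ∀ z, f z ≤ c) (n : ℕ) (z : Site d) : convPow f (n + 1) z ≤ c := by
  rw [← ENNReal.ofReal_le_ofReal_iff hc0, ← stepLaw_eq_convPow hf, stepLaw_add]
  calc ∑' y, stepLaw f n y * stepLaw f 1 (z - y) ≤ ∑' y, stepLaw f n y * ENNReal.ofReal c := by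
        gcongr with y
        rw [stepLaw_one]
        exact ENNReal.ofReal_le_ofReal (hc _)
    _ = ENNReal.ofReal c := by
        rw [tsum_stepLaw_mul, ENNReal.tsum_mul_right, tsum_wt hf.mass, one_mul]

lemma le_pMax {d : ℕ} {f : Site d → ℝ} {x : ℝ} (hne : ∃ z, 0 < f z)
    (h : ∀ z, 0 < f z → x ≤ 1 / f z) : x ≤ pMax f := by
  obtain ⟨z, hz⟩ := hne
  refine le_csInf ⟨_, z, hz, rfl⟩ ?_
  rintro _ ⟨y, hy, rfl⟩
  exact h y hy

/-! ### The nearest-neighbour model. -/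

/-- The unit vectors of `ℤ^d`. -/
def unitVec {d : ℕ} (a : Fin d × Bool) : Site d := Pi.single a.1 (if a.2 then 1 else -1)

lemma unitVec_injective {d : ℕ} : Function.Injective (unitVec : Fin d × Bool → Site d) := by
  rintro ⟨i, b⟩ ⟨i', b'⟩ h
  have h1 := congrFun h i
  simp only [unitVec, Pi.single_eq_same] at h1
  by_cases hi : i = i'
  · subst hi
    simp only [Pi.single_eq_same] at h1
    cases b <;> cases b' <;> simp_all
  · rw [Pi.single_eq_of_ne hi] at h1
    cases b <;> simp at h1

lemma unitVec_not {d : ℕ} (i : Fin d) (b : Bool) : unitVec (i, !b) = - unitVec (i, b) := by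
  cases b <;> simp [unitVec, ← Pi.single_neg]

lemma sum_abs_eq_one_iff {d : ℕ} (z : Site d) : ∑ i, |z i| = 1 ↔ ∃ a, unitVec a = z := by
  classical
  constructor
  · intro h
    have hex : ∃ i, z i ≠ 0 := by
      by_contra! hc
      simp [hc] at h
    obtain ⟨i, hi⟩ := hex
    have h1 : 1 ≤ |z i| := Int.one_le_abs hi
    rw [← Finset.add_sum_erase _ _ (Finset.mem_univ i)] at h
    have h2 : 0 ≤ ∑ j ∈ Finset.univ.erase i, |z j| := Finset.sum_nonneg fun _ _ => abs_nonneg _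
    have h3 : ∑ j ∈ Finset.univ.erase i, |z j| = 0 := by omega
    have h4 : |z i| = 1 := by omega
    have h5 : ∀ j, j ≠ i → z j = 0 := fun j hj =>
      abs_eq_zero.1 ((Finset.sum_eq_zero_iff_of_nonneg fun _ _ => abs_nonneg _).1 h3 j
        (Finset.mem_erase.2 ⟨hj, Finset.mem_univ _⟩))
    have key : ∀ b : Bool, z i = (if b then 1 else -1) → unitVec (i, b) = z := by
      intro b hb
      funext j
      by_cases hj : j = i
      · subst hj; simp [unitVec, hb]
      · simp [unitVec, hj, h5 j hj]
    rcases abs_eq (zero_le_one' ℤ) |>.1 h4 with h6 | h6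
    · exact ⟨(i, true), key true (by simpa using h6)⟩
    · exact ⟨(i, false), key false (by simpa using h6)⟩
  · rintro ⟨⟨i, b⟩, rfl⟩
    rw [Finset.sum_eq_single i]
    · cases b <;> simp [unitVec]
    · intro j _ hj; simp [unitVec, hj]
    · simp

lemma nearestNeighbor_unitVec {d : ℕ} (a : Fin d × Bool) :
    nearestNeighbor d (unitVec a) = 1 / (2 * d) := by
  rw [nearestNeighbor, if_pos ((sum_abs_eq_one_iff _).2 ⟨a, rfl⟩)]

lemma nearestNeighbor_le {d : ℕ} (z : Site d) : nearestNeighbor d z ≤ 1 / (2 * d) := by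
  unfold nearestNeighbor
  split_ifs
  · exact le_rfl
  · positivity

lemma isSymmKernel_nearestNeighbor {d : ℕ} (hd : 0 < d) : IsSymmKernel (nearestNeighbor d) where
  nonneg z := by unfold nearestNeighbor; split_ifs <;> positivity
  symm z := by simp [nearestNeighbor]
  mass := by
    classical
    rw [tsum_eq_sum (s := Finset.univ.image unitVec), Finset.sum_image fun a _ b _ h =>
      unitVec_injective h]
    · simp only [nearestNeighbor_unitVec, Finset.sum_const, Finset.card_univ, Fintype.card_prod,
        Fintype.card_fin, Fintype.card_bool, nsmul_eq_mul]
      rw [← ENNReal.ofReal_natCast, ← ENNReal.ofReal_mul (by positivity)]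
      rw [ENNReal.ofReal_eq_one]
      push_cast
      field_simp
    · intro z hz
      rw [nearestNeighbor, if_neg, ENNReal.ofReal_zero]
      rw [sum_abs_eq_one_iff]
      simpa using hz

/-- Two walks with different first steps meet at time `2` if they use the same two steps in opposite
order, or if both return to the origin. This gives at least `2 (2d)^2 - 3 (2d)` pairs, each of
weight `(2d)^{-4}`. -/
lemma firstMeet_two_nearestNeighbor {d : ℕ} (hd : 2 ≤ d) :
    1 / (2 * (d : ℝ) ^ 2) - 3 / (8 * (d : ℝ) ^ 3) ≤ (firstMeet (nearestNeighbor d) 2).toReal := by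
  classical
  have hd' : (0 : ℝ) < d := by positivity
  set E := Fin d × Bool
  have hcardE : Fintype.card E = 2 * d := by simp [E, mul_comm]
  let c : ENNReal := ENNReal.ofReal (1 / (2 * d)) ^ 4
  let G : (Fin 2 → Site d) × (Fin 2 → Site d) → ENNReal := fun x =>
    if pos x.1 2 = pos x.2 2 ∧ ∀ j, 0 < j → j < 2 → pos x.1 j ≠ pos x.2 j then
      wt (nearestNeighbor d) x.1 * wt (nearestNeighbor d) x.2 else 0
  let opp : E → E := fun a => (a.1, !a.2)
  let ι : (E × E) ⊕ (E × E) → (Fin 2 → Site d) × (Fin 2 → Site d) := Sum.elim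
    (fun x => (![unitVec x.1, unitVec x.2], ![unitVec x.2, unitVec x.1]))
    (fun x => (![unitVec x.1, unitVec (opp x.1)], ![unitVec x.2, unitVec (opp x.2)]))
  let T₁ : Finset (E × E) := Finset.univ.offDiag
  -- When `b` is opposite to `a`, both walks return to the origin by exchanging their steps; this
  -- pair is already in the first family and is removed here.
  let T₂ : Finset (E × E) := T₁ \ Finset.univ.image fun a => (a, opp a)
  let T : Finset ((E × E) ⊕ (E × E)) := T₁.disjSum T₂
  have hcard : 2 * (2 * d) ^ 2 ≤ T.card + 3 * (2 * d) := by
    have h1 : T₁.card + 2 * d = (2 * d) ^ 2 := by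
      have := Finset.offDiag_card (Finset.univ : Finset E)
      rw [Finset.card_univ, hcardE] at this
      have h2 : 2 * d ≤ 2 * d * (2 * d) := Nat.le_mul_self _
      simp only [T₁]
      rw [this, sq]; omega
    have h2 : T₁.card ≤ T₂.card + 2 * d := by
      have h3 := Finset.le_card_sdiff (Finset.univ.image fun a : E => (a, opp a)) T₁
      have h4 : (Finset.univ.image fun a : E => (a, opp a)).card ≤ 2 * d :=
        Finset.card_image_le.trans (by rw [Finset.card_univ, hcardE])
      simp only [T₂]
      omega
    simp only [T, Finset.card_disjSum]
    omega
  have hu := unitVec_injective (d := d)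
  have hoppv : ∀ a : E, unitVec a + unitVec (opp a) = 0 := by
    rintro ⟨i, b⟩
    simp only [opp, unitVec_not, add_neg_cancel]
  have hinj : Set.InjOn ι T := by
    rintro (⟨a, b⟩ | ⟨a, b⟩) hx (⟨a', b'⟩ | ⟨a', b'⟩) hy h
    · simp only [ι, Sum.elim_inl, Prod.mk.injEq, Matrix.vecCons_inj, hu.eq_iff] at h
      simp [h.1.1, h.2.1]
    · simp only [ι, Sum.elim_inl, Sum.elim_inr, Prod.mk.injEq, Matrix.vecCons_inj, hu.eq_iff] at h
      exfalso
      have h2 : (a', b') ∈ T₂ := by simpa [T] using hy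
      refine (Finset.mem_sdiff.1 h2).2 (Finset.mem_image.2 ⟨a', Finset.mem_univ _, ?_⟩)
      rw [← h.1.2.1, h.2.1]
    · simp only [ι, Sum.elim_inl, Sum.elim_inr, Prod.mk.injEq, Matrix.vecCons_inj, hu.eq_iff] at h
      exfalso
      have h2 : (a, b) ∈ T₂ := by simpa [T] using hx
      refine (Finset.mem_sdiff.1 h2).2 (Finset.mem_image.2 ⟨a, Finset.mem_univ _, ?_⟩)
      rw [h.1.2.1, h.2.1]
    · simp only [ι, Sum.elim_inr, Prod.mk.injEq, Matrix.vecCons_inj, hu.eq_iff] at h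
      simp [h.1.1, h.2.1]
  have hpos1 : ∀ x y : Site d, pos ![x, y] 1 = x := by
    intro x y; simp [pos]
  have hpos2 : ∀ x y : Site d, pos ![x, y] 2 = x + y := by
    intro x y; simp [pos, Fin.sum_univ_two]
  have hval : ∀ x ∈ T, G (ι x) = c := by
    have hG : ∀ a b a' b' : E, a ≠ a' → unitVec a + unitVec b = unitVec a' + unitVec b' →
        G (![unitVec a, unitVec b], ![unitVec a', unitVec b']) = c := by
      intro a b a' b' hne heq
      simp only [G]
      rw [if_pos]
      · simp only [wt, Fin.prod_univ_two, Matrix.cons_val_zero, Matrix.cons_val_one,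
          nearestNeighbor_unitVec, c]
        ring
      · refine ⟨by rw [hpos2, hpos2, heq], fun j h0 h2 => ?_⟩
        obtain rfl : j = 1 := by omega
        rw [hpos1, hpos1]
        exact hu.ne hne
    have hT₂ : ∀ a b, (a, b) ∈ T₂ → a ≠ b := fun a b h => by
      simpa [T₁] using (Finset.mem_sdiff.1 h).1
    rintro (⟨a, b⟩ | ⟨a, b⟩) hx
    · exact hG a b b a (by simpa [T, T₁] using hx) (add_comm _ _)
    · exact hG a _ b _ (hT₂ a b (by simpa [T] using hx)) (by rw [hoppv, hoppv])
  have hle : (T.card : ENNReal) * c ≤ firstMeet (nearestNeighbor d) 2 := by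
    have h1 : firstMeet (nearestNeighbor d) 2 = ∑' x, G x := by
      rw [ENNReal.tsum_prod']; rfl
    rw [h1]
    refine le_trans (le_of_eq ?_) (ENNReal.sum_le_tsum (T.image ι))
    rw [Finset.sum_image hinj, Finset.sum_congr rfl hval, Finset.sum_const, nsmul_eq_mul]
  have hne : firstMeet (nearestNeighbor d) 2 ≠ ⊤ := ne_top_of_le_ne_top ENNReal.one_ne_top
    (firstMeet_le_one (isSymmKernel_nearestNeighbor (by omega)).mass 2)
  have hle2 := ENNReal.toReal_mono hne hle
  simp only [c] at hle2
  rw [ENNReal.toReal_mul, ENNReal.toReal_natCast, ENNReal.toReal_pow,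
    ENNReal.toReal_ofReal (by positivity)] at hle2
  refine le_trans ?_ hle2
  have hcard' : 2 * (2 * (d : ℝ)) ^ 2 ≤ T.card + 3 * (2 * d) := by exact_mod_cast hcard
  calc 1 / (2 * (d : ℝ) ^ 2) - 3 / (8 * (d : ℝ) ^ 3)
      = (2 * (2 * (d : ℝ)) ^ 2 - 3 * (2 * d)) * (1 / (2 * (d : ℝ))) ^ 4 := by field_simp; ring
    _ ≤ _ := by gcongr; linarith

/-- Only detours of length `2` are used. Since `p ≤ 2`, ears cost at most `8 (p + p ^ 2) / (2 d) ≤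
24 / d`; this explains `24 ≤ d`. The resulting errors `12 / d ^ 3` and `3 / (8 d ^ 3)` are rounded
up to `13 / d ^ 3`. -/
lemma le_secondThreshold_nearestNeighbor {d : ℕ} (hd : 24 ≤ d) :
    1 + Real.log 2 / (2 * (d : ℝ) ^ 2) + -13 / (d : ℝ) ^ 3 ≤
      secondThreshold (nearestNeighbor d) := by
  have hf := isSymmKernel_nearestNeighbor (d := d) (by omega)
  have hd' : (24 : ℝ) ≤ d := by exact_mod_cast hd
  have hd0 : (0 : ℝ) < d := by linarith
  have hl0 : 0 < Real.log 2 := Real.log_pos (by norm_num)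
  have hl1 : Real.log 2 ≤ 1 := by linarith [Real.log_two_lt_d9]
  have hx2 : 1 + Real.log 2 / (2 * (d : ℝ) ^ 2) + -13 / (d : ℝ) ^ 3 ≤ 2 := by
    have h1 : Real.log 2 / (2 * (d : ℝ) ^ 2) ≤ 1 := by
      rw [div_le_one (by positivity)]; nlinarith
    have h2 : -13 / (d : ℝ) ^ 3 ≤ 0 := div_nonpos_of_nonpos_of_nonneg (by norm_num) (by positivity)
    linarith
  have hmax : 1 + Real.log 2 / (2 * (d : ℝ) ^ 2) + -13 / (d : ℝ) ^ 3 ≤ pMax (nearestNeighbor d) := by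
    refine le_pMax ⟨unitVec (⟨0, by omega⟩, true), ?_⟩ fun z hz => hx2.trans ?_
    · rw [nearestNeighbor_unitVec]; positivity
    · rw [le_div_iff₀ hz]
      have := nearestNeighbor_le z
      have h3 : 2 * (1 / (2 * (d : ℝ))) ≤ 1 := by
        rw [← mul_div_assoc, mul_one, div_le_one (by positivity)]; linarith
      linarith
  refine le_secondThreshold hf hmax 2 (b := fun _ => 1 / (2 * (d : ℝ))) (fun _ => by positivity)
    (fun l hl z => ?_) fun p hp1 hpx => ?_
  · obtain ⟨m, rfl⟩ := Nat.exists_eq_add_of_le (Finset.mem_Icc.1 hl).1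
    rw [add_comm]
    exact convPow_succ_le hf (by positivity) nearestNeighbor_le m z
  · have hp2 : p ≤ 2 := hpx.le.trans hx2
    have hg := firstMeet_two_nearestNeighbor (d := d) (by omega)
    set g := (firstMeet (nearestNeighbor d) 2).toReal
    rw [Finset.Icc_self, Finset.sum_singleton, show Finset.Icc 1 2 = {1, 2} from rfl,
      Finset.sum_pair (by norm_num)]
    have hlogp : Real.log p < Real.log 2 / (2 * (d : ℝ) ^ 2) + -13 / (d : ℝ) ^ 3 := by
      have := Real.log_le_sub_one_of_pos (x := p) (by linarith)
      linarith
    set w := (d : ℝ)⁻¹ with hw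
    have hw0 : 0 < w := by positivity
    have hw1 : 24 * w ≤ 1 := by rw [hw]; field_simp; exact hd'
    have e1 : Real.log 2 / (2 * (d : ℝ) ^ 2) + -13 / (d : ℝ) ^ 3 =
        Real.log 2 * (w ^ 2 / 2) - 13 * w ^ 3 := by rw [hw]; field_simp; ring
    have e2 : 1 / (2 * (d : ℝ) ^ 2) - 3 / (8 * (d : ℝ) ^ 3) = w ^ 2 / 2 - 3 / 8 * w ^ 3 := by
      rw [hw]; field_simp
    have e3 : 1 / (2 * (d : ℝ)) = w / 2 := by rw [hw]; field_simp
    rw [e1] at hlogp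
    rw [e2] at hg
    rw [e3]
    push_cast
    have hp2' : p ^ 2 ≤ 4 := by nlinarith
    have hp1' : 1 ≤ p ^ 2 := one_le_pow₀ hp1
    have h1 : 1 - 24 * w ≤ 1 - 4 * 2 * (p ^ 1 * (w / 2) + p ^ 2 * (w / 2)) := by
      rw [pow_one]; nlinarith
    have hg0 : 0 ≤ w ^ 2 / 2 - 3 / 8 * w ^ 3 := by
      have : 0 ≤ w ^ 2 * (1 / 2 - 3 / 8 * w) := mul_nonneg (sq_nonneg _) (by linarith)
      nlinarith
    have h2 : (w ^ 2 / 2 - 3 / 8 * w ^ 3) * (1 - 24 * w) ≤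
        p ^ 2 * g * (1 - 4 * 2 * (p ^ 1 * (w / 2) + p ^ 2 * (w / 2))) := by
      refine mul_le_mul ?_ h1 (by linarith) (by positivity)
      nlinarith
    have h3 : w ^ 2 / 2 - 13 * w ^ 3 ≤ (w ^ 2 / 2 - 3 / 8 * w ^ 3) * (1 - 24 * w) := by
      nlinarith [pow_pos hw0 3, pow_pos hw0 4]
    have h4 : Real.log 2 * (w ^ 2 / 2) - 13 * w ^ 3 ≤ Real.log 2 * (w ^ 2 / 2 - 13 * w ^ 3) := by
      nlinarith [pow_pos hw0 3]
    calc Real.log p < Real.log 2 * (w ^ 2 / 2) - 13 * w ^ 3 := hlogp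
      _ ≤ Real.log 2 * (w ^ 2 / 2 - 13 * w ^ 3) := h4
      _ ≤ _ := mul_le_mul_of_nonneg_left (h3.trans h2) hl0.le

theorem secondThreshold_nearestNeighbor_asymptotics :
    ∃ r : ℕ → ℝ, r =o[atTop] (fun d : ℕ => ((d : ℝ) ^ 2)⁻¹) ∧
      ∀ᶠ d : ℕ in atTop,
        1 + Real.log 2 / (2 * (d : ℝ) ^ 2) + r d ≤ secondThreshold (nearestNeighbor d) := by
  refine ⟨fun d => -13 / (d : ℝ) ^ 3, ?_, ?_⟩
  · rw [isLittleO_iff]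
    intro c hc
    obtain ⟨N, hN⟩ := exists_nat_gt (13 / c)
    filter_upwards [eventually_ge_atTop N, eventually_gt_atTop 0] with d hd hd0
    have hd' : (0 : ℝ) < d := by exact_mod_cast hd0
    have h1 : 13 / c ≤ d := hN.le.trans (by exact_mod_cast hd)
    rw [div_le_iff₀ hc] at h1
    rw [Real.norm_eq_abs, Real.norm_eq_abs, abs_div, abs_of_pos (pow_pos hd' 3),
      abs_of_pos (inv_pos.2 (pow_pos hd' 2)), abs_neg, abs_of_pos (by norm_num : (0 : ℝ) < 13),
      div_le_iff₀ (pow_pos hd' 3)]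
    calc (13 : ℝ) ≤ d * c := h1
      _ = _ := by field_simp
  · filter_upwards [eventually_ge_atTop 24] with d hd
    exact le_secondThreshold_nearestNeighbor hd

/-! ### Estimates for the binomial distribution. -/

/-- The largest probability of the binomial distribution with parameters `j` and `1 / 2`. -/
noncomputable def binomMode (j : ℕ) : ℝ := (j.choose (j / 2) : ℝ) / 2 ^ j

lemma binomMode_nonneg (j : ℕ) : 0 ≤ binomMode j := by unfold binomMode; positivity

/-- The ratio of consecutive left-hand sides is `4 (2n + 1)(2n + 3) / (n + 1)^2`, which is at most
`16`. -/
lemma centralBinom_sq_mul_le (n : ℕ) : (n.centralBinom : ℝ) ^ 2 * (2 * n + 1) ≤ 16 ^ n := by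
  induction n with
  | zero => simp
  | succ n ih =>
    have h := Nat.succ_mul_centralBinom_succ n
    have h' : ((n : ℝ) + 1) * (n + 1).centralBinom = 2 * (2 * n + 1) * n.centralBinom := by
      exact_mod_cast h
    have hn : (0 : ℝ) < ((n : ℝ) + 1) ^ 2 := by positivity
    refine le_of_mul_le_mul_left ?_ hn
    push_cast
    calc ((n : ℝ) + 1) ^ 2 * (((n + 1).centralBinom : ℝ) ^ 2 * (2 * (n + 1) + 1))
        = (((n : ℝ) + 1) * (n + 1).centralBinom) ^ 2 * (2 * (n + 1) + 1) := by ring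
      _ = 4 * (2 * n + 1) * (2 * n + 3) * ((n.centralBinom : ℝ) ^ 2 * (2 * n + 1)) := by
        rw [h']; ring
      _ ≤ 4 * (2 * n + 1) * (2 * n + 3) * 16 ^ n := by gcongr
      _ ≤ (16 * ((n : ℝ) + 1) ^ 2) * 16 ^ n :=
        mul_le_mul_of_nonneg_right (by nlinarith) (by positivity)
      _ = _ := by ring

/-- Even `j` is the central binomial bound; the mode at `2n + 1` equals the mode at `2n + 2`. -/
lemma binomMode_sq_le (j : ℕ) : binomMode j ^ 2 ≤ 1 / (j + 1) := by
  have even : ∀ n : ℕ, binomMode (2 * n) ^ 2 * (2 * n + 1) ≤ 1 := by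
    intro n
    have := centralBinom_sq_mul_le n
    unfold binomMode
    rw [show 2 * n / 2 = n by omega, ← Nat.centralBinom_eq_two_mul_choose, div_pow, ← pow_mul,
      show 2 * n * 2 = 4 * n by ring, pow_mul, div_mul_eq_mul_div, div_le_one (by positivity)]
    norm_num
    exact this
  rw [le_div_iff₀ (by positivity)]
  rcases Nat.even_or_odd' j with ⟨n, rfl | rfl⟩
  · have := even n
    push_cast
    exact this
  · have h1 : binomMode (2 * n + 1) = binomMode (2 * (n + 1)) := by
      unfold binomMode
      rw [show (2 * n + 1) / 2 = n by omega, show 2 * (n + 1) / 2 = n + 1 by omega]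
      have h2 : (2 * (n + 1)).choose (n + 1) = 2 * (2 * n + 1).choose n := by
        rw [show 2 * (n + 1) = 2 * n + 1 + 1 by ring, Nat.choose_succ_succ, Nat.choose_symm_half]
        ring
      rw [h2, show 2 * (n + 1) = 2 * n + 1 + 1 by ring, pow_succ]
      push_cast
      field_simp
      ring
    have h2 := even (n + 1)
    rw [h1]
    push_cast at h2 ⊢
    have := sq_nonneg (binomMode (2 * (n + 1)))
    nlinarith

lemma choose_div_eq (k j : ℕ) : (k.choose j : ℝ) / (((j : ℝ) + 1) * (j + 2) * (j + 3)) =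
    ((k + 3).choose (j + 3) : ℝ) / (((k : ℝ) + 1) * (k + 2) * (k + 3)) := by
  have h1 : ((k : ℝ) + 1) * k.choose j = (k + 1).choose (j + 1) * (j + 1) := by
    exact_mod_cast Nat.add_one_mul_choose_eq k j
  have h2 : ((k : ℝ) + 2) * (k + 1).choose (j + 1) = (k + 2).choose (j + 2) * (j + 2) := by
    exact_mod_cast Nat.add_one_mul_choose_eq (k + 1) (j + 1)
  have h3 : ((k : ℝ) + 3) * (k + 2).choose (j + 2) = (k + 3).choose (j + 3) * (j + 3) := by
    exact_mod_cast Nat.add_one_mul_choose_eq (k + 2) (j + 2)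
  rw [div_eq_div_iff (by positivity) (by positivity)]
  linear_combination ((k : ℝ) + 2) * (k + 3) * h1 + (k + 3) * (j + 1) * h2 + (j + 1) * (j + 2) * h3

/-- Absorbing the three factors into the binomial coefficient raises `k` to `k + 3`; what remains is
part of the expansion of `(α + (1 - α)) ^ (k + 3) = 1`. -/
lemma sum_binomial_inv_le {α : ℝ} (h0 : 0 < α) (h1 : α ≤ 1) (k : ℕ) :
    ∑ j ∈ Finset.range (k + 1), α ^ j * (1 - α) ^ (k - j) * k.choose j *
      (1 / (((j : ℝ) + 1) * (j + 2) * (j + 3))) ≤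
      1 / (α ^ 3 * (((k : ℝ) + 1) * (k + 2) * (k + 3))) := by
  have h2 : ∑ j ∈ Finset.range (k + 1), α ^ j * (1 - α) ^ (k - j) * k.choose j *
      (1 / (((j : ℝ) + 1) * (j + 2) * (j + 3))) =
      1 / (α ^ 3 * (((k : ℝ) + 1) * (k + 2) * (k + 3))) * ∑ j ∈ Finset.range (k + 1),
        α ^ (3 + j) * (1 - α) ^ (k + 3 - (3 + j)) * (k + 3).choose (3 + j) := by
    rw [Finset.mul_sum]
    refine Finset.sum_congr rfl fun j _ => ?_
    rw [show k + 3 - (3 + j) = k - j by omega, add_comm 3 j]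
    have := choose_div_eq k j
    rw [mul_assoc, mul_one_div, this, pow_add]
    field_simp
  rw [h2]
  refine mul_le_of_le_one_right (by positivity) ?_
  have h3 := add_pow α (1 - α) (k + 3)
  rw [add_sub_cancel, one_pow, show k + 3 + 1 = 3 + (k + 1) by ring, Finset.sum_range_add] at h3
  have h4 : 0 ≤ 1 - α := by linarith
  have h5 : 0 ≤ ∑ j ∈ Finset.range 3, α ^ j * (1 - α) ^ (k + 3 - j) * ((k + 3).choose j : ℝ) :=
    Finset.sum_nonneg fun j _ => by positivity
  linarith

/-- The number `j` of smoothing factors is binomial, and `binomMode j ^ 3` is of order at most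
`j^{-3/2}`. The half-integer power is linearized by `2 y ≤ l * y ^ 2 + 1 / l` with `l = k^{3/2}`, so
that only the inverse cubic moment of `sum_binomial_inv_le` is needed. -/
lemma sum_binomial_binomMode_le {α : ℝ} (h0 : 0 < α) (h1 : α ≤ 1) {k : ℕ} (hk : 0 < k) :
    ∑ j ∈ Finset.range (k + 1), α ^ j * (1 - α) ^ (k - j) * k.choose j * binomMode j ^ 3 ≤
      (3 / α ^ 3 + 1) * (k : ℝ) ^ (-(3 / 2) : ℝ) := by
  have hk' : (0 : ℝ) < k := by exact_mod_cast hk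
  have hα : 0 ≤ 1 - α := by linarith
  set l : ℝ := (k : ℝ) ^ (3 / 2 : ℝ) with hl
  have hl0 : 0 < l := Real.rpow_pos_of_pos hk' _
  have hl2 : l ^ 2 = (k : ℝ) ^ 3 := by
    rw [hl, ← Real.rpow_natCast, ← Real.rpow_mul hk'.le, ← Real.rpow_natCast]; norm_num
  have hmode : ∀ j : ℕ, binomMode j ^ 3 ≤
      3 * l * (1 / (((j : ℝ) + 1) * (j + 2) * (j + 3))) + 1 / l := by
    intro j
    set y := binomMode j ^ 3
    have hy : y ^ 2 ≤ 6 * (1 / (((j : ℝ) + 1) * (j + 2) * (j + 3))) := by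
      calc y ^ 2 = (binomMode j ^ 2) ^ 3 := by simp only [y]; ring
        _ ≤ (1 / ((j : ℝ) + 1)) ^ 3 := pow_le_pow_left₀ (sq_nonneg _) (binomMode_sq_le j) 3
        _ ≤ _ := by
          rw [div_pow, one_pow, mul_one_div, div_le_div_iff₀ (by positivity) (by positivity)]
          have : (0 : ℝ) ≤ j := Nat.cast_nonneg j
          nlinarith [mul_nonneg this this, mul_nonneg (mul_nonneg this this) this]
    have h2 : 2 * y ≤ l * y ^ 2 + 1 / l := by
      have : 0 ≤ (l * y - 1) ^ 2 / l := by positivity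
      have h3 : (l * y - 1) ^ 2 / l = l * y ^ 2 - 2 * y + 1 / l := by field_simp; ring
      linarith
    have h4 : l * y ^ 2 ≤ l * (6 * (1 / (((j : ℝ) + 1) * (j + 2) * (j + 3)))) := by gcongr
    have h5 : 0 ≤ 1 / l := by positivity
    linarith
  calc ∑ j ∈ Finset.range (k + 1), α ^ j * (1 - α) ^ (k - j) * k.choose j * binomMode j ^ 3
      ≤ ∑ j ∈ Finset.range (k + 1), α ^ j * (1 - α) ^ (k - j) * k.choose j *
        (3 * l * (1 / (((j : ℝ) + 1) * (j + 2) * (j + 3))) + 1 / l) := by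
        gcongr with j _; exact hmode j
    _ = 3 * l * (∑ j ∈ Finset.range (k + 1), α ^ j * (1 - α) ^ (k - j) * k.choose j *
        (1 / (((j : ℝ) + 1) * (j + 2) * (j + 3)))) + 1 / l *
        ∑ j ∈ Finset.range (k + 1), α ^ j * (1 - α) ^ (k - j) * k.choose j := by
        rw [Finset.mul_sum, Finset.mul_sum, ← Finset.sum_add_distrib]
        exact Finset.sum_congr rfl fun j _ => by ring
    _ ≤ 3 * l * (1 / (α ^ 3 * (((k : ℝ) + 1) * (k + 2) * (k + 3)))) + 1 / l * 1 := by
        rw [← add_pow, add_sub_cancel, one_pow]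
        gcongr
        exact sum_binomial_inv_le h0 h1 k
    _ ≤ 3 * l * (1 / (α ^ 3 * l ^ 2)) + 1 / l * 1 := by
        gcongr
        rw [hl2]
        nlinarith [mul_pos hk' hk', mul_pos (mul_pos hk' hk') hk']
    _ = (3 / α ^ 3 + 1) * (1 / l) := by field_simp
    _ = _ := by rw [Real.rpow_neg hk'.le, one_div]

/-! ### Convolution algebra -/

open AddMonoidAlgebra

/-- The total mass of an element of the convolution algebra. -/
noncomputable def totalMass (d : ℕ) : AddMonoidAlgebra ℝ (Site d) →ₐ[ℝ] ℝ :=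
  AddMonoidAlgebra.lift ℝ ℝ (Site d) 1

lemma totalMass_eq {d : ℕ} (x : AddMonoidAlgebra ℝ (Site d)) :
    totalMass d x = x.coeff.sum fun _ r => r := by
  simp [totalMass, AddMonoidAlgebra.lift_apply]

lemma totalMass_single {d : ℕ} (z : Site d) (r : ℝ) :
    totalMass d (AddMonoidAlgebra.single z r) = r := by
  simp [totalMass]

/-- All the coefficients are nonnegative. -/
def CoeffNonneg {d : ℕ} (x : AddMonoidAlgebra ℝ (Site d)) : Prop := ∀ z, 0 ≤ x.coeff z

lemma CoeffNonneg.mul {d : ℕ} {x y : AddMonoidAlgebra ℝ (Site d)} (hx : CoeffNonneg x)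
    (hy : CoeffNonneg y) : CoeffNonneg (x * y) := by
  intro z
  rw [coeff_mul_apply_left]
  exact Finset.sum_nonneg fun a _ => mul_nonneg (hx a) (hy _)

lemma CoeffNonneg.pow {d : ℕ} {x : AddMonoidAlgebra ℝ (Site d)} (hx : CoeffNonneg x) (n : ℕ) :
    CoeffNonneg (x ^ n) := by
  induction n with
  | zero =>
    intro z
    rw [pow_zero, AddMonoidAlgebra.one_def, AddMonoidAlgebra.coeff_single, Finsupp.single_apply]
    split_ifs <;> norm_num
  | succ n ih => rw [pow_succ]; exact ih.mul hx

lemma coeff_mul_le {d : ℕ} {x y : AddMonoidAlgebra ℝ (Site d)} (hx : CoeffNonneg x) {c : ℝ}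
    (hy : ∀ z, y.coeff z ≤ c) (z : Site d) : (x * y).coeff z ≤ totalMass d x * c := by
  rw [coeff_mul_apply_left, totalMass_eq, Finsupp.sum, Finsupp.sum, Finset.sum_mul]
  exact Finset.sum_le_sum fun a _ => mul_le_mul_of_nonneg_left (hy _) (hx a)

/-- Convolution powers become powers in a commutative algebra, where the binomial theorem is
available. -/
lemma convPow_eq_coeff {d : ℕ} {f : Site d → ℝ} (x : AddMonoidAlgebra ℝ (Site d))
    (hx : ∀ z, x.coeff z = f z) (n : ℕ) (z : Site d) : convPow f n z = (x ^ n).coeff z := by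
  induction n generalizing z with
  | zero =>
    simp only [convPow, pow_zero]
    rw [AddMonoidAlgebra.one_def, AddMonoidAlgebra.coeff_single, Finsupp.single_apply]
    simp only [eq_comm]
  | succ n ih =>
    rw [pow_succ, coeff_mul_apply_left, convPow]
    simp only
    rw [tsum_eq_sum (s := (x ^ n).coeff.support)]
    · refine Finset.sum_congr rfl fun y _ => ?_
      simp only [ih, hx, sub_eq_neg_add]
    · intro y hy
      rw [ih, Finsupp.notMem_support_iff.1 hy, zero_mul]

/-! ### Cube laws and a local bound for convolution powers. -/

/-- The cube `{0, …, m - 1}^d`. -/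
noncomputable def cube (d m : ℕ) : Finset (Site d) := Fintype.piFinset fun _ => Finset.Ico (0 : ℤ) m

lemma card_cube (d m : ℕ) : (cube d m).card = m ^ d := by
  simp [cube, Fintype.card_piFinset]

/-- The uniform distribution on the cube of side `m` with corner `a`. -/
noncomputable def cubeLaw {d : ℕ} (m : ℕ) (a : Site d) : AddMonoidAlgebra ℝ (Site d) :=
  ∑ v ∈ cube d m, AddMonoidAlgebra.single (a + v) (1 / (m : ℝ) ^ d)

lemma coeff_cubeLaw {d : ℕ} (m : ℕ) (a z : Site d) :
    (cubeLaw m a).coeff z = if z - a ∈ cube d m then 1 / (m : ℝ) ^ d else 0 := by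
  classical
  unfold cubeLaw
  rw [AddMonoidAlgebra.coeff_sum, Finsupp.coe_finsetSum, Finset.sum_apply]
  have : ∀ v, ((AddMonoidAlgebra.single (a + v) (1 / (m : ℝ) ^ d)).coeff z) =
      if z - a = v then 1 / (m : ℝ) ^ d else 0 := by
    intro v
    rw [AddMonoidAlgebra.coeff_single, Finsupp.single_apply]
    have : a + v = z ↔ z - a = v := by
      constructor
      · rintro rfl; abel
      · rintro rfl; abel
    simp only [this]
  simp only [this]
  rw [Finset.sum_ite_eq]

lemma totalMass_cubeLaw {d m : ℕ} (hm : 0 < m) (a : Site d) : totalMass d (cubeLaw m a) = 1 := by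
  unfold cubeLaw
  simp only [map_sum, totalMass_single, Finset.sum_const, card_cube, nsmul_eq_mul]
  push_cast
  field_simp

lemma coeffNonneg_cubeLaw {d : ℕ} (m : ℕ) (a : Site d) : CoeffNonneg (cubeLaw m a) := by
  intro z
  rw [coeff_cubeLaw]
  split_ifs <;> positivity

/-- The lattice point `m * b`. -/
def scaled {d : ℕ} (m : ℕ) (b : Fin d → ℕ) : Site d := fun i => (b i : ℤ) * m

/-- Translates of a cube of side `m` by distinct points of the lattice `m ℤ^d` are disjoint, so at
most one term is nonzero. -/
lemma sum_coeff_cubeLaw_le {d m : ℕ} (a z : Site d) (B : Finset (Fin d → ℕ)) :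
    ∑ b ∈ B, (cubeLaw m a).coeff (z - scaled m b) ≤ 1 / (m : ℝ) ^ d := by
  classical
  simp only [coeff_cubeLaw]
  rw [← Finset.sum_filter, Finset.sum_const, nsmul_eq_mul]
  refine mul_le_of_le_one_left (by positivity) ?_
  have : (B.filter fun b => z - scaled m b - a ∈ cube d m).card ≤ 1 := by
    rw [Finset.card_le_one]
    intro b hb b' hb'
    have h1 := (Finset.mem_filter.1 hb).2
    have h2 := (Finset.mem_filter.1 hb').2
    simp only [cube, Fintype.mem_piFinset, Finset.mem_Ico, scaled, Pi.sub_apply] at h1 h2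
    funext i
    obtain ⟨h3, h4⟩ := h1 i
    obtain ⟨h5, h6⟩ := h2 i
    by_contra hne
    have hm : (0 : ℤ) ≤ m := Int.natCast_nonneg m
    rcases lt_or_gt_of_ne hne with hlt | hlt
    · have : (b i : ℤ) + 1 ≤ b' i := by exact_mod_cast hlt
      nlinarith
    · have : (b' i : ℤ) + 1 ≤ b i := by exact_mod_cast hlt
      nlinarith
  exact_mod_cast this

/-- For `j ≥ 1` one cube law is split off and the disjointness bound is averaged over the others. -/
lemma sum_coeff_cubeLaw_pow_le {d m : ℕ} (hm : 0 < m) (a z : Site d) (B : Finset (Fin d → ℕ))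
    {j : ℕ} (hj : 0 < j) :
    ∑ b ∈ B, (cubeLaw m a ^ j).coeff (z - scaled m b) ≤ 1 / (m : ℝ) ^ d := by
  obtain ⟨i, rfl⟩ := Nat.exists_eq_succ_of_ne_zero hj.ne'
  rw [Nat.succ_eq_add_one, pow_succ]
  simp only [coeff_mul_apply_left, Finsupp.sum]
  rw [Finset.sum_comm]
  have hmass : totalMass d (cubeLaw m a ^ i) = 1 := by
    rw [map_pow, totalMass_cubeLaw hm, one_pow]
  rw [totalMass_eq] at hmass
  calc ∑ h ∈ (cubeLaw m a ^ i).coeff.support, ∑ b ∈ B,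
        (cubeLaw m a ^ i).coeff h * (cubeLaw m a).coeff (-h + (z - scaled m b))
      ≤ ∑ h ∈ (cubeLaw m a ^ i).coeff.support, (cubeLaw m a ^ i).coeff h * (1 / (m : ℝ) ^ d) := by
        refine Finset.sum_le_sum fun h _ => ?_
        rw [← Finset.mul_sum]
        refine mul_le_mul_of_nonneg_left ?_ ((coeffNonneg_cubeLaw m a).pow i h)
        simp only [← add_sub_assoc]
        exact sum_coeff_cubeLaw_le a _ B
    _ = 1 / (m : ℝ) ^ d := by
        rw [← Finset.sum_mul]
        change (∑ h ∈ (cubeLaw m a ^ i).coeff.support, (cubeLaw m a ^ i).coeff h) = 1 at hmass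
        rw [hmass, one_mul]

/-- The uniform distribution on `{0, m}^d`. -/
noncomputable def cornerLaw (d m : ℕ) : AddMonoidAlgebra ℝ (Site d) :=
  ∏ i : Fin d, (AddMonoidAlgebra.single (Pi.single i (m : ℤ)) (1 / 2 : ℝ) +
    AddMonoidAlgebra.single 0 (1 / 2 : ℝ))

lemma cornerLaw_pow (d m j : ℕ) : cornerLaw d m ^ j =
    ∑ b ∈ Fintype.piFinset fun _ : Fin d => Finset.range (j + 1),
      AddMonoidAlgebra.single (scaled m b) (∏ i, (j.choose (b i) : ℝ) / 2 ^ j) := by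
  classical
  have h1 : ∀ i : Fin d, (AddMonoidAlgebra.single (Pi.single i (m : ℤ)) (1 / 2 : ℝ) +
      AddMonoidAlgebra.single (0 : Site d) (1 / 2 : ℝ)) ^ j = ∑ n ∈ Finset.range (j + 1),
      AddMonoidAlgebra.single (Pi.single i ((n : ℤ) * m)) ((j.choose n : ℝ) / 2 ^ j) := by
    intro i
    rw [add_pow]
    refine Finset.sum_congr rfl fun n hn => ?_
    rw [AddMonoidAlgebra.single_pow, AddMonoidAlgebra.single_pow,
      AddMonoidAlgebra.single_mul_single, AddMonoidAlgebra.natCast_def,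
      AddMonoidAlgebra.single_mul_single]
    congr 1
    · rw [smul_zero, add_zero, add_zero, ← Pi.single_smul, nsmul_eq_mul]
    · rw [← pow_add, Nat.add_sub_of_le (by simpa [Nat.lt_succ_iff] using hn), one_div, inv_pow]
      ring
  unfold cornerLaw
  rw [← Finset.prod_pow]
  simp only [h1]
  rw [Finset.prod_univ_sum]
  refine Finset.sum_congr rfl fun b _ => ?_
  rw [AddMonoidAlgebra.prod_single]
  congr 1
  funext i
  simp [scaled, Finset.sum_apply, Pi.single_apply]

lemma totalMass_cornerLaw (d m : ℕ) : totalMass d (cornerLaw d m) = 1 := by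
  unfold cornerLaw
  rw [map_prod]
  refine Finset.prod_eq_one fun i _ => ?_
  rw [map_add, totalMass_single, totalMass_single]
  norm_num

lemma coeff_cubeLaw_pow_mul_cornerLaw_pow {d : ℕ} (m : ℕ) (a : Site d) (j : ℕ) (z : Site d) :
    (cubeLaw m a ^ j * cornerLaw d m ^ j).coeff z =
      ∑ b ∈ Fintype.piFinset fun _ : Fin d => Finset.range (j + 1),
        (cubeLaw m a ^ j).coeff (z - scaled m b) * ∏ i, (j.choose (b i) : ℝ) / 2 ^ j := by
  rw [cornerLaw_pow, Finset.mul_sum, AddMonoidAlgebra.coeff_sum, Finsupp.coe_finsetSum,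
    Finset.sum_apply]
  refine Finset.sum_congr rfl fun b _ => ?_
  rw [coeff_mul_single_apply, sub_eq_add_neg]

/-- The corner part gives each lattice point at most mass `binomMode j ^ d`, and the cube part,
summed over the lattice, contributes at most `m^{-d}`. -/
lemma coeff_cubeLaw_mul_cornerLaw_pow_le {d m : ℕ} (hm : 0 < m) (a : Site d) {j : ℕ} (hj : 0 < j)
    (z : Site d) :
    ((cubeLaw m a * cornerLaw d m) ^ j).coeff z ≤ binomMode j ^ d * (1 / (m : ℝ) ^ d) := by
  rw [mul_pow, coeff_cubeLaw_pow_mul_cornerLaw_pow]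
  calc _ ≤ ∑ b ∈ Fintype.piFinset fun _ : Fin d => Finset.range (j + 1),
        (cubeLaw m a ^ j).coeff (z - scaled m b) * binomMode j ^ d := by
        refine Finset.sum_le_sum fun b _ => mul_le_mul_of_nonneg_left ?_
          ((coeffNonneg_cubeLaw m a).pow j _)
        calc ∏ i, (j.choose (b i) : ℝ) / 2 ^ j ≤ ∏ _i : Fin d, binomMode j := by
              refine Finset.prod_le_prod (fun i _ => by positivity) fun i _ => ?_
              unfold binomMode
              gcongr
              exact Nat.choose_le_middle _ _
          _ = _ := by simp
    _ ≤ _ := by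
        rw [← Finset.sum_mul, mul_comm]
        exact mul_le_mul_of_nonneg_left (sum_coeff_cubeLaw_pow_le hm a z _ hj)
          (pow_nonneg (binomMode_nonneg j) d)

/-- The `2 ^ d` translates of the cube of side `m` by the corners tile the cube of side `2 * m`. -/
lemma coeff_cubeLaw_mul_cornerLaw_le {d m : ℕ} (a z : Site d) :
    (cubeLaw m a * cornerLaw d m).coeff z ≤
      if z - a ∈ cube d (2 * m) then 1 / (2 * (m : ℝ)) ^ d else 0 := by
  classical
  have h := coeff_cubeLaw_pow_mul_cornerLaw_pow m a 1 z
  rw [pow_one, pow_one] at h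
  rw [h]
  have h1 : ∀ b ∈ Fintype.piFinset (fun _ : Fin d => Finset.range (1 + 1)),
      (cubeLaw m a).coeff (z - scaled m b) * ∏ i, ((1 : ℕ).choose (b i) : ℝ) / 2 ^ 1 =
      (cubeLaw m a).coeff (z - scaled m b) * (1 / 2 ^ d) := by
    intro b hb
    congr 1
    have h2 : ∏ _i : Fin d, (1 / 2 : ℝ) = 1 / 2 ^ d := by simp
    rw [← h2]
    refine Finset.prod_congr rfl fun i _ => ?_
    have := Fintype.mem_piFinset.1 hb i
    rw [Finset.mem_range] at this
    interval_cases b i <;> simp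
  rw [Finset.sum_congr rfl h1, ← Finset.sum_mul]
  split_ifs with hz
  · calc _ ≤ 1 / (m : ℝ) ^ d * (1 / 2 ^ d) :=
        mul_le_mul_of_nonneg_right (sum_coeff_cubeLaw_le a z _) (by positivity)
      _ = _ := by rw [mul_pow, mul_comm, one_div_mul_one_div]
  · rw [Finset.sum_eq_zero, zero_mul]
    intro b hb
    rw [coeff_cubeLaw, if_neg]
    intro hc
    apply hz
    simp only [cube, Fintype.mem_piFinset, Finset.mem_Ico, scaled, Pi.sub_apply] at hc ⊢
    intro i
    have h2 := Fintype.mem_piFinset.1 hb i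
    rw [Finset.mem_range] at h2
    obtain ⟨h3, h4⟩ := hc i
    push_cast
    interval_cases b i
    · constructor <;> push_cast at h3 h4 <;> omega
    · constructor <;> push_cast at h3 h4 <;> omega

/-- A finitely supported kernel which dominates a multiple of the uniform distribution on a cube of
side `2 * m` satisfies a local upper bound of the order of the local limit theorem. -/
theorem convPow_le_of_cube {d m : ℕ} (hd : 3 ≤ d) (hm : 0 < m) {f : Site d → ℝ}
    (hf : IsSymmKernel f) (hfin : (Function.support f).Finite) (a : Site d) {α A : ℝ}
    (hα0 : 0 < α) (hα1 : α ≤ 1 / 2) (hA : 1 ≤ A) (hup : ∀ z, f z ≤ A / (m : ℝ) ^ d)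
    (hlow : ∀ z, z - a ∈ cube d (2 * m) → α / (2 * (m : ℝ)) ^ d ≤ f z) {k : ℕ} (hk : 0 < k)
    (z : Site d) :
    convPow f k z ≤ 2 * A * (3 / α ^ 3 + 1) / (m : ℝ) ^ d * (k : ℝ) ^ (-(3 / 2) : ℝ) := by
  classical
  have hm' : (0 : ℝ) < m := by exact_mod_cast hm
  have hmd : (0 : ℝ) < (m : ℝ) ^ d := by positivity
  set x : AddMonoidAlgebra ℝ (Site d) := AddMonoidAlgebra.ofCoeff (Finsupp.ofSupportFinite f hfin)
  have hx : ∀ z, x.coeff z = f z := fun z => rfl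
  set U := cubeLaw m a * cornerLaw d m with hU
  -- The kernel is a mixture of `U`, with weight `α`, and a nonnegative remainder `h` of mass `1 -
  -- α`; its `k`-th power is expanded binomially.
  set h := x - α • U with hh
  have hxU : x = α • U + h := by rw [hh]; abel
  have hUmass : totalMass d U = 1 := by
    rw [hU, map_mul, totalMass_cubeLaw hm, totalMass_cornerLaw, one_mul]
  have hxmass : totalMass d x = 1 := by
    rw [totalMass_eq, ← hf.tsum_eq_one, tsum_eq_sum (s := x.coeff.support)]
    · rfl
    · intro y hy
      rw [← hx, Finsupp.notMem_support_iff.1 hy]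
  have hhmass : totalMass d h = 1 - α := by
    rw [hh, map_sub, map_smul, hUmass, hxmass, smul_eq_mul, mul_one]
  have hUnn : CoeffNonneg U := by
    have : CoeffNonneg (cornerLaw d m) := by
      rw [← pow_one (cornerLaw d m), cornerLaw_pow]
      intro z
      rw [AddMonoidAlgebra.coeff_sum, Finsupp.coe_finsetSum, Finset.sum_apply]
      refine Finset.sum_nonneg fun b _ => ?_
      rw [AddMonoidAlgebra.coeff_single, Finsupp.single_apply]
      split_ifs <;> positivity
    exact (coeffNonneg_cubeLaw m a).mul this
  have hhc : ∀ z, h.coeff z = f z - α * U.coeff z := by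
    intro z
    rw [hh, AddMonoidAlgebra.coeff_sub, Finsupp.sub_apply, AddMonoidAlgebra.coeff_smul,
      Finsupp.smul_apply, smul_eq_mul, hx]
  have hhnn : CoeffNonneg h := by
    intro z
    rw [hhc, sub_nonneg]
    have h1 := coeff_cubeLaw_mul_cornerLaw_le (m := m) a z
    split_ifs at h1 with hz
    · refine le_trans (mul_le_mul_of_nonneg_left h1 hα0.le) ?_
      rw [mul_one_div]; exact hlow z hz
    · exact (mul_nonpos_of_nonneg_of_nonpos hα0.le h1).trans (hf.nonneg z)
  have hhup : ∀ z, h.coeff z ≤ A / (m : ℝ) ^ d := by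
    intro z
    rw [hhc]
    have := mul_nonneg hα0.le (hUnn z)
    linarith [hup z]
  have hterm : ∀ j ∈ Finset.range (k + 1), ((α • U) ^ j * h ^ (k - j)).coeff z ≤
      2 * A / (m : ℝ) ^ d * (α ^ j * (1 - α) ^ (k - j) * binomMode j ^ 3) := by
    intro j hj
    have hβ : 0 ≤ 1 - α := by linarith
    -- Without a factor `U` the bound on one factor `h` is used. Its mass `1 - α` is then missing
    -- and is restored by `1 ≤ 2 (1 - α)`, which is where `α ≤ 1 / 2` and the constant `2` enter.
    rcases Nat.eq_zero_or_pos j with rfl | hj0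
    · obtain ⟨i, rfl⟩ := Nat.exists_eq_succ_of_ne_zero hk.ne'
      rw [pow_zero, one_mul, Nat.sub_zero, Nat.succ_eq_add_one, pow_succ]
      have h1 := coeff_mul_le (hhnn.pow i) hhup z
      rw [map_pow, hhmass] at h1
      refine h1.trans ?_
      have h2 : binomMode 0 = 1 := by simp [binomMode]
      rw [h2, pow_zero, one_pow, mul_one, one_mul, pow_succ]
      calc (1 - α) ^ i * (A / (m : ℝ) ^ d) = A / (m : ℝ) ^ d * ((1 - α) ^ i * 1) := by ring
        _ ≤ A / (m : ℝ) ^ d * ((1 - α) ^ i * (2 * (1 - α))) := by gcongr; linarith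
        _ = _ := by ring
    · rw [smul_pow, mul_comm, mul_smul_comm, AddMonoidAlgebra.coeff_smul, Finsupp.smul_apply,
        smul_eq_mul]
      have h1 := coeff_mul_le (hhnn.pow (k - j))
        (coeff_cubeLaw_mul_cornerLaw_pow_le hm a hj0) z
      rw [map_pow, hhmass] at h1
      have hb1 : binomMode j ≤ 1 := by
        have h2 := binomMode_sq_le j
        have h3 : 1 / ((j : ℝ) + 1) ≤ 1 := by
          rw [div_le_one (by positivity)]
          have : (0 : ℝ) ≤ j := Nat.cast_nonneg j
          linarith
        nlinarith [binomMode_nonneg j]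
      have hb : binomMode j ^ d ≤ binomMode j ^ 3 :=
        pow_le_pow_of_le_one (binomMode_nonneg j) hb1 hd
      have hb0 : 0 ≤ binomMode j ^ 3 := pow_nonneg (binomMode_nonneg j) 3
      calc α ^ j * (h ^ (k - j) * U ^ j).coeff z
          ≤ α ^ j * ((1 - α) ^ (k - j) * (binomMode j ^ 3 * (1 / (m : ℝ) ^ d))) := by
            gcongr
            exact h1.trans (by gcongr)
        _ = 1 / (m : ℝ) ^ d * (α ^ j * (1 - α) ^ (k - j) * binomMode j ^ 3) := by ring
        _ ≤ _ := by
            gcongr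
            linarith
  rw [convPow_eq_coeff x hx, hxU, add_pow, AddMonoidAlgebra.coeff_sum, Finsupp.coe_finsetSum,
    Finset.sum_apply]
  have hnat : ∀ (y : AddMonoidAlgebra ℝ (Site d)) (n : ℕ) (z : Site d),
      (y * (n : AddMonoidAlgebra ℝ (Site d))).coeff z = y.coeff z * n := by
    intro y n z
    rw [AddMonoidAlgebra.natCast_def, coeff_mul_single_apply, neg_zero, add_zero]
  calc _ ≤ ∑ j ∈ Finset.range (k + 1), 2 * A / (m : ℝ) ^ d *
        (α ^ j * (1 - α) ^ (k - j) * k.choose j * binomMode j ^ 3) := by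
        refine Finset.sum_le_sum fun j hj => ?_
        rw [hnat]
        refine (mul_le_mul_of_nonneg_right (hterm j hj) (Nat.cast_nonneg _)).trans_eq ?_
        ring
    _ ≤ 2 * A / (m : ℝ) ^ d * ((3 / α ^ 3 + 1) * (k : ℝ) ^ (-(3 / 2) : ℝ)) := by
        rw [← Finset.mul_sum]
        gcongr
        exact sum_binomial_binomMode_le hα0 (by linarith) hk
    _ = _ := by ring

/-! ### Sums of the powers `k^{-3/2}` and of convolutions. -/

/-- With `a`, `b` the two square roots, the right-hand side is `2 / ((a + b) a b)`, and `a ≤ b`. The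
bound telescopes. -/
lemma rpow_neg_three_halves_le {k : ℕ} (hk : 1 ≤ k) :
    ((k + 1 : ℕ) : ℝ) ^ (-(3 / 2) : ℝ) ≤ 2 / √k - 2 / √((k + 1 : ℕ) : ℝ) := by
  have hk' : (0 : ℝ) < k := by exact_mod_cast hk
  set a := √(k : ℝ) with ha
  set b := √((k + 1 : ℕ) : ℝ) with hb
  have ha0 : 0 < a := Real.sqrt_pos.2 hk'
  have hb0 : 0 < b := Real.sqrt_pos.2 (by positivity)
  have ha2 : a ^ 2 = k := Real.sq_sqrt hk'.le
  have hb2 : b ^ 2 = a ^ 2 + 1 := by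
    rw [ha2, hb, Real.sq_sqrt (by positivity)]; push_cast; rfl
  have hab : a ≤ b := Real.sqrt_le_sqrt (by push_cast; linarith)
  have h1 : ((k + 1 : ℕ) : ℝ) ^ (-(3 / 2) : ℝ) = 1 / b ^ 3 := by
    rw [Real.rpow_neg (by positivity), hb, Real.sqrt_eq_rpow, ← Real.rpow_natCast,
      ← Real.rpow_mul (by positivity), one_div]
    norm_num
  have h2 : 2 / a - 2 / b = 2 / ((a + b) * a * b) := by
    have : (b - a) * (a + b) = 1 := by nlinarith
    field_simp
    linarith
  rw [h1, h2, div_le_div_iff₀ (by positivity) (by positivity)]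
  have h3 : (a + b) * a * b ≤ (b + b) * b * b := by gcongr
  nlinarith

lemma sum_Ico_rpow_le {n : ℕ} (hn : 1 ≤ n) (m : ℕ) :
    ∑ k ∈ Finset.Ico (n + 1) m, (k : ℝ) ^ (-(3 / 2) : ℝ) ≤ 2 / √n := by
  rcases le_or_gt m (n + 1) with h | h
  · rw [Finset.Ico_eq_empty_of_le h, Finset.sum_empty]; positivity
  · have key : ∀ m, n + 1 ≤ m + 1 → ∑ k ∈ Finset.Ico (n + 1) (m + 1), (k : ℝ) ^ (-(3 / 2) : ℝ) ≤
        2 / √n - 2 / √m := by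
      intro m hm
      induction m, (Nat.le_of_succ_le_succ hm) using Nat.le_induction with
      | base => simp
      | succ m hm' ih =>
        rw [Finset.sum_Ico_succ_top (by omega)]
        have := rpow_neg_three_halves_le (k := m) (by omega)
        linarith [ih (by omega)]
    obtain ⟨m, rfl⟩ := Nat.exists_eq_succ_of_ne_zero (by omega : m ≠ 0)
    have := key m (by omega)
    have h2 : 0 ≤ 2 / √(m : ℝ) := by positivity
    exact this.trans (by linarith)

lemma sum_Icc_rpow_le (K : ℕ) : ∑ k ∈ Finset.Icc 1 K, (k : ℝ) ^ (-(3 / 2) : ℝ) ≤ 3 := by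
  rcases Nat.eq_zero_or_pos K with rfl | hK
  · simp
  · rw [show Finset.Icc 1 K = Finset.Ico 1 (K + 1) from rfl,
      Finset.sum_eq_sum_Ico_succ_bot (by omega)]
    have := sum_Ico_rpow_le le_rfl (K + 1)
    norm_num at this ⊢
    linarith

lemma sum_mul_rpow_le (K : ℕ) :
    ∑ k ∈ Finset.Icc 1 K, (k : ℝ) * (k : ℝ) ^ (-(3 / 2) : ℝ) ≤ 2 * √K := by
  induction K with
  | zero => simp
  | succ K ih =>
    rw [Finset.sum_Icc_succ_top (by omega)]
    have hK : (0 : ℝ) < ((K + 1 : ℕ) : ℝ) := by positivity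
    set a := √(K : ℝ) with ha
    set b := √((K + 1 : ℕ) : ℝ) with hb
    have ha0 : 0 ≤ a := Real.sqrt_nonneg _
    have hb0 : 0 < b := Real.sqrt_pos.2 hK
    have ha2 : a ^ 2 = K := Real.sq_sqrt (Nat.cast_nonneg K)
    have hb2 : b ^ 2 = a ^ 2 + 1 := by
      rw [ha2, hb, Real.sq_sqrt hK.le]; push_cast; rfl
    have h1 : ((K + 1 : ℕ) : ℝ) * ((K + 1 : ℕ) : ℝ) ^ (-(3 / 2) : ℝ) = 1 / b := by
      nth_rewrite 1 [← Real.rpow_one ((K + 1 : ℕ) : ℝ)]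
      rw [← Real.rpow_add hK, hb, Real.sqrt_eq_rpow, one_div, ← Real.rpow_neg hK.le]
      norm_num
    have h2 : 1 / b ≤ 2 * b - 2 * a := by
      rw [div_le_iff₀ hb0]
      nlinarith [sq_nonneg (b - a)]
    rw [h1]
    linarith

/-- The map `(k, j) ↦ (j, k - j)` embeds the index set into the square of `[1, K]`. -/
lemma sum_conv_le {q : ℕ → ℝ} (hq : ∀ k, 0 ≤ q k) (K : ℕ) :
    ∑ k ∈ Finset.Icc 2 K, ∑ j ∈ Finset.Ioo 0 k, q j * q (k - j) ≤
      (∑ j ∈ Finset.Icc 1 K, q j) ^ 2 := by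
  rw [sq, Finset.sum_mul_sum, ← Finset.sum_product', Finset.sum_sigma']
  have hinj : Set.InjOn (fun x : (_ : ℕ) × ℕ => (x.2, x.1 - x.2))
      ((Finset.Icc 2 K).sigma fun k => Finset.Ioo 0 k : Finset ((_ : ℕ) × ℕ)) := by
    rintro ⟨k, j⟩ hx ⟨k', j'⟩ hx' h
    simp only [Finset.coe_sigma, Set.mem_sigma_iff, Finset.mem_coe, Finset.mem_Ioo] at hx hx'
    simp only [Prod.mk.injEq] at h
    obtain ⟨rfl, h2⟩ := h
    have : k = k' := by omega
    subst this; rfl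
  rw [← Finset.sum_image (f := fun y : ℕ × ℕ => q y.1 * q y.2) hinj]
  refine Finset.sum_le_sum_of_subset_of_nonneg ?_ fun _ _ _ => mul_nonneg (hq _) (hq _)
  intro y hy
  obtain ⟨⟨k, j⟩, hx, rfl⟩ := Finset.mem_image.1 hy
  simp only [Finset.mem_sigma, Finset.mem_Icc, Finset.mem_Ioo, Finset.mem_product] at hx ⊢
  omega

lemma sum_range_le_of_tail {q : ℕ → ℝ} {c : ℝ} (hq : ∀ k, 0 ≤ q k) (hc : 0 ≤ c)
    (hqc : ∀ k, 0 < k → q k ≤ c * (k : ℝ) ^ (-(3 / 2) : ℝ)) {K : ℕ} (hK : 1 ≤ K) (n : ℕ) :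
    ∑ i ∈ Finset.range n, q (i + 2) ≤ ∑ k ∈ Finset.Icc 2 K, q k + 2 * c / √K := by
  have h1 : ∑ i ∈ Finset.range n, q (i + 2) = ∑ k ∈ Finset.Ico 2 (n + 2), q k := by
    rw [Finset.sum_Ico_eq_sum_range, Nat.add_sub_cancel]
    exact Finset.sum_congr rfl fun i _ => by rw [add_comm]
  have hsub : Finset.Ico 2 (n + 2) ⊆ Finset.Icc 2 K ∪ Finset.Ico (K + 1) (n + 2) := by
    intro k hk
    simp only [Finset.mem_union, Finset.mem_Icc, Finset.mem_Ico] at hk ⊢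
    omega
  have hdisj : Disjoint (Finset.Icc 2 K) (Finset.Ico (K + 1) (n + 2)) := by
    rw [Finset.disjoint_left]
    intro k hk hk'
    simp only [Finset.mem_Icc, Finset.mem_Ico] at hk hk'
    omega
  rw [h1]
  refine (Finset.sum_le_sum_of_subset_of_nonneg hsub fun k _ _ => hq k).trans ?_
  rw [Finset.sum_union hdisj]
  gcongr
  calc ∑ k ∈ Finset.Ico (K + 1) (n + 2), q k
      ≤ ∑ k ∈ Finset.Ico (K + 1) (n + 2), c * (k : ℝ) ^ (-(3 / 2) : ℝ) :=
        Finset.sum_le_sum fun k hk => hqc k (by have := (Finset.mem_Ico.1 hk).1; omega)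
    _ ≤ c * (2 / √K) := by
        rw [← Finset.mul_sum]
        exact mul_le_mul_of_nonneg_left (sum_Ico_rpow_le hK _) hc
    _ = _ := by ring

/-! ### The threshold bound for kernels with decay `k^{-3/2}`. -/

/-- The lower bound on the second threshold for kernels whose convolution powers satisfy the
upper bound `f^{*k} ≤ C k^{-3/2} / D`. -/
theorem le_secondThreshold_of_convPow_le {d : ℕ} {f : Site d → ℝ} (hf : IsSymmKernel f) {C : ℝ}
    (hC : 1 ≤ C) {D : ℕ} (hD : 3 * C ≤ D)
    (hconv : ∀ k, 0 < k → ∀ z, convPow f k z ≤ C / D * (k : ℝ) ^ (-(3 / 2) : ℝ)) :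
    Summable (fun k : ℕ => convPow f (2 * (k + 2)) 0) ∧
      1 + Real.log 2 * (∑' k : ℕ, convPow f (2 * (k + 2)) 0) -
        (2 * C + 9 * C ^ 2 + 24 * Real.exp (3 * C) ^ 2 * C ^ 2) / √D ^ 3 ≤ secondThreshold f := by
  have hC0 : 0 < C := by linarith
  have hD0 : (0 : ℝ) < D := by linarith
  have hD1 : 1 ≤ D := by exact_mod_cast hD0
  set s := √(D : ℝ) with hs
  have hs2 : s ^ 2 = D := Real.sq_sqrt hD0.le
  have hs0 : 0 < s := Real.sqrt_pos.2 hD0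
  have hs1 : 1 ≤ s := Real.one_le_sqrt.2 (by exact_mod_cast hD1)
  set q : ℕ → ℝ := fun k => convPow f (2 * k) 0 with hq
  have hq0 : ∀ k, 0 ≤ q k := fun k => convPow_nonneg hf.nonneg _ _
  have hqc : ∀ k, 0 < k → q k ≤ C / D * (k : ℝ) ^ (-(3 / 2) : ℝ) := by
    intro k hk
    refine (hconv (2 * k) (by omega) 0).trans ?_
    gcongr ?_ * ?_
    refine Real.rpow_le_rpow_of_nonpos (by exact_mod_cast hk) ?_ (by norm_num)
    push_cast
    have : (0 : ℝ) ≤ k := Nat.cast_nonneg k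
    linarith
  have hCD : 0 ≤ C / D := by positivity
  have hsum1 : ∑ k ∈ Finset.Icc 1 D, q k ≤ 3 * C / D := by
    calc ∑ k ∈ Finset.Icc 1 D, q k ≤ ∑ k ∈ Finset.Icc 1 D, C / D * (k : ℝ) ^ (-(3 / 2) : ℝ) :=
          Finset.sum_le_sum fun k hk => hqc k (Finset.mem_Icc.1 hk).1
      _ ≤ C / D * 3 := by
          rw [← Finset.mul_sum]
          exact mul_le_mul_of_nonneg_left (sum_Icc_rpow_le D) hCD
      _ = _ := by ring
  have hrange3 : ∀ n, ∑ i ∈ Finset.range n, q (i + 2) ≤ 3 * C / D := by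
    intro n
    have h1 := sum_range_le_of_tail hq0 hCD hqc le_rfl n
    rw [show Finset.Icc 2 1 = ∅ from rfl, Finset.sum_empty, Nat.cast_one, Real.sqrt_one, zero_add,
      div_one] at h1
    refine h1.trans ?_
    rw [← mul_div_assoc]
    gcongr
    norm_num
  have hsummable : Summable fun k => q (k + 2) :=
    summable_of_sum_range_le (fun k => hq0 _) hrange3
  refine ⟨hsummable, ?_⟩
  change 1 + Real.log 2 * (∑' k : ℕ, q (k + 2)) - _ / s ^ 3 ≤ _
  set σ := ∑' k, q (k + 2) with hσ
  have hσ0 : 0 ≤ σ := tsum_nonneg fun k => hq0 _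
  have hσ3 : σ ≤ 3 * C / D := Real.tsum_le_of_sum_range_le (fun k => hq0 _) hrange3
  have hσK : σ ≤ ∑ k ∈ Finset.Icc 2 D, q k + 2 * C / s ^ 3 := by
    refine Real.tsum_le_of_sum_range_le (fun k => hq0 _) fun n => ?_
    have hCs : 2 * (C / (D : ℝ)) / s = 2 * C / s ^ 3 := by
      rw [← mul_div_assoc, div_div, pow_succ s 2, hs2]
    exact (sum_range_le_of_tail hq0 hCD hqc hD1 n).trans_eq (by rw [hCs])
  have hl0 : 0 < Real.log 2 := Real.log_pos (by norm_num)
  have hl1 : Real.log 2 ≤ 1 := by linarith [Real.log_two_lt_d9]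
  set P := Real.exp (3 * C) with hP
  set E := 2 * C + 9 * C ^ 2 + 24 * P ^ 2 * C ^ 2 with hE
  have hE0 : 0 ≤ E / s ^ 3 := by positivity
  have hx : 1 + Real.log 2 * σ - E / s ^ 3 ≤ 1 + 3 * C / D := by
    have : Real.log 2 * σ ≤ 1 * (3 * C / D) := by gcongr
    linarith
  have hmax : 1 + Real.log 2 * σ - E / s ^ 3 ≤ pMax f := by
    refine le_pMax ?_ fun z hz => hx.trans ?_
    · by_contra! hcon
      have : ∀ z, f z = 0 := fun z => le_antisymm (hcon z) (hf.nonneg z)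
      have h1 := hf.tsum_eq_one
      simp [this] at h1
    · have h1 : f z ≤ C / D := by
        have h2 := hconv 1 one_pos z
        have h3 := stepLaw_eq_convPow hf 1 z
        rw [stepLaw_one, ENNReal.ofReal_eq_ofReal_iff (hf.nonneg z)
          (convPow_nonneg hf.nonneg _ _)] at h3
        rw [h3]
        simpa using h2
      rw [le_div_iff₀ hz]
      have h2 : 3 * C / D ≤ 1 := by rwa [div_le_one hD0]
      have h3 : (1 + 3 * C / D) * f z ≤ 2 * (C / D) := by
        have : (0 : ℝ) ≤ 3 * C / D := by positivity
        gcongr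
        linarith
      have h4 : 2 * (C / D) ≤ 3 * C / D := by
        rw [← mul_div_assoc]; gcongr; norm_num
      linarith
  -- The cutoff `K = D` balances the errors: the neglected tail and the loss from ears are both of
  -- order `D^{-3/2}`.
  refine le_secondThreshold hf hmax D (b := fun l => C / D * (l : ℝ) ^ (-(3 / 2) : ℝ))
    (fun l => by positivity) (fun l hl z => hconv l (Finset.mem_Icc.1 hl).1 z) fun p hp1 hpx => ?_
  have hp0 : 0 < p := by linarith
  -- The range of `p` ends below `1 + 3 C / D`, so powers up to the cutoff stay bounded by `exp (3
  -- C)`.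
  have hpow : ∀ k ≤ D, p ^ k ≤ P := by
    intro k hk
    calc p ^ k ≤ p ^ D := pow_le_pow_right₀ hp1 hk
      _ ≤ Real.exp (3 * C / D) ^ D := by
          gcongr
          have := Real.add_one_le_exp (3 * C / D)
          linarith
      _ = P := by
          rw [← Real.exp_nat_mul, hP]
          congr 1
          field_simp
  have hP0 : 0 < P := Real.exp_pos _
  set g : ℕ → ℝ := fun k => (firstMeet f k).toReal with hg
  have hg0 : ∀ k, 0 ≤ g k := fun k => ENNReal.toReal_nonneg
  have hgq : ∀ k, g k ≤ q k := fun k => firstMeet_le hf k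
  set B := ∑ l ∈ Finset.Icc 1 D, p ^ l * (C / D * (l : ℝ) ^ (-(3 / 2) : ℝ)) with hB
  have hB0 : 0 ≤ B := Finset.sum_nonneg fun l _ => by positivity
  have hB1 : B ≤ 3 * P * C / s ^ 2 := by
    calc B ≤ ∑ l ∈ Finset.Icc 1 D, P * (C / D * (l : ℝ) ^ (-(3 / 2) : ℝ)) := by
          refine Finset.sum_le_sum fun l hl => ?_
          gcongr
          exact hpow l (Finset.mem_Icc.1 hl).2
      _ ≤ P * (C / D * 3) := by
          rw [← Finset.mul_sum, ← Finset.mul_sum]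
          gcongr
          exact sum_Icc_rpow_le D
      _ = _ := by rw [hs2]; ring
  -- Here `B` is of order `1 / D`, and `∑ k * g k` up to `D` is of order `√D / D`.
  have herr : ∑ k ∈ Finset.Icc 2 D, p ^ k * g k * (4 * k * B) ≤ 24 * P ^ 2 * C ^ 2 / s ^ 3 := by
    have h1 : ∑ k ∈ Finset.Icc 2 D, p ^ k * g k * (4 * k * B) ≤
        ∑ k ∈ Finset.Icc 1 D, 4 * B * P * (C / D) * ((k : ℝ) * (k : ℝ) ^ (-(3 / 2) : ℝ)) := by
      calc _ ≤ ∑ k ∈ Finset.Icc 1 D, p ^ k * g k * (4 * k * B) := by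
            refine Finset.sum_le_sum_of_subset_of_nonneg (Finset.Icc_subset_Icc_left (by norm_num))
              fun k _ _ => ?_
            have := hg0 k
            positivity
        _ ≤ _ := by
            refine Finset.sum_le_sum fun k hk => ?_
            rw [Finset.mem_Icc] at hk
            calc p ^ k * g k * (4 * k * B)
                ≤ P * (C / D * (k : ℝ) ^ (-(3 / 2) : ℝ)) * (4 * k * B) := by
                  have := hg0 k
                  gcongr
                  · exact hpow k hk.2
                  · exact (hgq k).trans (hqc k hk.1)
              _ = _ := by ring
    refine h1.trans ?_
    rw [← Finset.mul_sum]
    calc 4 * B * P * (C / D) * ∑ k ∈ Finset.Icc 1 D, (k : ℝ) * (k : ℝ) ^ (-(3 / 2) : ℝ)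
        ≤ 4 * (3 * P * C / s ^ 2) * P * (C / D) * (2 * s) := by
          gcongr
          exact sum_mul_rpow_le D
      _ = _ := by rw [← hs2]; field_simp; ring
  have hmain : ∑ k ∈ Finset.Icc 2 D, q k - 9 * C ^ 2 / s ^ 3 ≤ ∑ k ∈ Finset.Icc 2 D, g k := by
    have h1 : ∑ k ∈ Finset.Icc 2 D, q k - ∑ k ∈ Finset.Icc 2 D, ∑ j ∈ Finset.Ioo 0 k,
        q j * q (k - j) ≤ ∑ k ∈ Finset.Icc 2 D, g k := by
      rw [← Finset.sum_sub_distrib]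
      exact Finset.sum_le_sum fun k _ => le_firstMeet hf k
    have h2 := sum_conv_le hq0 D
    have h3 : (∑ j ∈ Finset.Icc 1 D, q j) ^ 2 ≤ 9 * C ^ 2 / s ^ 3 := by
      calc (∑ j ∈ Finset.Icc 1 D, q j) ^ 2 ≤ (3 * C / D) ^ 2 :=
            pow_le_pow_left₀ (Finset.sum_nonneg fun _ _ => hq0 _) hsum1 2
        _ = 9 * C ^ 2 / s ^ 4 := by rw [← hs2]; ring
        _ ≤ 9 * C ^ 2 / s ^ 3 := by
            gcongr
            norm_num
    linarith
  have hlow : ∑ k ∈ Finset.Icc 2 D, g k - ∑ k ∈ Finset.Icc 2 D, p ^ k * g k * (4 * k * B) ≤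
      ∑ k ∈ Finset.Icc 2 D, p ^ k * g k * (1 - 4 * k * B) := by
    rw [← Finset.sum_sub_distrib]
    refine Finset.sum_le_sum fun k _ => ?_
    have h1 : g k ≤ p ^ k * g k := le_mul_of_one_le_left (hg0 k) (one_le_pow₀ hp1)
    linarith
  have hall : σ - E / s ^ 3 ≤ ∑ k ∈ Finset.Icc 2 D, p ^ k * g k * (1 - 4 * k * B) := by
    have : E / s ^ 3 = 2 * C / s ^ 3 + 9 * C ^ 2 / s ^ 3 + 24 * P ^ 2 * C ^ 2 / s ^ 3 := by
      rw [hE]; ring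
    linarith
  calc Real.log p ≤ p - 1 := Real.log_le_sub_one_of_pos hp0
    _ < Real.log 2 * σ - E / s ^ 3 := by linarith
    _ ≤ Real.log 2 * (σ - E / s ^ 3) := by nlinarith
    _ ≤ _ := mul_le_mul_of_nonneg_left hall hl0.le

/-! ### The spread-out model. -/

/-- The point reflection is the composition of all coordinate reflections; it makes the kernel
symmetric. -/
lemma apply_neg_of_reflect {d : ℕ} {F : (Fin d → ℝ) → ℝ}
    (h : ∀ (i : Fin d) (x : Fin d → ℝ), F (Function.update x i (-x i)) = F x) (x : Fin d → ℝ) :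
    F (-x) = F x := by
  have key : ∀ s : Finset (Fin d), F (fun i => if i ∈ s then -x i else x i) = F x := by
    intro s
    induction s using Finset.induction_on with
    | empty => simp
    | insert i s hi ih =>
      rw [← ih, ← h i (fun j => if j ∈ s then -x j else x j)]
      congr 1
      ext j
      by_cases hj : j = i
      · subst hj; simp [hi]
      · simp [hj]
  have := key Finset.univ
  simp only [Finset.mem_univ, if_true] at this
  exact this

/-- A continuous, compactly supported, nonnegative function of positive integral is bounded,
supported in a cube and bounded below on some cube. -/
lemma exists_profile_bounds {d : ℕ} {F : (Fin d → ℝ) → ℝ} (hF : Continuous F)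
    (hc : HasCompactSupport F) (h0 : ∀ x, 0 ≤ F x) (hint : ∫ x, F x = 1) :
    ∃ (R : ℕ) (c δ M : ℝ) (x₀ : Fin d → ℝ), 1 ≤ R ∧ 0 < c ∧ 0 < δ ∧
      (∀ x, F x ≠ 0 → ∀ i, |x i| ≤ R) ∧ (∀ x, (∀ i, |x i - x₀ i| ≤ δ) → c ≤ F x) ∧
      ∀ x, F x ≤ M := by
  obtain ⟨x₀, hx₀⟩ : ∃ x, 0 < F x := by
    by_contra! hcon
    have : ∀ x, F x = 0 := fun x => le_antisymm (hcon x) (h0 x)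
    simp [this] at hint
  obtain ⟨M, hM⟩ := hc.exists_bound_of_continuous hF
  obtain ⟨r, hr⟩ := hc.isCompact.isBounded.subset_closedBall 0
  obtain ⟨R, hR⟩ := exists_nat_ge (max r 1)
  have hev : ∀ᶠ x in nhds x₀, F x₀ / 2 < F x :=
    hF.continuousAt.eventually (lt_mem_nhds (half_lt_self hx₀))
  obtain ⟨ε, hε, hball⟩ := Metric.eventually_nhds_iff_ball.1 hev
  refine ⟨R, F x₀ / 2, ε / 2, M, x₀, ?_, half_pos hx₀, half_pos hε, fun x hx i => ?_,
    fun x hx => (hball x ?_).le, fun x => (le_abs_self _).trans (hM x)⟩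
  · exact_mod_cast (le_max_right r 1).trans hR
  · have h1 := hr (subset_tsupport F hx)
    rw [mem_closedBall_zero_iff] at h1
    exact ((norm_le_pi_norm x i).trans h1).trans ((le_max_left r 1).trans hR)
  · rw [Metric.mem_ball]
    refine ((dist_pi_le_iff (half_pos hε).le).2 fun i => ?_).trans_lt (half_lt_self hε)
    rw [Real.dist_eq]
    exact hx i

/-- The convolution powers of the spread-out kernels satisfy an upper bound of the order of the
local limit theorem, uniformly in the range. -/
theorem exists_convPow_spreadOut_le {d : ℕ} (hd : 3 ≤ d) {F : (Fin d → ℝ) → ℝ}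
    (hF : Continuous F) (hc : HasCompactSupport F) (h0 : ∀ x, 0 ≤ F x)
    (hrefl : ∀ (i : Fin d) (x : Fin d → ℝ), F (Function.update x i (-x i)) = F x)
    (hint : ∫ x, F x = 1) :
    ∃ C : ℝ, 1 ≤ C ∧ ∀ᶠ L : ℕ in atTop, IsSymmKernel (spreadOut F L) ∧ ∀ k, 0 < k → ∀ z,
      convPow (spreadOut F L) k z ≤ C / ((L ^ d : ℕ) : ℝ) * (k : ℝ) ^ (-(3 / 2) : ℝ) := by
  obtain ⟨R, c, δ, M, x₀, hR, hc0, hδ, hsupp, hlow, hM⟩ := exists_profile_bounds hF hc h0 hint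
  have hM0 : 0 < M := hc0.trans_le
    ((hlow x₀ fun i => by simpa using hδ.le).trans (hM x₀))
  have hR0 : (0 : ℝ) < R := by exact_mod_cast hR
  set A := max 1 (M / c) with hA
  -- The fraction compares the mass `c (2m)^d` on the cube, where `2 m ≥ δ L / 2`, with the bound
  -- `(3 R L)^d M` on the normalization; the factors `L ^ d` cancel.
  set α := min (1 / 2) (c * (δ / 2) ^ d / ((3 * R) ^ d * M)) with hα
  have hα0 : 0 < α := lt_min (by norm_num) (by positivity)
  have hA1 : 1 ≤ A := le_max_left _ _
  refine ⟨max 1 (2 * A * (3 / α ^ 3 + 1) * (4 / δ) ^ d), le_max_left _ _, ?_⟩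
  filter_upwards [eventually_ge_atTop (max 1 ⌈4 / δ⌉₊)] with L hL
  have hL0 : 0 < L := (le_max_left _ _).trans hL
  have hL' : (0 : ℝ) < L := by exact_mod_cast hL0
  have hδL : 4 ≤ δ * L := by
    have h1 : 4 / δ ≤ L := (Nat.le_ceil _).trans (by exact_mod_cast (le_max_right _ _).trans hL)
    rwa [div_le_iff₀ hδ, mul_comm] at h1
  -- Since `δ L ≥ 4`, the floor satisfies `m ≥ δ L / 4 > 0`, while `2 m ≤ δ L` keeps the cube where
  -- `F ≥ c`.
  set m := ⌊δ * L / 2⌋₊ with hm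
  have hm1 : (m : ℝ) ≤ δ * L / 2 := Nat.floor_le (by positivity)
  have hm2 : δ * L / 4 ≤ m := by
    have := Nat.lt_floor_add_one (δ * L / 2)
    rw [← hm] at this
    linarith
  have hm0' : (0 : ℝ) < m := by linarith
  have hm0 : 0 < m := by exact_mod_cast hm0'
  set G : Site d → ℝ := fun y => F fun i => (y i : ℝ) / L with hG
  set a : Site d := fun i => ⌈L * x₀ i⌉ with ha
  set b : Finset (Site d) := Fintype.piFinset fun _ => Finset.Icc (-(R * L : ℤ)) (R * L) with hb
  have hGb : ∀ y ∉ b, G y = 0 := by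
    intro y hy
    by_contra hne
    refine hy (Fintype.mem_piFinset.2 fun i => Finset.mem_Icc.2 (abs_le.1 ?_))
    have h1 := hsupp _ hne i
    rw [abs_div, abs_of_pos hL', div_le_iff₀ hL'] at h1
    exact_mod_cast h1
  have hGlow : ∀ z, z - a ∈ cube d (2 * m) → c ≤ G z := by
    intro z hz
    refine hlow _ fun i => ?_
    have h1 := Finset.mem_Ico.1 (Fintype.mem_piFinset.1 hz i)
    simp only [Pi.sub_apply, ha] at h1
    have h2 := Int.le_ceil (L * x₀ i)
    have h3 := Int.ceil_lt_add_one (L * x₀ i)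
    have h4 : ((⌈L * x₀ i⌉ : ℤ) : ℝ) ≤ z i := by exact_mod_cast sub_nonneg.1 h1.1
    have h5 : (z i : ℝ) + 1 ≤ ⌈L * x₀ i⌉ + 2 * m := by
      have : z i + 1 ≤ ⌈L * x₀ i⌉ + 2 * m := by
        have := h1.2
        push_cast at this
        linarith
      exact_mod_cast this
    have h6 : (z i : ℝ) / L - x₀ i = (z i - L * x₀ i) / L := by field_simp
    rw [h6, abs_div, abs_of_pos hL', div_le_iff₀ hL', abs_of_nonneg (by linarith)]
    linarith
  have hGsum : HasSum G (∑ y ∈ b, G y) := hasSum_sum_of_ne_finset_zero hGb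
  set N := ∑' y, G y with hN
  have hNb : N = ∑ y ∈ b, G y := hGsum.tsum_eq
  have hG0 : ∀ y, 0 ≤ G y := fun y => h0 _
  have hNup : N ≤ (3 * R * L) ^ d * M := by
    have hcard : (b.card : ℝ) ≤ (3 * R * L) ^ d := by
      rw [hb, Fintype.card_piFinset_const, Int.card_Icc]
      push_cast
      gcongr
      have h1 : ((R * L + 1 - -(R * L : ℤ)).toNat : ℤ) ≤ 3 * R * L := by
        have : (1 : ℤ) ≤ R * L := by exact_mod_cast Nat.mul_pos hR hL0
        rw [Int.toNat_of_nonneg (by linarith)]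
        linarith
      exact_mod_cast h1
    calc N ≤ ∑ _y ∈ b, M := hNb.trans_le (Finset.sum_le_sum fun y _ => hM _)
      _ = b.card * M := by rw [Finset.sum_const, nsmul_eq_mul]
      _ ≤ _ := by gcongr
  have hNlow : (2 * (m : ℝ)) ^ d * c ≤ N := by
    calc (2 * (m : ℝ)) ^ d * c = ∑ v ∈ cube d (2 * m), c := by
          rw [Finset.sum_const, card_cube, nsmul_eq_mul]; push_cast; rfl
      _ ≤ ∑ v ∈ cube d (2 * m), G (v + a) :=
          Finset.sum_le_sum fun v hv => hGlow _ (by rwa [add_sub_cancel_right])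
      _ = ∑ z ∈ (cube d (2 * m)).map (addRightEmbedding a), G z := by
          rw [Finset.sum_map]; rfl
      _ ≤ N := hGsum.summable.sum_le_tsum _ fun y _ => hG0 y
  have hN0 : 0 < N := lt_of_lt_of_le (by positivity) hNlow
  have hfG : ∀ z, spreadOut F L z = G z / N := fun z => rfl
  have hkernel : IsSymmKernel (spreadOut F L) := by
    refine ⟨fun z => div_nonneg (hG0 z) hN0.le, ?_, fun z => ?_⟩
    · simp only [hfG]
      rw [← ENNReal.ofReal_tsum_of_nonneg (fun z => div_nonneg (hG0 z) hN0.le)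
        (hGsum.summable.div_const N), tsum_div_const, div_self hN0.ne', ENNReal.ofReal_one]
    · rw [hfG, hfG]
      congr 1
      rw [hG]
      simp only
      rw [← apply_neg_of_reflect hrefl]
      congr 1
      ext i
      simp [neg_div]
  refine ⟨hkernel, fun k hk z => ?_⟩
  have hfin : (Function.support (spreadOut F L)).Finite := by
    refine b.finite_toSet.subset fun z hz => ?_
    by_contra hzb
    exact hz (by rw [hfG, hGb z hzb, zero_div])
  have hup : ∀ z, spreadOut F L z ≤ A / (m : ℝ) ^ d := by
    intro z
    rw [hfG, div_le_div_iff₀ hN0 (by positivity)]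
    have h1 : M ≤ A * c := by rw [← div_le_iff₀ hc0]; exact le_max_right _ _
    calc G z * (m : ℝ) ^ d ≤ (A * c) * (2 * (m : ℝ)) ^ d := by
          have := hm0'.le
          gcongr
          · exact (hM _).trans h1
          · linarith
      _ = A * ((2 * (m : ℝ)) ^ d * c) := by ring
      _ ≤ A * N := by gcongr
  have hlow' : ∀ z, z - a ∈ cube d (2 * m) → α / (2 * (m : ℝ)) ^ d ≤ spreadOut F L z := by
    intro z hz
    rw [hfG, div_le_div_iff₀ (by positivity) hN0]
    calc α * N ≤ (c * (δ / 2) ^ d / ((3 * R) ^ d * M)) * ((3 * R * L) ^ d * M) := by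
          gcongr
          exact min_le_right _ _
      _ = c * (δ * L / 2) ^ d := by
          rw [mul_pow (3 * (R : ℝ)) L, show δ * (L : ℝ) / 2 = δ / 2 * L by ring,
            mul_pow (δ / 2) (L : ℝ)]
          field_simp
      _ ≤ G z * (2 * (m : ℝ)) ^ d := by
          gcongr
          · exact hG0 z
          · exact hGlow z hz
          · linarith
  refine (convPow_le_of_cube hd hm0 hkernel hfin a hα0 (min_le_left _ _) hA1 hup hlow' hk z).trans
    (mul_le_mul_of_nonneg_right ?_ (by positivity))
  calc 2 * A * (3 / α ^ 3 + 1) / (m : ℝ) ^ d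
      ≤ 2 * A * (3 / α ^ 3 + 1) / (δ * L / 4) ^ d := by gcongr
    _ = 2 * A * (3 / α ^ 3 + 1) * (4 / δ) ^ d / ((L ^ d : ℕ) : ℝ) := by
        push_cast
        rw [div_pow 4 δ, div_pow, mul_pow]
        field_simp
    _ ≤ _ := by gcongr; exact le_max_right _ _

/-- The lower bound on the second threshold of the spread-out models. -/
theorem secondThreshold_spreadOut_asymptotics {d : ℕ} (hd : 3 ≤ d) {F : (Fin d → ℝ) → ℝ}
    (hF : Continuous F) (hc : HasCompactSupport F) (h0 : ∀ x, 0 ≤ F x)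
    (hrefl : ∀ (i : Fin d) (x : Fin d → ℝ), F (Function.update x i (-x i)) = F x)
    (hint : ∫ x, F x = 1) :
    ∃ r : ℕ → ℝ, r =O[atTop] (fun L : ℕ => (L : ℝ) ^ (-(3 * (d : ℝ) / 2))) ∧
      ∀ᶠ L : ℕ in atTop,
        Summable (fun k : ℕ => convPow (spreadOut F L) (2 * (k + 2)) 0) ∧
        1 + Real.log 2 * (∑' k : ℕ, convPow (spreadOut F L) (2 * (k + 2)) 0) + r L
          ≤ secondThreshold (spreadOut F L) := by
  obtain ⟨C, hC, hev⟩ := exists_convPow_spreadOut_le hd hF hc h0 hrefl hint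
  set K := 2 * C + 9 * C ^ 2 + 24 * Real.exp (3 * C) ^ 2 * C ^ 2 with hK
  refine ⟨fun L => -K * (L : ℝ) ^ (-(3 * (d : ℝ) / 2)),
    (isBigO_refl _ _).const_mul_left _, ?_⟩
  filter_upwards [hev, eventually_ge_atTop (max 1 ⌈3 * C⌉₊)] with L ⟨hker, hconv⟩ hL
  have hL1 : 1 ≤ L := (le_max_left _ _).trans hL
  have hD : 3 * C ≤ ((L ^ d : ℕ) : ℝ) := by
    have h1 : 3 * C ≤ (L : ℝ) :=
      (Nat.le_ceil _).trans (by exact_mod_cast (le_max_right _ _).trans hL)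
    refine h1.trans ?_
    exact_mod_cast Nat.le_self_pow (by omega) L
  obtain ⟨h1, h2⟩ := le_secondThreshold_of_convPow_le hker hC hD hconv
  refine ⟨h1, le_trans (le_of_eq ?_) h2⟩
  have hL0 : (0 : ℝ) ≤ L := Nat.cast_nonneg L
  -- The general bound is applied with `D = L ^ d`, so the error `D^{-3/2}` is `L^{-3d/2}`.
  have hpow : √((L ^ d : ℕ) : ℝ) ^ 3 = (L : ℝ) ^ (3 * (d : ℝ) / 2) := by
    rw [Real.sqrt_eq_rpow, Nat.cast_pow, ← Real.rpow_natCast, ← Real.rpow_natCast,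
      ← Real.rpow_mul hL0, ← Real.rpow_mul hL0]
    congr 1
    push_cast
    ring
  rw [hpow, Real.rpow_neg hL0, ← hK]
  ring

theorem theorem1 :
    (∃ r : ℕ → ℝ, r =o[atTop] (fun d : ℕ => ((d : ℝ) ^ 2)⁻¹) ∧
      ∀ᶠ d : ℕ in atTop,
        1 + Real.log 2 / (2 * (d : ℝ) ^ 2) + r d ≤ secondThreshold (nearestNeighbor d)) ∧
    (∀ (d : ℕ), 3 ≤ d → ∀ (F : (Fin d → ℝ) → ℝ), Continuous F → HasCompactSupport F →
      (∀ x, 0 ≤ F x) →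
      (∀ (i : Fin d) (x : Fin d → ℝ), F (Function.update x i (-x i)) = F x) →
      (∫ x, F x = 1) →
      ∃ r : ℕ → ℝ, r =O[atTop] (fun L : ℕ => (L : ℝ) ^ (-(3 * (d : ℝ) / 2))) ∧
        ∀ᶠ L : ℕ in atTop,
          Summable (fun k : ℕ => convPow (spreadOut F L) (2 * (k + 2)) 0) ∧
          1 + Real.log 2 * (∑' k : ℕ, convPow (spreadOut F L) (2 * (k + 2)) 0) + r L
            ≤ secondThreshold (spreadOut F L)) :=
  ⟨secondThreshold_nearestNeighbor_asymptotics,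
    fun _ hd _ hF hc h0 hrefl hint =>
      secondThreshold_spreadOut_asymptotics hd hF hc h0 hrefl hint⟩
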